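/- Let $k$ be an algebraically closed field of characteristic zero. Order monomials of equal degree lexicographically with $x_4>x_3>x_2>x_1$. Consider relations \[ \begin{aligned} r_1&=x_3^2-f_1, & r_2&=x_3x_1-f_2, & r_3&=x_3x_2-f_3 &&\text{in } k\langle x_1,x_2,x_3\rangle,\\ r_4&=x_4x_1-f_4, & r_5&=x_4x_2-f_5, & r_6&=x_4^2-f_6 &&\text{in } k\langle x_1,x_2,x_4\rangle,\\ r_7&=x_2^2x_1-f_7, & r_8&=x_2x_1^2-f_8 && &&\text{in } k\langle x_1,x_2\rangle, \end{aligned} \] where each $f_i$ is a linear combination of monomials, in the variables of the indicated free algebra, of the same degree as the displayed leading monomial of $r_i$ and strictly smaller than it. Put $A=k\langle x_1,x_2,x_3\rangle/(r_1,r_2,r_3)$, $B=k\langle x_1,x_2,x_4\rangle/(r_4,r_5,r_6)$ and $C=k\langle x_1,x_2\rangle/(r_7,r_8)$. Assume that $A$, $B$, $C$ are Artin-Schelter regular of global dimension three and that $x_1\mapsto x_1$, $x_2\mapsto x_2$ define injective algebra maps $C\hookrightarrow A$ and $C\hookrightarrow B$. The pushout $D$ of these two inclusions in the category of $k$-algebras,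 that is, $D=k\langle x_1,x_2,x_3,x_4\rangle/(r_1,\dots,r_6)$, is called a type A algebra. Let $R$ and $T$ be the $4\times 6$ and $6\times 4$ matrices of linear forms with $XR=[r_1,\dots,r_6]$ and $TX^t=[r_1,\dots,r_6]^t$ in the free algebra, where $X=[x_1,x_2,x_3,x_4]$. One says that $D$ has a potential resolution if there is an invertible $6\times 6$ matrix $S$ over $k$ with $RST=0$ in $D$, that is, such that \[ 0\to D(-4)\xrightarrow{X^t}D(-3)^{\oplus 4}\xrightarrow{ST}D(-2)^{\oplus 6}\xrightarrow{R}D(-1)^{\oplus 4}\xrightarrow{X}D\to k_D\to 0 \] is a complex of right $D$-modules. Theorem. If a type A algebra $D$ has a potential resolution, then $\operatorname{gldim} D=4$ (both the right and the left global dimension of $D$ equal $4$). -/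

import Mathlib

open CategoryTheory CategoryTheory.Abelian

universe u

namespace TypeA

noncomputable section

/-! ### Words, graded pieces, and presented algebras -/

/-- The monomial `x_{w₁} x_{w₂} ⋯ x_{wₙ}` attached to a word `w` in the letters `ι`. -/
def word {R ι : Type*} [Monoid R] (x : ι → R) (w : List ι) : R :=
  (w.map x).prod

/-- The `k`-span of all monomials of length `n` in the elements `x`: the piece of degree `n` of an
algebra generated in degree one by `x`. -/
def degreePart (k : Type*) {R ι : Type*} [Field k] [Ring R] [Algebra k R] (x : ι → R) (n : ℕ) :
    Submodule k R :=
  Submodule.span k {y | ∃ w : List ι, w.length = n ∧ word x w = y}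

/-- The forms in the free algebra all of whose monomials have the same degree as the monomial
`lead` and are strictly smaller than it, in the lexicographic order determined by
`x_0 < x_1 < ⋯ < x_{n-1}`. -/
def lowerForms (k : Type*) [Field k] {n : ℕ} (lead : List (Fin n)) :
    Submodule k (FreeAlgebra k (Fin n)) :=
  Submodule.span k
    {y | ∃ w : List (Fin n), w.length = lead.length ∧ w < lead ∧ word (FreeAlgebra.ι k) w = y}

/-- The algebra `k⟨x_j : j ∈ X⟩ / (r_i : i ∈ I)`, the quotient by a two-sided ideal. -/
abbrev Presented {k : Type*} [Field k] {X I : Type*} (r : I → FreeAlgebra k X) :=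
  RingQuot (fun a b : FreeAlgebra k X => ∃ i, a = r i ∧ b = 0)

/-- The class of the `j`-th variable in `k⟨x_j⟩ / (r_i)`. -/
def gen {k : Type*} [Field k] {X I : Type*} (r : I → FreeAlgebra k X) (j : X) : Presented r :=
  RingQuot.mkAlgHom k _ (FreeAlgebra.ι k j)

/-! ### Global dimension -/

/-- The left global dimension of a ring: the supremum of the projective dimensions of all
left modules. -/
def leftGlobalDimension (R : Type u) [Ring R] : WithBot ℕ∞ :=
  ⨆ M : ModuleCat.{u} R, projectiveDimension M

/-- The right global dimension of a ring; right modules are left modules over the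
opposite ring. -/
def rightGlobalDimension (R : Type u) [Ring R] : WithBot ℕ∞ :=
  leftGlobalDimension Rᵐᵒᵖ

/-- `gldim R = d`, on both sides. -/
def HasGlobalDimension (R : Type u) [Ring R] (d : ℕ) : Prop :=
  rightGlobalDimension R = (d : ℕ∞) ∧ leftGlobalDimension R = (d : ℕ∞)

/-! ### Artin-Schelter regular algebras -/

section Regular

variable {k : Type u} [Field k] {R : Type u} [Ring R] [Algebra k R]

/-- The trivial left module `R / R_{≥ 1}` of a connected graded algebra. -/
abbrev trivialModule (𝒟 : ℕ → Submodule k R) : ModuleCat.{u} R :=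
  ModuleCat.of R (R ⧸ Submodule.span R {a : R | ∃ n, 1 ≤ n ∧ a ∈ 𝒟 n})

/-- The right action of `R` on `Ext^i_R(M, R)` for a left module `M`, through the right
multiplications `r ↦ r * a` of the left module `R`. -/
def extSMul {M : ModuleCat.{u} R} {i : ℕ} (e : Ext M (ModuleCat.of R R) i) (a : R) :
    Ext M (ModuleCat.of R R) i :=
  e.comp (Ext.mk₀ (ModuleCat.ofHom (LinearMap.toSpanSingleton R R a))) (add_zero i)

/-- The Gorenstein condition for the left trivial module: `Ext^i_R(k, R) = 0` for `i ≠ d`, and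
`Ext^d_R(k, R)` is isomorphic, as a right module, to the trivial module `k`. -/
def IsGorensteinLeft (𝒟 : ℕ → Submodule k R) (d : ℕ) : Prop :=
  (∀ i, i ≠ d → Subsingleton (Ext (trivialModule 𝒟) (ModuleCat.of R R) i)) ∧
  ∃ φ : k ≃+ Ext (trivialModule 𝒟) (ModuleCat.of R R) d,
    (∀ c c' : k, φ (c * c') = extSMul (φ c) (algebraMap k R c')) ∧
    ∀ (c : k) (n : ℕ) (a : R), 1 ≤ n → a ∈ 𝒟 n → extSMul (φ c) a = 0

/-- The grading of the opposite algebra. -/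
def opGrading (𝒟 : ℕ → Submodule k R) (n : ℕ) : Submodule k Rᵐᵒᵖ :=
  (𝒟 n).map (MulOpposite.opLinearEquiv k : R ≃ₗ[k] Rᵐᵒᵖ).toLinearMap

/-- The algebra `R`, with the grading `𝒟`, is a connected graded algebra that is
Artin-Schelter regular of global dimension `d`. -/
structure IsASRegular (𝒟 : ℕ → Submodule k R) (d : ℕ) : Prop where
  gradedMonoid : SetLike.GradedMonoid 𝒟
  isInternal : DirectSum.IsInternal 𝒟
  connected : Module.finrank k (𝒟 0) = 1
  globalDimension : HasGlobalDimension R d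
  finiteDimensional : ∀ n, Module.Finite k (𝒟 n)
  growth : ∃ c : ℝ, 0 < c ∧ ∀ n : ℕ, 1 ≤ n → (Module.finrank k (𝒟 n) : ℝ) < c * (n : ℝ) ^ c
  gorensteinLeft : IsGorensteinLeft 𝒟 d
  gorensteinRight : IsGorensteinLeft (opGrading 𝒟) d

end Regular

/-! ### Type A algebras -/

/-- The forms `f₁, …, f₈` in the relations of a type A algebra. The letters `0, 1, 2` of the first
free algebra on `Fin 3` stand for `x₁, x₂, x₃`; the letters `0, 1, 2` of the second one, for
`f₄, f₅, f₆`, stand for `x₁, x₂, x₄`; the letters `0, 1` of `Fin 2` stand for `x₁, x₂`. -/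
structure Relations (k : Type u) [Field k] where
  f₁ : FreeAlgebra k (Fin 3)
  f₂ : FreeAlgebra k (Fin 3)
  f₃ : FreeAlgebra k (Fin 3)
  f₄ : FreeAlgebra k (Fin 3)
  f₅ : FreeAlgebra k (Fin 3)
  f₆ : FreeAlgebra k (Fin 3)
  f₇ : FreeAlgebra k (Fin 2)
  f₈ : FreeAlgebra k (Fin 2)
  lower₁ : f₁ ∈ lowerForms k [2, 2]
  lower₂ : f₂ ∈ lowerForms k [2, 0]
  lower₃ : f₃ ∈ lowerForms k [2, 1]
  lower₄ : f₄ ∈ lowerForms k [2, 0]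
  lower₅ : f₅ ∈ lowerForms k [2, 1]
  lower₆ : f₆ ∈ lowerForms k [2, 2]
  lower₇ : f₇ ∈ lowerForms k [1, 1, 0]
  lower₈ : f₈ ∈ lowerForms k [1, 0, 0]

namespace Relations

variable {k : Type u} [Field k] (P : Relations k)

/-- `r₁ = x₃² - f₁`, `r₂ = x₃x₁ - f₂`, `r₃ = x₃x₂ - f₃`. -/
def relA : Fin 3 → FreeAlgebra k (Fin 3) :=
  ![word (FreeAlgebra.ι k) [2, 2] - P.f₁,
    word (FreeAlgebra.ι k) [2, 0] - P.f₂,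
    word (FreeAlgebra.ι k) [2, 1] - P.f₃]

/-- `r₄ = x₄x₁ - f₄`, `r₅ = x₄x₂ - f₅`, `r₆ = x₄² - f₆`. -/
def relB : Fin 3 → FreeAlgebra k (Fin 3) :=
  ![word (FreeAlgebra.ι k) [2, 0] - P.f₄,
    word (FreeAlgebra.ι k) [2, 1] - P.f₅,
    word (FreeAlgebra.ι k) [2, 2] - P.f₆]

/-- `r₇ = x₂²x₁ - f₇`, `r₈ = x₂x₁² - f₈`. -/
def relC : Fin 2 → FreeAlgebra k (Fin 2) :=
  ![word (FreeAlgebra.ι k) [1, 1, 0] - P.f₇,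
    word (FreeAlgebra.ι k) [1, 0, 0] - P.f₈]

/-- The six relations `r₁, …, r₆` in the free algebra `k⟨x₁, x₂, x₃, x₄⟩`. -/
def relD : Fin 6 → FreeAlgebra k (Fin 4) :=
  let a : FreeAlgebra k (Fin 3) →ₐ[k] FreeAlgebra k (Fin 4) :=
    FreeAlgebra.lift k (fun j => FreeAlgebra.ι k ((![0, 1, 2] : Fin 3 → Fin 4) j))
  let b : FreeAlgebra k (Fin 3) →ₐ[k] FreeAlgebra k (Fin 4) :=
    FreeAlgebra.lift k (fun j => FreeAlgebra.ι k ((![0, 1, 3] : Fin 3 → Fin 4) j))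
  ![a (P.relA 0), a (P.relA 1), a (P.relA 2), b (P.relB 0), b (P.relB 1), b (P.relB 2)]

/-- `A = k⟨x₁, x₂, x₃⟩ / (r₁, r₂, r₃)`. -/
abbrev A := Presented P.relA

/-- `B = k⟨x₁, x₂, x₄⟩ / (r₄, r₅, r₆)`. -/
abbrev B := Presented P.relB

/-- `C = k⟨x₁, x₂⟩ / (r₇, r₈)`. -/
abbrev C := Presented P.relC

end Relations

/-- A presentation of the algebra `D` as a type A algebra: `A`, `B`, `C` are regular of global
dimension three, `C` is a subalgebra of `A` and of `B` through `x₁ ↦ x₁`, `x₂ ↦ x₂`, and `D` is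
the pushout of the two inclusions in the category of `k`-algebras. -/
structure TypeAAlgebra (k : Type u) [Field k] (D : Type u) [Ring D] [Algebra k D]
    extends Relations k where
  regularA : IsASRegular (degreePart k (gen toRelations.relA)) 3
  regularB : IsASRegular (degreePart k (gen toRelations.relB)) 3
  regularC : IsASRegular (degreePart k (gen toRelations.relC)) 3
  i₁ : toRelations.C →ₐ[k] toRelations.A
  i₂ : toRelations.C →ₐ[k] toRelations.B
  i₁_gen : ∀ j : Fin 2, i₁ (gen toRelations.relC j) = gen toRelations.relA j.castSucc
  i₂_gen : ∀ j : Fin 2, i₂ (gen toRelations.relC j) = gen toRelations.relB j.castSucc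
  i₁_injective : Function.Injective i₁
  i₂_injective : Function.Injective i₂
  j₁ : toRelations.A →ₐ[k] D
  j₂ : toRelations.B →ₐ[k] D
  isPushout : IsPushout (AlgCat.ofHom i₁) (AlgCat.ofHom i₂) (AlgCat.ofHom j₁) (AlgCat.ofHom j₂)

namespace TypeAAlgebra

variable {k : Type u} [Field k] {D : Type u} [Ring D] [Algebra k D]

/-- The generators `x₁, x₂, x₃, x₄` of a type A algebra. -/
def x (P : TypeAAlgebra k D) : Fin 4 → D :=
  ![P.j₁ (gen P.relA 0), P.j₁ (gen P.relA 1), P.j₁ (gen P.relA 2), P.j₂ (gen P.relB 2)]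

end TypeAAlgebra

/-! ### Potential resolutions -/

/-- Let `D = k⟨x₁, …, x₄⟩ / (r₁, …, r₆)` with quadratic `r₁, …, r₆`. The data of a complex of free
right `D`-modules, written as columns,
`0 → D(-4) → D(-3)⁴ → D(-2)⁶ → D(-1)⁴ → D → k → 0`,
with differentials the left multiplications by `Xᵗ`, `S T`, `R`, `X`, where `X = [x₁, …, x₄]`,
`S` is an invertible scalar matrix, and `R`, `T` are matrices of linear forms with
`X R = [r₁, …, r₆]` and `T Xᵗ = [r₁, …, r₆]ᵗ` in the free algebra. As `X R` and `S T Xᵗ` vanish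
in `D`, this is a complex exactly when `R S T = 0` in `D`. -/
structure PotentialResolution {k D : Type*} [Field k] [Ring D] [Algebra k D]
    (x : Fin 4 → D) (r : Fin 6 → FreeAlgebra k (Fin 4)) where
  R : Matrix (Fin 4) (Fin 6) (FreeAlgebra k (Fin 4))
  T : Matrix (Fin 6) (Fin 4) (FreeAlgebra k (Fin 4))
  S : Matrix (Fin 6) (Fin 6) k
  isUnit_S : IsUnit S
  R_linear : ∀ i j, R i j ∈ degreePart k (FreeAlgebra.ι k) 1
  T_linear : ∀ i j, T i j ∈ degreePart k (FreeAlgebra.ι k) 1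
  X_mul_R : Matrix.vecMul (FreeAlgebra.ι k) R = r
  T_mul_X : Matrix.mulVec T (FreeAlgebra.ι k) = r
  R_mul_S_mul_T :
    R.map (FreeAlgebra.lift k x) * S.map (algebraMap k D) * T.map (FreeAlgebra.lift k x) = 0

end

end TypeA

/-! Write `R` for the product of the given `R` with `S`. The matrices give two linear complexes with
terms of ranks 1, 4, 6, 4, 1: on columns a complex of free right modules with maps `x`ᵗ, `T`, `R`,
`x`, and on rows its transpose, a complex of free left modules. Both turn out to be resolutions of
`k`, and this determines the global dimension on both sides.

Structure of `D`. For a regular algebra of dimension three, projectivity of the second syzygy of `k`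
and one-dimensionality of `Ext³(k, E)` force that syzygy to be free of rank one, generated in degree
one (`exists_last_syzygy`). The resulting resolution gives the Hilbert series `(1 - t)⁻³` for `A`
and `B`, and `(1 - 2t + 2t³ - t⁴)⁻¹` for `C`. The leading monomials show `A = C + C x₃` and `B = C +
C x₄`. Since `(1 - t)³(1 + t) = 1 - 2t + 2t³ - t⁴`, comparing dimensions makes both sums direct.
Hence `D` is a free left `C`-module on the alternating words in `x₃`, `x₄`
(`IsAmalgam.bijective_leftCombination`); it is also free as a left module over `A` and over `B`, and
its Hilbert series is `(1 - t)⁻⁴`.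

Exactness. The two ends next to `k` are exact because the `rᵢ` present `D`. The vanishing of
`Ext⁰(k, -)` and `Ext¹(k, -)` for `A`, `B`, `C` passes to `D` by freeness: no nonzero element is
killed on the left by `x₁` and `x₂`, and the columns killed by `T` are the multiples of `x`. The
right complex is therefore exact outside `D⁶`, and there as well by the Hilbert series
(`LinearComplex.exists_T_mulVec`). For the left complex, an element of degree at least two in a
kernel is shown, by a chase between the two complexes, to be a combination of kernel elements of
smaller degree; degrees zero and one are dimension counts (`LinearComplex.exists_vecMul_R`,
`LinearComplex.exists_mul_gen`, `LinearComplex.left_inj`).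

Dimension. If `k` had projective dimension at most three, the last map of its minimal resolution
would split, putting `1` in the augmentation ideal (`four_le_leftGlobalDimension`). For the upper
bound an arbitrary, ungraded left module `M` is filtered. The right resolution of `k` computes
`Tor(k, gr M)`, which vanishes beyond degree four; each filtered free cover lowers the degree by
one, and a filtered module with `Tor₁(k, gr M) = 0` is free (`free_of_isExactAt`). So the fourth
syzygy of `M` is free (`leftGlobalDimension_le_four`). Passing to the opposite ring exchanges the
two complexes and gives the other side. -/

namespace TypeA

/-! ### Monomials, coefficients and two-sided ideals in free algebras -/

section FreeAlg

variable {k : Type*} [Field k] {X : Type*}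

theorem word_nil {R ι : Type*} [Monoid R] (x : ι → R) : word x [] = 1 := rfl

theorem word_cons {R ι : Type*} [Monoid R] (x : ι → R) (i : ι) (w : List ι) :
    word x (i :: w) = x i * word x w := by simp [word]

theorem word_append {R ι : Type*} [Monoid R] (x : ι → R) (v w : List ι) :
    word x (v ++ w) = word x v * word x w := by simp [word]

theorem word_concat {R ι : Type*} [Monoid R] (x : ι → R) (w : List ι) (i : ι) :
    word x (w ++ [i]) = word x w * x i := by simp [word]

theorem map_word {R S F ι : Type*} [Monoid R] [Monoid S] [FunLike F R S] [MonoidHomClass F R S]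
    (f : F) (x : ι → R) (w : List ι) : f (word x w) = word (fun i => f (x i)) w := by
  induction w with
  | nil => simp [word_nil]
  | cons i w ih => rw [word_cons, word_cons, map_mul, ih]

/-- The basis of the free algebra consisting of the monomials. -/
noncomputable def wordBasis (k : Type*) [Field k] (X : Type*) :
    Module.Basis (List X) k (FreeAlgebra k X) :=
  (FreeAlgebra.basisFreeMonoid k X).reindex FreeMonoid.toList

theorem wordBasis_apply (w : List X) : wordBasis k X w = word (FreeAlgebra.ι k) w := by
  have : wordBasis k X w = FreeAlgebra.equivMonoidAlgebraFreeMonoid.symm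
      (MonoidAlgebra.single (FreeMonoid.ofList w) (1 : k)) := by
    simp [wordBasis, FreeAlgebra.basisFreeMonoid]
  rw [this, FreeAlgebra.equivMonoidAlgebraFreeMonoid]
  simp [FreeMonoid.lift_apply, word]

theorem span_word_eq_top : Submodule.span k (Set.range (word (FreeAlgebra.ι k (X := X)))) = ⊤ := by
  rw [← (wordBasis k X).span_eq]
  congr 2
  funext w
  rw [wordBasis_apply]

/-- Linear maps out of the free algebra agree if they agree on monomials. -/
theorem linearMap_ext_word {M : Type*} [AddCommMonoid M] [Module k M]
    {f g : FreeAlgebra k X →ₗ[k] M} (h : ∀ w, f (word (FreeAlgebra.ι k) w) =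
      g (word (FreeAlgebra.ι k) w)) : f = g :=
  (wordBasis k X).ext fun w => by rw [wordBasis_apply, h]

theorem freeAlgebra_induction_word {p : FreeAlgebra k X → Prop}
    (hw : ∀ w, p (word (FreeAlgebra.ι k) w)) (h0 : p 0) (hadd : ∀ a b, p a → p b → p (a + b))
    (hsmul : ∀ (c : k) a, p a → p (c • a)) (a : FreeAlgebra k X) : p a := by
  have : a ∈ Submodule.span k (Set.range (word (FreeAlgebra.ι k (X := X)))) := by
    rw [span_word_eq_top]; trivial
  induction this using Submodule.span_induction with
  | mem x hx => obtain ⟨w, rfl⟩ := hx; exact hw w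
  | zero => exact h0
  | add x y _ _ hx hy => exact hadd x y hx hy
  | smul c x _ hx => exact hsmul c x hx

/-- The coefficients of a noncommutative polynomial with respect to the last letter. -/
noncomputable def rightCoeff (k : Type*) [Field k] (X : Type*) [DecidableEq X] :
    FreeAlgebra k X →ₗ[k] (X → FreeAlgebra k X) :=
  (wordBasis k X).constr k fun w => match w.getLast? with
    | none => 0
    | some i => Pi.single i (word (FreeAlgebra.ι k) w.dropLast)

/-- The coefficients of a noncommutative polynomial with respect to the first letter. -/
noncomputable def leftCoeff (k : Type*) [Field k] (X : Type*) [DecidableEq X] :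
    FreeAlgebra k X →ₗ[k] (X → FreeAlgebra k X) :=
  (wordBasis k X).constr k fun w => match w with
    | [] => 0
    | i :: v => Pi.single i (word (FreeAlgebra.ι k) v)

theorem rightCoeff_mul_ι [DecidableEq X] (a : FreeAlgebra k X) (i : X) :
    rightCoeff k X (a * FreeAlgebra.ι k i) = Pi.single i a := by
  have : (rightCoeff k X).comp (LinearMap.mulRight k (FreeAlgebra.ι k i)) =
      LinearMap.single k (fun _ => FreeAlgebra k X) i := by
    refine linearMap_ext_word fun w => ?_
    simp only [LinearMap.comp_apply, LinearMap.mulRight_apply, LinearMap.single_apply]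
    rw [← word_concat, ← wordBasis_apply, rightCoeff, Module.Basis.constr_basis]
    simp
  exact LinearMap.congr_fun this a

theorem leftCoeff_ι_mul [DecidableEq X] (a : FreeAlgebra k X) (i : X) :
    leftCoeff k X (FreeAlgebra.ι k i * a) = Pi.single i a := by
  have : (leftCoeff k X).comp (LinearMap.mulLeft k (FreeAlgebra.ι k i)) =
      LinearMap.single k (fun _ => FreeAlgebra k X) i := by
    refine linearMap_ext_word fun w => ?_
    simp only [LinearMap.comp_apply, LinearMap.mulLeft_apply, LinearMap.single_apply]
    rw [← word_cons, ← wordBasis_apply, leftCoeff, Module.Basis.constr_basis]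
  exact LinearMap.congr_fun this a

/-- `rightCoeff` recovers the coefficients: the augmentation ideal of a free algebra is a free left
module on the letters. This uniqueness lifts syzygies from a quotient, and later compares the matrix
`T` of `D` with those of `A` and `B`. -/
theorem eq_of_sum_mul_ι_eq [Fintype X] {a b : X → FreeAlgebra k X}
    (h : ∑ i, a i * FreeAlgebra.ι k i = ∑ i, b i * FreeAlgebra.ι k i) : a = b := by
  classical
  have key : ∀ c : X → FreeAlgebra k X, rightCoeff k X (∑ i, c i * FreeAlgebra.ι k i) = c := by
    intro c
    rw [map_sum]
    simp_rw [rightCoeff_mul_ι]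
    exact Finset.univ_sum_single c
  rw [← key a, h, key b]

theorem eq_of_sum_ι_mul_eq [Fintype X] {a b : X → FreeAlgebra k X}
    (h : ∑ i, FreeAlgebra.ι k i * a i = ∑ i, FreeAlgebra.ι k i * b i) : a = b := by
  classical
  have key : ∀ c : X → FreeAlgebra k X, leftCoeff k X (∑ i, FreeAlgebra.ι k i * c i) = c := by
    intro c
    rw [map_sum]
    simp_rw [leftCoeff_ι_mul]
    exact Finset.univ_sum_single c
  rw [← key a, h, key b]

theorem exists_eq_algebraMap_add_sum_mul_ι [Fintype X] (a : FreeAlgebra k X) :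
    ∃ (c : k) (q : X → FreeAlgebra k X),
      a = algebraMap k _ c + ∑ i, q i * FreeAlgebra.ι k i := by
  classical
  induction a using freeAlgebra_induction_word with
  | hw w =>
    rcases List.eq_nil_or_concat w with rfl | ⟨v, i, rfl⟩
    · exact ⟨1, 0, by simp [word_nil]⟩
    · refine ⟨0, Pi.single i (word (FreeAlgebra.ι k) v), ?_⟩
      rw [List.concat_eq_append, word_concat, map_zero, zero_add, Finset.sum_eq_single i] <;> simp +contextual
  | h0 => exact ⟨0, 0, by simp⟩
  | hadd a b ha hb =>
    obtain ⟨c, q, rfl⟩ := ha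
    obtain ⟨c', q', rfl⟩ := hb
    exact ⟨c + c', q + q', by simp [add_mul, Finset.sum_add_distrib]; abel⟩
  | hsmul s a ha =>
    obtain ⟨c, q, rfl⟩ := ha
    exact ⟨s * c, s • q, by
      rw [smul_add, Finset.smul_sum, map_mul, ← Algebra.smul_def]; simp⟩

theorem exists_eq_algebraMap_add_sum_ι_mul [Fintype X] (a : FreeAlgebra k X) :
    ∃ (c : k) (q : X → FreeAlgebra k X),
      a = algebraMap k _ c + ∑ i, FreeAlgebra.ι k i * q i := by
  classical
  induction a using freeAlgebra_induction_word with
  | hw w =>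
    rcases w with _ | ⟨i, v⟩
    · exact ⟨1, 0, by simp [word_nil]⟩
    · refine ⟨0, Pi.single i (word (FreeAlgebra.ι k) v), ?_⟩
      rw [word_cons, map_zero, zero_add, Finset.sum_eq_single i] <;> simp +contextual
  | h0 => exact ⟨0, 0, by simp⟩
  | hadd a b ha hb =>
    obtain ⟨c, q, rfl⟩ := ha
    obtain ⟨c', q', rfl⟩ := hb
    exact ⟨c + c', q + q', by simp [mul_add, Finset.sum_add_distrib]; abel⟩
  | hsmul s a ha =>
    obtain ⟨c, q, rfl⟩ := ha
    exact ⟨s * c, s • q, by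
      rw [smul_add, Finset.smul_sum, map_mul, ← Algebra.smul_def]; simp⟩

/-- The two-sided ideal generated by a family, as a linear subspace. -/
def idealSpan {I : Type*} (r : I → FreeAlgebra k X) : Submodule k (FreeAlgebra k X) :=
  Submodule.span k {y | ∃ p j q, y = p * r j * q}

section Ideal

variable {I : Type*} {r : I → FreeAlgebra k X}

theorem mul_mem_idealSpan_left (a : FreeAlgebra k X) {y : FreeAlgebra k X}
    (hy : y ∈ idealSpan r) : a * y ∈ idealSpan r := by
  induction hy using Submodule.span_induction with
  | mem x hx =>
    obtain ⟨p, j, q, rfl⟩ := hx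
    exact Submodule.subset_span ⟨a * p, j, q, by simp [mul_assoc]⟩
  | zero => simp
  | add x y _ _ hx hy => rw [mul_add]; exact add_mem hx hy
  | smul c x _ hx => rw [mul_smul_comm]; exact Submodule.smul_mem _ _ hx

theorem mul_mem_idealSpan_right (a : FreeAlgebra k X) {y : FreeAlgebra k X}
    (hy : y ∈ idealSpan r) : y * a ∈ idealSpan r := by
  induction hy using Submodule.span_induction with
  | mem x hx =>
    obtain ⟨p, j, q, rfl⟩ := hx
    exact Submodule.subset_span ⟨p, j, q * a, by simp [mul_assoc]⟩
  | zero => simp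
  | add x y _ _ hx hy => rw [add_mul]; exact add_mem hx hy
  | smul c x _ hx => rw [smul_mul_assoc]; exact Submodule.smul_mem _ _ hx

theorem mem_idealSpan (j : I) : r j ∈ idealSpan r :=
  Submodule.subset_span ⟨1, j, 1, by simp⟩

/-- The congruence of the two-sided ideal generated by a family. -/
def idealCon (r : I → FreeAlgebra k X) : RingCon (FreeAlgebra k X) where
  r a b := a - b ∈ idealSpan r
  iseqv :=
    { refl a := by simp
      symm {a b} h := by rw [← neg_sub]; exact neg_mem h
      trans {a b c} h h' := by rw [← sub_add_sub_cancel a b c]; exact add_mem h h' }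
  mul' {a b c d} h h' := by
    have : a * c - b * d = (a - b) * c + b * (c - d) := by noncomm_ring
    rw [this]
    exact add_mem (mul_mem_idealSpan_right _ h) (mul_mem_idealSpan_left _ h')
  add' {a b c d} h h' := by
    rw [add_sub_add_comm]; exact add_mem h h'

/-- The map to the quotient by `idealCon r` kills the relations, so it factors through the
`RingQuot`; in its target, being zero is membership in `idealSpan r`. -/
theorem mem_idealSpan_of_mkAlgHom_eq_zero {a : FreeAlgebra k X}
    (h : RingQuot.mkAlgHom k (fun a b : FreeAlgebra k X => ∃ i, a = r i ∧ b = 0) a = 0) :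
    a ∈ idealSpan r := by
  let π : FreeAlgebra k X →ₐ[k] (idealCon r).Quotient :=
    { (idealCon r).mk' with commutes' := fun _ => rfl }
  have hπ : ∀ ⦃x y : FreeAlgebra k X⦄, (∃ i, x = r i ∧ y = 0) → π x = π y := by
    rintro _ _ ⟨i, rfl, rfl⟩
    refine Quotient.sound (?_ : r i - 0 ∈ idealSpan r)
    rw [sub_zero]; exact mem_idealSpan i
  have := RingQuot.liftAlgHom_mkAlgHom_apply k (s := fun a b => ∃ i, a = r i ∧ b = 0) π hπ a
  rw [h, map_zero] at this
  have h2 : (idealCon r) a 0 := Quotient.exact this.symm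
  have h3 : a - 0 ∈ idealSpan r := h2
  rwa [sub_zero] at h3

theorem lift_gen_eq_mkAlgHom (a : FreeAlgebra k X) :
    FreeAlgebra.lift k (gen r) a = RingQuot.mkAlgHom k _ a := by
  have : FreeAlgebra.lift k (gen r) = RingQuot.mkAlgHom k _ := by
    ext i; simp [gen]
  rw [this]

theorem mem_idealSpan_of_lift_gen_eq_zero {a : FreeAlgebra k X}
    (h : FreeAlgebra.lift k (gen r) a = 0) : a ∈ idealSpan r :=
  mem_idealSpan_of_mkAlgHom_eq_zero (by rw [← lift_gen_eq_mkAlgHom, h])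

theorem lift_gen_relation (j : I) : FreeAlgebra.lift k (gen r) (r j) = 0 := by
  rw [lift_gen_eq_mkAlgHom, ← map_zero (RingQuot.mkAlgHom k _)]
  exact RingQuot.mkAlgHom_rel k ⟨j, rfl, rfl⟩

theorem lift_gen_surjective : Function.Surjective (FreeAlgebra.lift k (gen r)) := by
  intro a
  obtain ⟨b, rfl⟩ := RingQuot.mkAlgHom_surjective k _ a
  exact ⟨b, lift_gen_eq_mkAlgHom b⟩

/-- For the ideal `I` this says `I = ∑ F rⱼ + ∑ I xᵢ`: in a product `p rⱼ q`, split off the constant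
term of `q` and the last letters of the rest. -/
theorem exists_eq_sum_mul_relation_add [Fintype X] [Fintype I] {a : FreeAlgebra k X}
    (h : a ∈ idealSpan r) : ∃ (b : I → FreeAlgebra k X) (c : X → FreeAlgebra k X),
      (∀ i, c i ∈ idealSpan r) ∧ a = ∑ j, b j * r j + ∑ i, c i * FreeAlgebra.ι k i := by
  classical
  induction h using Submodule.span_induction with
  | mem x hx =>
    obtain ⟨p, j, q, rfl⟩ := hx
    obtain ⟨c, q, rfl⟩ := exists_eq_algebraMap_add_sum_mul_ι q
    refine ⟨Pi.single j (c • p), fun i => p * r j * q i, fun i =>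
      mul_mem_idealSpan_right _ (mul_mem_idealSpan_left _ (mem_idealSpan j)), ?_⟩
    rw [Finset.sum_eq_single j (by simp +contextual) (by simp), Pi.single_eq_same, mul_add,
      Finset.mul_sum, ← Algebra.commutes, Algebra.smul_def]
    simp [mul_assoc]
  | zero => exact ⟨0, 0, by simp⟩
  | add x y _ _ hx hy =>
    obtain ⟨b, c, hc, rfl⟩ := hx
    obtain ⟨b', c', hc', rfl⟩ := hy
    refine ⟨b + b', c + c', fun i => add_mem (hc i) (hc' i), ?_⟩
    simp [add_mul, Finset.sum_add_distrib]; abel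
  | smul s x _ hx =>
    obtain ⟨b, c, hc, rfl⟩ := hx
    exact ⟨s • b, s • c, fun i => Submodule.smul_mem _ _ (hc i), by
      simp [Finset.smul_sum]⟩

theorem exists_eq_sum_relation_mul_add [Fintype X] [Fintype I] {a : FreeAlgebra k X}
    (h : a ∈ idealSpan r) : ∃ (b : I → FreeAlgebra k X) (c : X → FreeAlgebra k X),
      (∀ i, c i ∈ idealSpan r) ∧ a = ∑ j, r j * b j + ∑ i, FreeAlgebra.ι k i * c i := by
  classical
  induction h using Submodule.span_induction with
  | mem x hx =>
    obtain ⟨p, j, q, rfl⟩ := hx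
    obtain ⟨c, p, rfl⟩ := exists_eq_algebraMap_add_sum_ι_mul p
    refine ⟨Pi.single j (c • q), fun i => p i * r j * q, fun i =>
      mul_mem_idealSpan_right _ (mul_mem_idealSpan_left _ (mem_idealSpan j)), ?_⟩
    rw [Finset.sum_eq_single j (by simp +contextual) (by simp), Pi.single_eq_same, add_mul,
      add_mul, Finset.sum_mul, Finset.sum_mul, Algebra.commutes, Algebra.smul_def]
    simp [mul_assoc]
  | zero => exact ⟨0, 0, by simp⟩
  | add x y _ _ hx hy =>
    obtain ⟨b, c, hc, rfl⟩ := hx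
    obtain ⟨b', c', hc', rfl⟩ := hy
    refine ⟨b + b', c + c', fun i => add_mem (hc i) (hc' i), ?_⟩
    simp [mul_add, Finset.sum_add_distrib]; abel
  | smul s x _ hx =>
    obtain ⟨b, c, hc, rfl⟩ := hx
    exact ⟨s • b, s • c, fun i => Submodule.smul_mem _ _ (hc i), by
      simp [Finset.smul_sum]⟩

end Ideal

/-! ### First syzygies of the generators of a presented algebra -/

section Presentation

variable {E : Type*} [Ring E] [Algebra k E] {I : Type*} [Fintype X] [Fintype I]
  {r : I → FreeAlgebra k X} {x : X → E}

/-- Exactness of the start of the resolution of the trivial left module: the syzygies of the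
generators are the rows of the matrix of right coefficients of the relations. -/
theorem exists_vecMul_of_sum_mul_gen_eq_zero (hsurj : Function.Surjective (FreeAlgebra.lift k x))
    (hker : ∀ a, FreeAlgebra.lift k x a = 0 → a ∈ idealSpan r)
    (hrel : ∀ j, FreeAlgebra.lift k x (r j) = 0)
    {T : Matrix I X (FreeAlgebra k X)} (hT : Matrix.mulVec T (FreeAlgebra.ι k) = r)
    {a : X → E} (ha : ∑ i, a i * x i = 0) :
    ∃ b : I → E, a = Matrix.vecMul b (T.map (FreeAlgebra.lift k x)) := by
  choose f hf using fun i => hsurj (a i)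
  have h0 : FreeAlgebra.lift k x (∑ i, f i * FreeAlgebra.ι k i) = 0 := by
    simpa [map_sum, hf] using ha
  have hI0 : ∀ y ∈ idealSpan r, FreeAlgebra.lift k x y = 0 := by
    intro y hy
    induction hy using Submodule.span_induction with
    | mem y hy => obtain ⟨p, j, q, rfl⟩ := hy; simp [hrel]
    | zero => simp
    | add y z _ _ hy hz => simp [hy, hz]
    | smul c y _ hy => simp [hy]
  obtain ⟨b, c, hc, h⟩ := exists_eq_sum_mul_relation_add (hker _ h0)
  -- Substituting `rⱼ = ∑ Tⱼᵢ xᵢ` and comparing right coefficients gives the syzygy; the `c i` lie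
  -- in the ideal and vanish in `E`.
  have h2 : f = fun i => ∑ j, b j * T j i + c i := by
    apply eq_of_sum_mul_ι_eq
    rw [h]
    simp_rw [add_mul, Finset.sum_add_distrib, Finset.sum_mul]
    rw [Finset.sum_comm]
    congr 1
    refine Finset.sum_congr rfl fun j _ => ?_
    rw [← hT, Matrix.mulVec, dotProduct, Finset.mul_sum]
    simp [mul_assoc]
  refine ⟨fun j => FreeAlgebra.lift k x (b j), ?_⟩
  funext i
  rw [← hf i, h2]
  simp [Matrix.vecMul, dotProduct, hI0 _ (hc i)]

/-- The right-handed version of `exists_vecMul_of_sum_mul_gen_eq_zero`. -/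
theorem exists_mulVec_of_sum_gen_mul_eq_zero (hsurj : Function.Surjective (FreeAlgebra.lift k x))
    (hker : ∀ a, FreeAlgebra.lift k x a = 0 → a ∈ idealSpan r)
    (hrel : ∀ j, FreeAlgebra.lift k x (r j) = 0)
    {R : Matrix X I (FreeAlgebra k X)} (hR : Matrix.vecMul (FreeAlgebra.ι k) R = r)
    {a : X → E} (ha : ∑ i, x i * a i = 0) :
    ∃ b : I → E, a = Matrix.mulVec (R.map (FreeAlgebra.lift k x)) b := by
  choose f hf using fun i => hsurj (a i)
  have h0 : FreeAlgebra.lift k x (∑ i, FreeAlgebra.ι k i * f i) = 0 := by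
    simpa [map_sum, hf] using ha
  have hI0 : ∀ y ∈ idealSpan r, FreeAlgebra.lift k x y = 0 := by
    intro y hy
    induction hy using Submodule.span_induction with
    | mem y hy => obtain ⟨p, j, q, rfl⟩ := hy; simp [hrel]
    | zero => simp
    | add y z _ _ hy hz => simp [hy, hz]
    | smul c y _ hy => simp [hy]
  obtain ⟨b, c, hc, h⟩ := exists_eq_sum_relation_mul_add (hker _ h0)
  have h2 : f = fun i => ∑ j, R i j * b j + c i := by
    apply eq_of_sum_ι_mul_eq
    rw [h]
    simp_rw [mul_add, Finset.sum_add_distrib, Finset.mul_sum]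
    rw [Finset.sum_comm]
    congr 1
    refine Finset.sum_congr rfl fun j _ => ?_
    rw [← hR, Matrix.vecMul, dotProduct, Finset.sum_mul]
    simp [mul_assoc]
  refine ⟨fun j => FreeAlgebra.lift k x (b j), ?_⟩
  funext i
  rw [← hf i, h2]
  simp [Matrix.mulVec, dotProduct, hI0 _ (hc i)]

end Presentation

theorem exists_sum_mul_ι_of_mem_degreePart [Fintype X] {n : ℕ} {f : FreeAlgebra k X}
    (hf : f ∈ degreePart k (FreeAlgebra.ι k) (n + 1)) :
    ∃ t : X → FreeAlgebra k X, (∀ i, t i ∈ degreePart k (FreeAlgebra.ι k) n) ∧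
      ∑ i, t i * FreeAlgebra.ι k i = f := by
  classical
  induction hf using Submodule.span_induction with
  | mem y hy =>
    obtain ⟨w, hw, rfl⟩ := hy
    rcases List.eq_nil_or_concat w with rfl | ⟨v, i, rfl⟩
    · simp at hw
    refine ⟨Pi.single i (word (FreeAlgebra.ι k) v), fun j => ?_, ?_⟩
    · by_cases hj : j = i
      · subst hj; rw [Pi.single_eq_same]
        exact Submodule.subset_span ⟨v, by simpa using hw, rfl⟩
      · rw [Pi.single_eq_of_ne hj]; exact zero_mem _
    · rw [List.concat_eq_append, word_concat, Finset.sum_eq_single i] <;> simp +contextual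
  | zero => exact ⟨0, by simp⟩
  | add y z _ _ hy hz =>
    obtain ⟨t, ht, rfl⟩ := hy
    obtain ⟨t', ht', rfl⟩ := hz
    exact ⟨t + t', fun i => add_mem (ht i) (ht' i), by simp [add_mul, Finset.sum_add_distrib]⟩
  | smul c y _ hy =>
    obtain ⟨t, ht, rfl⟩ := hy
    exact ⟨c • t, fun i => Submodule.smul_mem _ _ (ht i), by simp [Finset.smul_sum]⟩

theorem exists_sum_ι_mul_of_mem_degreePart [Fintype X] {n : ℕ} {f : FreeAlgebra k X}
    (hf : f ∈ degreePart k (FreeAlgebra.ι k) (n + 1)) :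
    ∃ t : X → FreeAlgebra k X, (∀ i, t i ∈ degreePart k (FreeAlgebra.ι k) n) ∧
      ∑ i, FreeAlgebra.ι k i * t i = f := by
  classical
  induction hf using Submodule.span_induction with
  | mem y hy =>
    obtain ⟨w, hw, rfl⟩ := hy
    rcases w with _ | ⟨i, v⟩
    · simp at hw
    refine ⟨Pi.single i (word (FreeAlgebra.ι k) v), fun j => ?_, ?_⟩
    · by_cases hj : j = i
      · subst hj; rw [Pi.single_eq_same]
        exact Submodule.subset_span ⟨v, by simpa using hw, rfl⟩
      · rw [Pi.single_eq_of_ne hj]; exact zero_mem _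
    · rw [word_cons, Finset.sum_eq_single i] <;> simp +contextual
  | zero => exact ⟨0, by simp⟩
  | add y z _ _ hy hz =>
    obtain ⟨t, ht, rfl⟩ := hy
    obtain ⟨t', ht', rfl⟩ := hz
    exact ⟨t + t', fun i => add_mem (ht i) (ht' i), by simp [mul_add, Finset.sum_add_distrib]⟩
  | smul c y _ hy =>
    obtain ⟨t, ht, rfl⟩ := hy
    exact ⟨c • t, fun i => Submodule.smul_mem _ _ (ht i), by simp [Finset.smul_sum]⟩

theorem degreePart_eq_span_wordBasis (n : ℕ) : degreePart k (FreeAlgebra.ι k (X := X)) n =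
    Submodule.span k (wordBasis k X '' {w | w.length = n}) := by
  unfold degreePart
  congr 1
  ext y
  simp [wordBasis_apply]

theorem mul_mem_degreePart {R ι : Type*} [Ring R] [Algebra k R] {x : ι → R} {m n : ℕ} {a b : R}
    (ha : a ∈ degreePart k x m) (hb : b ∈ degreePart k x n) :
    a * b ∈ degreePart k x (m + n) := by
  have : degreePart k x m * degreePart k x n ≤ degreePart k x (m + n) := by
    unfold degreePart
    rw [Submodule.span_mul_span]
    refine Submodule.span_mono ?_
    rintro _ ⟨_, ⟨v, hv, rfl⟩, _, ⟨w, hw, rfl⟩, rfl⟩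
    exact ⟨v ++ w, by simp [hv, hw], word_append x v w⟩
  exact this (Submodule.mul_mem_mul ha hb)

/-- An ideal generated in degree `N` has no elements in smaller degrees. -/
theorem eq_zero_of_mem_idealSpan_of_mem_degreePart {I : Type*} {r : I → FreeAlgebra k X} {N n : ℕ}
    (hr : ∀ j, r j ∈ degreePart k (FreeAlgebra.ι k) N) (hn : n < N) {a : FreeAlgebra k X}
    (ha : a ∈ idealSpan r) (han : a ∈ degreePart k (FreeAlgebra.ι k) n) : a = 0 := by
  have hle : idealSpan r ≤ Submodule.span k (wordBasis k X '' {w | N ≤ w.length}) := by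
    refine Submodule.span_le.2 ?_
    rintro _ ⟨p, j, q, rfl⟩
    have hsub : ∀ m, N ≤ m → degreePart k (FreeAlgebra.ι k (X := X)) m ≤
        Submodule.span k (wordBasis k X '' {w | N ≤ w.length}) := by
      intro m hm
      rw [degreePart_eq_span_wordBasis]
      refine Submodule.span_mono (Set.image_mono ?_)
      rintro w rfl; exact hm
    induction p using freeAlgebra_induction_word with
    | hw v =>
      induction q using freeAlgebra_induction_word with
      | hw w =>
        refine hsub (v.length + N + w.length) (by omega)
          (mul_mem_degreePart (mul_mem_degreePart ?_ (hr j)) ?_)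
        · exact Submodule.subset_span ⟨v, rfl, rfl⟩
        · exact Submodule.subset_span ⟨w, rfl, rfl⟩
      | h0 => simp
      | hadd a b ha hb => rw [mul_add]; exact add_mem ha hb
      | hsmul c a ha => rw [mul_smul_comm]; exact Submodule.smul_mem _ _ ha
    | h0 => simp
    | hadd a b ha hb => rw [add_mul, add_mul]; exact add_mem ha hb
    | hsmul c a ha => rw [smul_mul_assoc, smul_mul_assoc]; exact Submodule.smul_mem _ _ ha
  have hd : Disjoint {w : List X | w.length = n} {w | N ≤ w.length} := by
    rw [Set.disjoint_left]
    rintro w rfl h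
    exact absurd hn (not_lt.2 h)
  have := (wordBasis k X).linearIndependent.disjoint_span_image hd
  rw [Submodule.disjoint_def] at this
  exact this a (by rwa [← degreePart_eq_span_wordBasis]) (hle ha)

theorem repr_lowerForms_eq_zero {n : ℕ} {lead w : List (Fin n)} (hw : ¬ w < lead)
    {f : FreeAlgebra k (Fin n)} (hf : f ∈ lowerForms k lead) :
    (wordBasis k (Fin n)).repr f w = 0 := by
  induction hf using Submodule.span_induction with
  | mem y hy =>
    obtain ⟨v, -, hv, rfl⟩ := hy
    rw [← wordBasis_apply, Module.Basis.repr_self, Finsupp.single_eq_of_ne]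
    rintro rfl; exact hw hv
  | zero => simp
  | add y z _ _ hy hz => simp [hy, hz]
  | smul c y _ hy => simp [hy]

theorem repr_word {n : ℕ} (v w : List (Fin n)) :
    (wordBasis k (Fin n)).repr (word (FreeAlgebra.ι k) v) w = if v = w then 1 else 0 := by
  rw [← wordBasis_apply, Module.Basis.repr_self, Finsupp.single_apply]

theorem lowerForms_le_degreePart {n : ℕ} (lead : List (Fin n)) :
    lowerForms k lead ≤ degreePart k (FreeAlgebra.ι k) lead.length :=
  Submodule.span_mono fun _ ⟨w, hw, _, h⟩ => ⟨w, hw, h⟩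

theorem word_sub_mem_degreePart {n : ℕ} {lead : List (Fin n)} {f : FreeAlgebra k (Fin n)}
    (hf : f ∈ lowerForms k lead) : word (FreeAlgebra.ι k) lead - f ∈
      degreePart k (FreeAlgebra.ι k) lead.length :=
  sub_mem (Submodule.subset_span ⟨lead, rfl, rfl⟩) (lowerForms_le_degreePart lead hf)

theorem lift_mem_degreePart {R : Type*} [Ring R] [Algebra k R] {x : X → R} {n : ℕ}
    {f : FreeAlgebra k X} (hf : f ∈ degreePart k (FreeAlgebra.ι k) n) :
    FreeAlgebra.lift k x f ∈ degreePart k x n := by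
  induction hf using Submodule.span_induction with
  | mem y hy =>
    obtain ⟨w, hw, rfl⟩ := hy
    rw [map_word]
    exact Submodule.subset_span ⟨w, hw, by simp⟩
  | zero => simp
  | add y z _ _ hy hz => rw [map_add]; exact add_mem hy hz
  | smul c y _ hy => rw [map_smul]; exact Submodule.smul_mem _ _ hy

end FreeAlg

end TypeA

namespace TypeA

/-! ### Integer degrees, homogeneous vectors and graded Nakayama -/

section Graded

variable {k : Type*} [Field k] {E : Type*} [Ring E] [Algebra k E] (𝒟 : ℕ → Submodule k E)

/-- The extension of an `ℕ`-grading to `ℤ` by zero. -/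
def zpart : ℤ → Submodule k E
  | Int.ofNat n => 𝒟 n
  | Int.negSucc _ => ⊥

theorem zpart_natCast (n : ℕ) : zpart 𝒟 n = 𝒟 n := rfl

theorem zpart_of_neg {m : ℤ} (hm : m < 0) : zpart 𝒟 m = ⊥ := by
  obtain ⟨n, rfl⟩ := Int.eq_negSucc_of_lt_zero hm
  rfl

variable [GradedAlgebra 𝒟]

/-- The homogeneous component of integral degree `m`. -/
noncomputable def zcomp : ℤ → E →ₗ[k] E
  | Int.ofNat n => GradedAlgebra.proj 𝒟 n
  | Int.negSucc _ => 0

theorem zcomp_of_neg {m : ℤ} (hm : m < 0) (a : E) : zcomp 𝒟 m a = 0 := by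
  obtain ⟨n, rfl⟩ := Int.eq_negSucc_of_lt_zero hm
  rfl

theorem zcomp_mem (m : ℤ) (a : E) : zcomp 𝒟 m a ∈ zpart 𝒟 m := by
  cases m with
  | ofNat n => exact (DirectSum.decompose 𝒟 a n).2
  | negSucc n => exact zero_mem _

variable {𝒟}

theorem zcomp_of_mem_same {m : ℤ} {a : E} (ha : a ∈ zpart 𝒟 m) : zcomp 𝒟 m a = a := by
  cases m with
  | ofNat n => exact DirectSum.decompose_of_mem_same 𝒟 ha
  | negSucc n => rw [(Submodule.mem_bot k).1 ha, map_zero]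

theorem zcomp_of_mem_ne {m m' : ℤ} {a : E} (ha : a ∈ zpart 𝒟 m) (h : m ≠ m') :
    zcomp 𝒟 m' a = 0 := by
  cases m with
  | ofNat n =>
    cases m' with
    | ofNat n' =>
      exact DirectSum.decompose_of_mem_ne 𝒟 ha (fun h' => h (by rw [h']))
    | negSucc n' => rfl
  | negSucc n => rw [(Submodule.mem_bot k).1 ha, map_zero]

/-- With integer degrees the shift needs no inequality between `m` and `d`: for negative `m` both
sides vanish. -/
theorem zcomp_mul_of_left_mem {d : ℕ} {x : E} (hx : x ∈ 𝒟 d) (m : ℤ) (a : E) :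
    zcomp 𝒟 (m + d) (x * a) = x * zcomp 𝒟 m a := by
  cases m with
  | ofNat n =>
    have := DirectSum.coe_decompose_mul_add_of_left_mem 𝒟 (j := n) (b := a) hx
    rw [add_comm] at this
    exact this
  | negSucc n =>
    rw [zcomp_of_neg 𝒟 (m := Int.negSucc n) (by omega), mul_zero]
    rcases lt_or_ge (Int.negSucc n + (d : ℤ)) 0 with h | h
    · exact zcomp_of_neg 𝒟 h _
    · obtain ⟨e, he⟩ := Int.eq_ofNat_of_zero_le h
      rw [he]
      exact DirectSum.coe_decompose_mul_of_left_mem_of_not_le 𝒟 hx (by omega)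

theorem zcomp_mul_of_right_mem {d : ℕ} {x : E} (hx : x ∈ 𝒟 d) (m : ℤ) (a : E) :
    zcomp 𝒟 (m + d) (a * x) = zcomp 𝒟 m a * x := by
  cases m with
  | ofNat n =>
    exact DirectSum.coe_decompose_mul_add_of_right_mem 𝒟 (i := n) (a := a) hx
  | negSucc n =>
    rw [zcomp_of_neg 𝒟 (m := Int.negSucc n) (by omega), zero_mul]
    rcases lt_or_ge (Int.negSucc n + (d : ℤ)) 0 with h | h
    · exact zcomp_of_neg 𝒟 h _
    · obtain ⟨e, he⟩ := Int.eq_ofNat_of_zero_le h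
      rw [he]
      exact DirectSum.coe_decompose_mul_of_right_mem_of_not_le 𝒟 hx (by omega)

theorem exists_sum_zcomp_eq (a : E) :
    ∃ N₀ : ℕ, ∀ N, N₀ ≤ N → ∑ n ∈ Finset.range N, zcomp 𝒟 (n : ℤ) a = a := by
  classical
  refine ⟨(DirectSum.decompose 𝒟 a).support.sup id + 1, fun N hN => ?_⟩
  conv_rhs => rw [← DirectSum.sum_support_decompose 𝒟 a]
  symm
  refine Finset.sum_subset (fun n hn => ?_) (fun n _ hn => ?_)
  · have := Finset.le_sup (f := id) hn
    simp only [id] at this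
    simp; omega
  · simpa using hn

theorem zcomp_mul_mem {m n : ℤ} {a b : E} (ha : a ∈ zpart 𝒟 m) (hb : b ∈ zpart 𝒟 n) :
    a * b ∈ zpart 𝒟 (m + n) := by
  cases m with
  | ofNat m =>
    cases n with
    | ofNat n => exact SetLike.GradedMul.mul_mem (A := 𝒟) ha hb
    | negSucc n => rw [(Submodule.mem_bot k).1 hb, mul_zero]; exact zero_mem _
  | negSucc m => rw [(Submodule.mem_bot k).1 ha, zero_mul]; exact zero_mem _

variable (𝒟) {ι κ : Type*}

/-- The vectors with entries homogeneous of degree `m`. -/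
def vpart (ι : Type*) (m : ℤ) : Submodule k (ι → E) :=
  Submodule.pi Set.univ fun _ => zpart 𝒟 m

/-- The homogeneous component of a vector. -/
noncomputable def vcomp (ι : Type*) (m : ℤ) : (ι → E) →ₗ[k] (ι → E) :=
  (zcomp 𝒟 m).compLeft ι

variable {𝒟}

omit [GradedAlgebra 𝒟] in
theorem mem_vpart {m : ℤ} {u : ι → E} : u ∈ vpart 𝒟 ι m ↔ ∀ i, u i ∈ zpart 𝒟 m := by
  simp [vpart]

theorem vcomp_apply (m : ℤ) (u : ι → E) (i : ι) : vcomp 𝒟 ι m u i = zcomp 𝒟 m (u i) := rfl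

theorem vcomp_mem (m : ℤ) (u : ι → E) : vcomp 𝒟 ι m u ∈ vpart 𝒟 ι m :=
  mem_vpart.2 fun i => zcomp_mem 𝒟 m (u i)

theorem vcomp_of_mem_same {m : ℤ} {u : ι → E} (hu : u ∈ vpart 𝒟 ι m) : vcomp 𝒟 ι m u = u :=
  funext fun i => zcomp_of_mem_same (mem_vpart.1 hu i)

theorem vcomp_of_neg {m : ℤ} (hm : m < 0) (u : ι → E) : vcomp 𝒟 ι m u = 0 :=
  funext fun i => zcomp_of_neg 𝒟 hm (u i)

theorem eq_zero_of_mem_vpart_of_neg {m : ℤ} (hm : m < 0) {u : ι → E} (hu : u ∈ vpart 𝒟 ι m) :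
    u = 0 := by
  rw [← vcomp_of_mem_same hu, vcomp_of_neg hm]

theorem exists_sum_vcomp_eq [Fintype ι] (u : ι → E) :
    ∃ N₀ : ℕ, ∀ N, N₀ ≤ N → ∑ n ∈ Finset.range N, vcomp 𝒟 ι (n : ℤ) u = u := by
  choose N hN using fun i => exists_sum_zcomp_eq (𝒟 := 𝒟) (u i)
  refine ⟨Finset.univ.sup N, fun M hM => funext fun i => ?_⟩
  rw [Finset.sum_apply]
  exact hN i M ((Finset.le_sup (Finset.mem_univ i)).trans hM)

/-- A subspace contains a vector as soon as it contains its homogeneous components. -/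
theorem mem_of_vcomp_mem [Fintype ι] {N : Submodule k (ι → E)} {u : ι → E}
    (h : ∀ m : ℤ, vcomp 𝒟 ι m u ∈ N) : u ∈ N := by
  obtain ⟨M, hM⟩ := exists_sum_vcomp_eq (𝒟 := 𝒟) u
  rw [← hM M le_rfl]
  exact Submodule.sum_mem _ fun n _ => h n

theorem eq_zero_of_vcomp_eq_zero [Fintype ι] {u : ι → E} (h : ∀ m : ℤ, vcomp 𝒟 ι m u = 0) :
    u = 0 := by
  have : u ∈ (⊥ : Submodule k (ι → E)) := mem_of_vcomp_mem (𝒟 := 𝒟) fun m => by simp [h]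
  simpa using this

theorem eq_zero_of_zcomp_eq_zero {a : E} (h : ∀ m : ℤ, zcomp 𝒟 m a = 0) : a = 0 := by
  obtain ⟨N, hN⟩ := exists_sum_zcomp_eq (𝒟 := 𝒟) a
  rw [← hN N le_rfl]
  exact Finset.sum_eq_zero fun n _ => h n

variable (𝒟)

/-- A linear map between spaces of vectors that raises the degree by `d`. -/
def IsShift (f : (ι → E) →ₗ[k] (κ → E)) (d : ℕ) : Prop :=
  ∀ (m : ℤ) (u : ι → E), vcomp 𝒟 κ (m + d) (f u) = f (vcomp 𝒟 ι m u)

variable {𝒟} {f : (ι → E) →ₗ[k] (κ → E)} {d : ℕ}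

theorem IsShift.mem (hf : IsShift 𝒟 f d) {m : ℤ} {u : ι → E} (hu : u ∈ vpart 𝒟 ι m) :
    f u ∈ vpart 𝒟 κ (m + d) := by
  rw [← vcomp_of_mem_same hu, ← hf]
  exact vcomp_mem _ _

theorem IsShift.vcomp_eq (hf : IsShift 𝒟 f d) (m : ℤ) (u : ι → E) :
    vcomp 𝒟 κ m (f u) = f (vcomp 𝒟 ι (m - d) u) := by
  have := hf (m - d) u
  rwa [sub_add_cancel] at this

/-- Exactness can be checked in each degree. -/
theorem IsShift.exact_of_forall_degree {σ : Type*} [Fintype κ] {g : (κ → E) →ₗ[k] (σ → E)} {e : ℕ}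
    (hg : IsShift 𝒟 g e)
    (h : ∀ m : ℤ, ∀ u ∈ vpart 𝒟 κ m, g u = 0 → ∃ v, f v = u) :
    ∀ u, g u = 0 → ∃ v, f v = u := by
  intro u hu
  have : u ∈ LinearMap.range f := by
    refine mem_of_vcomp_mem (𝒟 := 𝒟) fun m => ?_
    obtain ⟨v, hv⟩ := h m (vcomp 𝒟 κ m u) (vcomp_mem m u) (by rw [← hg, hu, map_zero])
    exact ⟨v, hv⟩
  exact this

theorem IsShift.exists_homogeneous (hf : IsShift 𝒟 f d) {m : ℤ} {u : κ → E}
    (hu : u ∈ vpart 𝒟 κ m) (h : ∃ v, f v = u) : ∃ v ∈ vpart 𝒟 ι (m - d), f v = u := by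
  obtain ⟨v, rfl⟩ := h
  exact ⟨vcomp 𝒟 ι (m - d) v, vcomp_mem _ _, by rw [← hf.vcomp_eq, vcomp_of_mem_same hu]⟩

/-- The bridge from exactness of ungraded maps to equalities of finite-dimensional pieces, used in
all rank counts. -/
theorem IsShift.exact_degree {σ : Type*} {g : (κ → E) →ₗ[k] (σ → E)}
    (hf : IsShift 𝒟 f d) (h : ∀ u, g u = 0 ↔ ∃ v, f v = u) (m : ℤ) :
    vpart 𝒟 κ m ⊓ LinearMap.ker g = (vpart 𝒟 ι (m - d)).map f := by
  ext u
  constructor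
  · rintro ⟨hu, hgu⟩
    obtain ⟨v, hv, rfl⟩ := hf.exists_homogeneous hu ((h u).1 hgu)
    exact ⟨v, hv, rfl⟩
  · rintro ⟨v, hv, rfl⟩
    refine ⟨?_, (h _).2 ⟨v, rfl⟩⟩
    have := hf.mem hv
    rwa [sub_add_cancel] at this

/-! ### Matrices as linear maps -/

variable (k)

/-- Left multiplication of columns by a matrix. -/
def colMap [Fintype ι] (M : Matrix κ ι E) : (ι → E) →ₗ[k] (κ → E) where
  toFun u := M.mulVec u
  map_add' := M.mulVec_add
  map_smul' c u := M.mulVec_smul c u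

/-- Right multiplication of rows by a matrix. -/
def rowMap [Fintype ι] (M : Matrix ι κ E) : (ι → E) →ₗ[k] (κ → E) where
  toFun u := M.vecMul u
  map_add' := M.add_vecMul
  map_smul' c u := M.smul_vecMul c u

variable {k}

@[simp] theorem colMap_apply [Fintype ι] (M : Matrix κ ι E) (u : ι → E) :
    colMap k M u = M.mulVec u := rfl

@[simp] theorem rowMap_apply [Fintype ι] (M : Matrix ι κ E) (u : ι → E) :
    rowMap k M u = M.vecMul u := rfl

theorem isShift_colMap [Fintype ι] {M : Matrix κ ι E} (hM : ∀ i j, M i j ∈ 𝒟 d) :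
    IsShift 𝒟 (colMap k M) d := by
  intro m u
  funext i
  simp only [vcomp_apply, colMap_apply, Matrix.mulVec, dotProduct, map_sum]
  exact Finset.sum_congr rfl fun j _ => zcomp_mul_of_left_mem (hM i j) m (u j)

theorem isShift_rowMap [Fintype ι] {M : Matrix ι κ E} (hM : ∀ i j, M i j ∈ 𝒟 d) :
    IsShift 𝒟 (rowMap k M) d := by
  intro m u
  funext i
  simp only [vcomp_apply, rowMap_apply, Matrix.vecMul, dotProduct, map_sum]
  exact Finset.sum_congr rfl fun j _ => zcomp_mul_of_right_mem (hM j i) m (u j)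

/-! ### Connected algebras generated in degree one -/

variable (𝒟)

/-- The algebra `E` is connected and generated by the elements `x` of degree one. -/
structure IsGeneratedBy [Fintype ι] (x : ι → E) : Prop where
  mem : ∀ i, x i ∈ 𝒟 1
  exists_left : ∀ a : E, ∃ (c : k) (b : ι → E), a = algebraMap k E c + ∑ i, b i * x i
  exists_right : ∀ a : E, ∃ (c : k) (b : ι → E), a = algebraMap k E c + ∑ i, x i * b i

variable {𝒟}

theorem algebraMap_mem_zero (c : k) : algebraMap k E c ∈ 𝒟 0 := by
  rw [Algebra.algebraMap_eq_smul_one]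
  exact Submodule.smul_mem _ _ SetLike.GradedOne.one_mem

namespace IsGeneratedBy

variable [Fintype ι] {x : ι → E} (hx : IsGeneratedBy 𝒟 x)
include hx

/-- A contribution in degree zero would need a coefficient of degree `-1`. -/
theorem zcomp_zero_sum_left (b : ι → E) : zcomp 𝒟 0 (∑ i, b i * x i) = 0 := by
  rw [map_sum]
  refine Finset.sum_eq_zero fun i _ => ?_
  have := zcomp_mul_of_right_mem (hx.mem i) (-1) (b i)
  rw [zcomp_of_neg 𝒟 (m := -1) (by omega), zero_mul] at this
  exact this

theorem zcomp_zero_sum_right (b : ι → E) : zcomp 𝒟 0 (∑ i, x i * b i) = 0 := by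
  rw [map_sum]
  refine Finset.sum_eq_zero fun i _ => ?_
  have := zcomp_mul_of_left_mem (hx.mem i) (-1) (b i)
  rw [zcomp_of_neg 𝒟 (m := -1) (by omega), mul_zero] at this
  exact this

theorem exists_scalar (a : E) : ∃ c : k, zcomp 𝒟 0 a = algebraMap k E c := by
  obtain ⟨c, b, rfl⟩ := hx.exists_left a
  refine ⟨c, ?_⟩
  rw [map_add, hx.zcomp_zero_sum_left, add_zero]
  exact zcomp_of_mem_same (m := 0) (algebraMap_mem_zero c)

theorem exists_scalar_of_mem {a : E} (ha : a ∈ zpart 𝒟 0) : ∃ c : k, a = algebraMap k E c := by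
  obtain ⟨c, hc⟩ := hx.exists_scalar a
  exact ⟨c, by rw [← hc, zcomp_of_mem_same ha]⟩

theorem exists_sum_left {a : E} (ha : zcomp 𝒟 0 a = 0) : ∃ b : ι → E, a = ∑ i, b i * x i := by
  obtain ⟨c, b, rfl⟩ := hx.exists_left a
  rw [map_add, hx.zcomp_zero_sum_left, add_zero] at ha
  rw [zcomp_of_mem_same (m := 0) (algebraMap_mem_zero c)] at ha
  exact ⟨b, by rw [ha, zero_add]⟩

theorem exists_sum_right {a : E} (ha : zcomp 𝒟 0 a = 0) : ∃ b : ι → E, a = ∑ i, x i * b i := by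
  obtain ⟨c, b, rfl⟩ := hx.exists_right a
  rw [map_add, hx.zcomp_zero_sum_right, add_zero] at ha
  rw [zcomp_of_mem_same (m := 0) (algebraMap_mem_zero c)] at ha
  exact ⟨b, by rw [ha, zero_add]⟩

/-- Nakayama's lemma for homogeneous subspaces of vectors. -/
theorem nakayama [Fintype κ] {K N : Submodule k (κ → E)}
    (hN : ∀ u ∈ N, ∀ m, vcomp 𝒟 κ m u ∈ N)
    (hxN : ∀ i, ∀ u ∈ N, (fun j => x i * u j) ∈ N)
    (h : ∀ z ∈ K, ∃ n ∈ N, ∃ ζ : ι → (κ → E), (∀ i, ζ i ∈ K) ∧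
      z = n + ∑ i, fun j => x i * ζ i j) : K ≤ N := by
  -- Induction on a bound for the degree, for all `z ∈ K` at once: the component of `x i * ζ i` in
  -- degree `m` involves only that of `ζ i` in degree `m - 1`. Only `N` has to be homogeneous.
  have key : ∀ (M : ℕ) (m : ℤ), m < M → ∀ z ∈ K, vcomp 𝒟 κ m z ∈ N := by
    intro M
    induction M with
    | zero => intro m hm z _; rw [vcomp_of_neg (by simpa using hm)]; exact zero_mem _
    | succ M ih =>
      intro m hm z hz
      obtain ⟨n, hn, ζ, hζ, rfl⟩ := h z hz
      obtain ⟨c, rfl⟩ : ∃ c : ι → κ → E, c = ζ := ⟨ζ, rfl⟩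
      rw [map_add, map_sum]
      refine add_mem (hN n hn m) (Submodule.sum_mem _ fun i _ => ?_)
      have h1 : vcomp 𝒟 κ m (fun j => x i * c i j) =
          fun j => x i * vcomp 𝒟 κ (m - 1) (c i) j := by
        funext j
        have := zcomp_mul_of_left_mem (hx.mem i) (m - 1) (c i j)
        rw [Nat.cast_one, sub_add_cancel] at this
        exact this
      rw [h1]
      exact hxN i _ (ih (m - 1) (by push_cast at hm; omega) _ (hζ i))
  intro z hz
  obtain ⟨M, hM⟩ := exists_sum_vcomp_eq (𝒟 := 𝒟) z
  exact mem_of_vcomp_mem (𝒟 := 𝒟) fun m => by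
    exact key (m.toNat + 1) m (by omega) z hz

end IsGeneratedBy

end Graded

end TypeA

namespace TypeA

/-! ### Dimension shifting for `Ext` and projective dimension -/

section Homological

variable {E : Type u} [Ring E]

/-- The short exact sequence `0 → ker g → M → N → 0` of a surjective linear map `g`. -/
noncomputable abbrev kerSeq {M N : Type u} [AddCommGroup M] [Module E M] [AddCommGroup N]
    [Module E N] (g : M →ₗ[E] N) : ShortComplex (ModuleCat.{u} E) :=
  ShortComplex.mk (ModuleCat.ofHom (LinearMap.ker g).subtype) (ModuleCat.ofHom g) (by
    ext ⟨x, hx⟩; exact hx)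

theorem kerSeq_shortExact {M N : Type u} [AddCommGroup M] [Module E M] [AddCommGroup N]
    [Module E N] {g : M →ₗ[E] N} (hg : Function.Surjective g) : (kerSeq g).ShortExact where
  exact := by
    rw [ShortComplex.moduleCat_exact_iff]
    intro x hx
    exact ⟨⟨x, hx⟩, rfl⟩
  mono_f := (ModuleCat.mono_iff_injective _).2 (LinearMap.ker g).injective_subtype
  epi_g := (ModuleCat.epi_iff_surjective _).2 hg

theorem projective_of_module_projective (M : Type u) [AddCommGroup M] [Module E M]
    [Module.Projective E M] : Projective (ModuleCat.of E M) :=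
  (IsProjective.iff_projective M).1 inferInstance

theorem module_projective_of_projective (M : Type u) [AddCommGroup M] [Module E M]
    (h : Projective (ModuleCat.of E M)) : Module.Projective E M :=
  (IsProjective.iff_projective M).2 h

theorem hasProjectiveDimensionLT_ker {M N : Type u} [AddCommGroup M] [Module E M]
    [Module.Projective E M] [AddCommGroup N] [Module E N] {g : M →ₗ[E] N}
    (hg : Function.Surjective g) {n : ℕ}
    (h : HasProjectiveDimensionLT (ModuleCat.of E N) (n + 2)) :
    HasProjectiveDimensionLT (ModuleCat.of E (LinearMap.ker g)) (n + 1) :=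
  ((kerSeq_shortExact hg).hasProjectiveDimensionLT_X₃_iff n
    (projective_of_module_projective M)).1 h

theorem hasProjectiveDimensionLT_of_ker {M N : Type u} [AddCommGroup M] [Module E M]
    [Module.Projective E M] [AddCommGroup N] [Module E N] {g : M →ₗ[E] N}
    (hg : Function.Surjective g) {n : ℕ}
    (h : HasProjectiveDimensionLT (ModuleCat.of E (LinearMap.ker g)) (n + 1)) :
    HasProjectiveDimensionLT (ModuleCat.of E N) (n + 2) :=
  ((kerSeq_shortExact hg).hasProjectiveDimensionLT_X₃_iff n
    (projective_of_module_projective M)).2 h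

variable {M N P : Type u} [AddCommGroup M] [Module E M]
    [AddCommGroup N] [Module E N] [AddCommGroup P] [Module E P]

/-- If `Ext¹(N, P) = 0`, every homomorphism from the kernel of a surjection `M → N` to `P`
extends to `M`. -/
theorem exists_extension_of_ext_one {g : M →ₗ[E] N} (hg : Function.Surjective g)
    (h : Subsingleton (Ext (ModuleCat.of E N) (ModuleCat.of E P) 1))
    (f : LinearMap.ker g →ₗ[E] P) : ∃ F : M →ₗ[E] P, f = F.comp (LinearMap.ker g).subtype := by
  obtain ⟨e, he⟩ := Ext.contravariant_sequence_exact₁ (kerSeq_shortExact hg)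
    (ModuleCat.of E P) (n₁ := 1) (Ext.mk₀ (ModuleCat.ofHom f)) rfl (h.elim _ _)
  obtain ⟨F, rfl⟩ := (Ext.mk₀_bijective _ _).2 e
  rw [Ext.mk₀_comp_mk₀] at he
  have := (Ext.mk₀_bijective _ _).1 he
  refine ⟨F.hom, ?_⟩
  have h2 := congrArg ModuleCat.Hom.hom this
  simpa using h2.symm

/-- The connecting map on `Ext` of the short exact sequence `0 → ker g → M → N → 0`. -/
noncomputable def extBoundary {g : M →ₗ[E] N} (hg : Function.Surjective g) (P : Type u)
    [AddCommGroup P] [Module E P] (n : ℕ)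
    (e : Ext (ModuleCat.of E (LinearMap.ker g)) (ModuleCat.of E P) n) :
    Ext (ModuleCat.of E N) (ModuleCat.of E P) (1 + n) :=
  (kerSeq_shortExact hg).extClass.comp e rfl

section Boundary

variable {g : M →ₗ[E] N} (hg : Function.Surjective g)

theorem extBoundary_add {n : ℕ}
    (e e' : Ext (ModuleCat.of E (LinearMap.ker g)) (ModuleCat.of E P) n) :
    extBoundary hg P n (e + e') = extBoundary hg P n e + extBoundary hg P n e' :=
  Ext.comp_add _ _ _ _

theorem extBoundary_comp {n : ℕ}
    (e : Ext (ModuleCat.of E (LinearMap.ker g)) (ModuleCat.of E P) n) (f : P →ₗ[E] P) :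
    extBoundary hg P n (e.comp (Ext.mk₀ (ModuleCat.ofHom f)) (add_zero n)) =
      (extBoundary hg P n e).comp (Ext.mk₀ (ModuleCat.ofHom f)) (add_zero _) :=
  (Ext.comp_assoc _ _ _ _ _ (by omega)).symm

variable [Module.Projective E M]

theorem ext_eq_zero_of_projective {n : ℕ} (hn : 1 ≤ n)
    (e : Ext (ModuleCat.of E M) (ModuleCat.of E P) n) : e = 0 := by
  have := projective_of_module_projective (E := E) M
  exact Ext.eq_zero_of_hasProjectiveDimensionLT e 1 hn

theorem extBoundary_surjective (n : ℕ) : Function.Surjective (extBoundary hg P n) := by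
  intro e
  exact Ext.contravariant_sequence_exact₃ (kerSeq_shortExact hg) (ModuleCat.of E P) e
    (ext_eq_zero_of_projective (by omega) _) rfl

theorem eq_zero_of_extBoundary_eq_zero {n : ℕ} (hn : 1 ≤ n)
    {e : Ext (ModuleCat.of E (LinearMap.ker g)) (ModuleCat.of E P) n}
    (he : extBoundary hg P n e = 0) : e = 0 := by
  obtain ⟨e', rfl⟩ := Ext.contravariant_sequence_exact₁ (kerSeq_shortExact hg)
    (ModuleCat.of E P) e rfl he
  rw [ext_eq_zero_of_projective hn e']
  exact Ext.comp_zero _ _ _ _ _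

-- The connecting map is injective in positive degrees when `M` is projective, but from degree zero
-- its kernel consists of the homomorphisms that extend to `M`.
omit [Module.Projective E M] in
theorem extBoundary_zero_eq_zero_iff (f : LinearMap.ker g →ₗ[E] P) :
    extBoundary hg P 0 (Ext.mk₀ (ModuleCat.ofHom f)) = 0 ↔
      ∃ F : M →ₗ[E] P, f = F.comp (LinearMap.ker g).subtype := by
  constructor
  · intro h
    obtain ⟨e, he⟩ := Ext.contravariant_sequence_exact₁ (kerSeq_shortExact hg)
      (ModuleCat.of E P) (Ext.mk₀ (ModuleCat.ofHom f)) rfl h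
    obtain ⟨F, rfl⟩ := (Ext.mk₀_bijective _ _).2 e
    rw [Ext.mk₀_comp_mk₀] at he
    have h2 := congrArg ModuleCat.Hom.hom ((Ext.mk₀_bijective _ _).1 he)
    exact ⟨F.hom, by simpa using h2.symm⟩
  · rintro ⟨F, rfl⟩
    have : ModuleCat.ofHom (F.comp (LinearMap.ker g).subtype) =
      (kerSeq g).f ≫ ModuleCat.ofHom F := rfl
    rw [this, ← Ext.mk₀_comp_mk₀]
    exact (kerSeq_shortExact hg).extClass_comp_assoc _

end Boundary

end Homological

/-! ### The Gorenstein condition read on the resolution of the trivial module -/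

section Resolution

variable {k : Type u} [Field k] {E : Type u} [Ring E] [Algebra k E] (𝒟 : ℕ → Submodule k E)

/-- The left ideal generated by the homogeneous elements of positive degree. -/
def augIdeal : Submodule E E := Submodule.span E {a : E | ∃ n, 1 ≤ n ∧ a ∈ 𝒟 n}

variable {𝒟} [GradedAlgebra 𝒟] {ι κ : Type} [Fintype ι] [Fintype κ] {x : ι → E}

theorem IsGeneratedBy.mem_augIdeal_iff (hx : IsGeneratedBy 𝒟 x) {a : E} :
    a ∈ augIdeal 𝒟 ↔ ∃ b : ι → E, a = ∑ i, b i * x i := by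
  constructor
  · intro ha
    refine hx.exists_sum_left ?_
    induction ha using Submodule.span_induction with
    | mem a ha =>
      obtain ⟨n, hn, ha⟩ := ha
      exact zcomp_of_mem_ne (m := n) (m' := 0) ha (by omega)
    | zero => simp
    | add a b _ _ ha hb => rw [map_add, ha, hb, add_zero]
    | smul c a _ ha =>
      obtain ⟨b, rfl⟩ := hx.exists_sum_left ha
      rw [smul_eq_mul, Finset.mul_sum]
      simp_rw [← mul_assoc]
      exact hx.zcomp_zero_sum_left _
  · rintro ⟨b, rfl⟩
    refine Submodule.sum_mem _ fun i _ => ?_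
    exact Submodule.smul_mem _ (b i) (Submodule.subset_span ⟨1, le_rfl, hx.mem i⟩)

/-- `Hom(k, E) = 0` says that no nonzero element is annihilated by all generators. -/
theorem eq_zero_of_gen_mul_eq_zero (hx : IsGeneratedBy 𝒟 x)
    (h : Subsingleton (Ext (trivialModule 𝒟) (ModuleCat.of E E) 0)) {a : E}
    (ha : ∀ i, x i * a = 0) : a = 0 := by
  have hle : augIdeal 𝒟 ≤ LinearMap.ker (LinearMap.toSpanSingleton E E a) := by
    intro b hb
    obtain ⟨c, rfl⟩ := hx.mem_augIdeal_iff.1 hb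
    simp [mul_assoc, ha]
  let f : (E ⧸ augIdeal 𝒟) →ₗ[E] E := (augIdeal 𝒟).liftQ _ hle
  have h0 : (Ext.mk₀ (ModuleCat.ofHom f) : Ext (trivialModule 𝒟) (ModuleCat.of E E) 0) =
    Ext.mk₀ (ModuleCat.ofHom 0) := h.elim _ _
  have h1 : f = 0 := congrArg ModuleCat.Hom.hom ((Ext.mk₀_bijective _ _).1 h0)
  have h2 : f ((augIdeal 𝒟).mkQ 1) = 0 := by rw [h1]; rfl
  simpa [f] using h2

/-- The map `E^ι → E` of left modules sending a row `a` to `∑ aᵢ xᵢ`. -/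
def genMap (x : ι → E) : (ι → E) →ₗ[E] E where
  toFun a := ∑ i, a i * x i
  map_add' a b := by simp [add_mul, Finset.sum_add_distrib]
  map_smul' c a := by simp [Finset.mul_sum, mul_assoc]

/-- Right multiplication of rows by a matrix, as a map of left modules. -/
def rowHom (T : Matrix κ ι E) : (κ → E) →ₗ[E] (ι → E) where
  toFun u := T.vecMul u
  map_add' := T.add_vecMul
  map_smul' c u := T.smul_vecMul c u

variable (𝒟) in
/-- The surjection of `E^ι` onto the augmentation ideal. -/
def augMap (hx : IsGeneratedBy 𝒟 x) : (ι → E) →ₗ[E] LinearMap.ker (augIdeal 𝒟).mkQ :=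
  (genMap x).codRestrict _ fun a => by
    rw [Submodule.ker_mkQ]; exact hx.mem_augIdeal_iff.2 ⟨a, rfl⟩

theorem augMap_surjective (hx : IsGeneratedBy 𝒟 x) : Function.Surjective (augMap 𝒟 hx) := by
  rintro ⟨a, ha⟩
  rw [Submodule.ker_mkQ] at ha
  obtain ⟨b, rfl⟩ := hx.mem_augIdeal_iff.1 ha
  exact ⟨b, rfl⟩

theorem mem_ker_augMap (hx : IsGeneratedBy 𝒟 x) {a : ι → E} :
    a ∈ LinearMap.ker (augMap 𝒟 hx) ↔ ∑ i, a i * x i = 0 := by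
  rw [LinearMap.mem_ker, ← Subtype.coe_inj]
  rfl

/-- The rows of `T` are a generating set of the syzygies of `x`. -/
def IsSyzygyMatrix (x : ι → E) (T : Matrix κ ι E) : Prop :=
  ∀ a : ι → E, ∑ i, a i * x i = 0 ↔ ∃ b : κ → E, T.vecMul b = a

/-- `Ext¹(k, E) = 0` gives exactness of the transposed complex. -/
theorem exists_eq_gen_mul_of_mulVec_eq_zero (hx : IsGeneratedBy 𝒟 x)
    {T : Matrix κ ι E} (hT : IsSyzygyMatrix x T)
    (h : Subsingleton (Ext (trivialModule 𝒟) (ModuleCat.of E E) 1)) {u : ι → E}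
    (hu : T.mulVec u = 0) : ∃ a : E, ∀ i, u i = x i * a := by
  classical
  -- Since `T u = 0`, the functional `a ↦ ∑ aᵢ uᵢ` kills all syzygies, so it descends to the
  -- augmentation ideal and sends `xᵢ` to `uᵢ`. As `Ext¹ = 0` it extends to `E`, where it is right
  -- multiplication by the image of `1`.
  have hle : LinearMap.ker (augMap 𝒟 hx) ≤ LinearMap.ker (genMap u) := by
    intro a ha
    obtain ⟨b, rfl⟩ := (hT a).1 ((mem_ker_augMap hx).1 ha)
    have : genMap u (T.vecMul b) = dotProduct (T.vecMul b) u := rfl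
    rw [LinearMap.mem_ker, this, ← Matrix.dotProduct_mulVec, hu, dotProduct_zero]
  let f : LinearMap.ker (augIdeal 𝒟).mkQ →ₗ[E] E :=
    ((LinearMap.ker (augMap 𝒟 hx)).liftQ (genMap u) hle).comp
      ((augMap 𝒟 hx).quotKerEquivOfSurjective (augMap_surjective hx)).symm.toLinearMap
  have hf : ∀ a, f (augMap 𝒟 hx a) = genMap u a := by
    intro a
    have : ((augMap 𝒟 hx).quotKerEquivOfSurjective (augMap_surjective hx)).symm
        (augMap 𝒟 hx a) = (LinearMap.ker (augMap 𝒟 hx)).mkQ a := by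
      rw [LinearEquiv.symm_apply_eq]; rfl
    simp only [f, LinearMap.comp_apply, LinearEquiv.coe_coe, this]
    rfl
  obtain ⟨F, hF⟩ := exists_extension_of_ext_one (augIdeal 𝒟).mkQ_surjective h f
  refine ⟨F 1, fun i => ?_⟩
  have h1 : genMap u (Pi.single i 1) = u i := by
    simp [genMap, Pi.single_apply]
  have h2 : (augMap 𝒟 hx (Pi.single i 1) : E) = x i := by
    change genMap x (Pi.single i 1) = x i
    simp [genMap, Pi.single_apply]
  rw [← h1, ← hf, hF]
  simp only [LinearMap.comp_apply, Submodule.subtype_apply, h2]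
  rw [← smul_eq_mul, ← map_smul, smul_eq_mul, mul_one]

/-- The surjection of `E^κ` onto the syzygies of the generators. -/
def syzMap (hx : IsGeneratedBy 𝒟 x) {T : Matrix κ ι E} (hT : IsSyzygyMatrix x T) :
    (κ → E) →ₗ[E] LinearMap.ker (augMap 𝒟 hx) :=
  (rowHom T).codRestrict _ fun a => (mem_ker_augMap hx).2 ((hT _).2 ⟨a, rfl⟩)

theorem syzMap_surjective (hx : IsGeneratedBy 𝒟 x) {T : Matrix κ ι E} (hT : IsSyzygyMatrix x T) :
    Function.Surjective (syzMap hx hT) := by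
  rintro ⟨a, ha⟩
  obtain ⟨b, rfl⟩ := (hT a).1 ((mem_ker_augMap hx).1 ha)
  exact ⟨b, rfl⟩

theorem mem_ker_syzMap (hx : IsGeneratedBy 𝒟 x) {T : Matrix κ ι E} (hT : IsSyzygyMatrix x T)
    {b : κ → E} : b ∈ LinearMap.ker (syzMap hx hT) ↔ T.vecMul b = 0 := by
  rw [LinearMap.mem_ker, ← Subtype.coe_inj]
  rfl

/-- Three dimension shifts along the covers of `k`, of the augmentation ideal and of the first
syzygies. -/
theorem projective_ker_syzMap (hx : IsGeneratedBy 𝒟 x) {T : Matrix κ ι E}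
    (hT : IsSyzygyMatrix x T) (h : HasProjectiveDimensionLT (trivialModule 𝒟) 4) :
    Module.Projective E (LinearMap.ker (syzMap hx hT)) := by
  have h1 := hasProjectiveDimensionLT_ker (augIdeal 𝒟).mkQ_surjective (n := 2) h
  have h2 := hasProjectiveDimensionLT_ker (augMap_surjective hx) h1
  have h3 := hasProjectiveDimensionLT_ker (syzMap_surjective hx hT) h2
  exact module_projective_of_projective _ (projective_iff_hasProjectiveDimensionLT_one.2 h3)

/-- The identification of `Ext³(k, E)` with a quotient of the dual of the second syzygy module. -/
theorem exists_dual_functional (hx : IsGeneratedBy 𝒟 x) {T : Matrix κ ι E}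
    (hT : IsSyzygyMatrix x T) (h : IsGorensteinLeft 𝒟 3) :
    ∃ ε : (LinearMap.ker (syzMap hx hT) →ₗ[E] E) → k,
      (∀ f g, ε (f + g) = ε f + ε g) ∧ Function.Surjective ε ∧
      (∀ f a c, zcomp 𝒟 0 a = algebraMap k E c →
        ε ((LinearMap.toSpanSingleton E E a).comp f) = ε f * c) ∧
      ∀ f, ε f = 0 ↔ ∃ F : (κ → E) →ₗ[E] E, f = F.comp (LinearMap.ker (syzMap hx hT)).subtype := by
  obtain ⟨-, φ, hφ1, hφ2⟩ := h
  -- Three connecting maps in a row, `Hom(K, E) → Ext¹ → Ext² → Ext³(k, E)`. All are surjective, and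
  -- only the innermost has a kernel: the functionals that extend to `E^κ`.
  let Θ : (LinearMap.ker (syzMap hx hT) →ₗ[E] E) →
      Ext (trivialModule 𝒟) (ModuleCat.of E E) 3 := fun f =>
    extBoundary (augIdeal 𝒟).mkQ_surjective E 2 (extBoundary (augMap_surjective hx) E 1
      (extBoundary (syzMap_surjective hx hT) E 0 (Ext.mk₀ (ModuleCat.ofHom f))))
  have hadd : ∀ f g, Θ (f + g) = Θ f + Θ g := by
    intro f g
    have : ModuleCat.ofHom (f + g) = ModuleCat.ofHom f + ModuleCat.ofHom g := rfl
    simp only [Θ]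
    rw [this, Ext.mk₀_add, extBoundary_add, extBoundary_add]
    exact extBoundary_add _ _ _
  have hsurj : Function.Surjective Θ := by
    intro e
    obtain ⟨e, rfl⟩ := extBoundary_surjective (augIdeal 𝒟).mkQ_surjective 2 e
    obtain ⟨e, rfl⟩ := extBoundary_surjective (augMap_surjective hx) 1 e
    obtain ⟨e, rfl⟩ := extBoundary_surjective (syzMap_surjective hx hT) 0 e
    obtain ⟨f, rfl⟩ := (Ext.mk₀_bijective _ _).2 e
    exact ⟨f.hom, rfl⟩
  have hker : ∀ f, Θ f = 0 ↔
      ∃ F : (κ → E) →ₗ[E] E, f = F.comp (LinearMap.ker (syzMap hx hT)).subtype := by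
    intro f
    rw [← extBoundary_zero_eq_zero_iff (syzMap_surjective hx hT)]
    constructor
    · intro h
      exact eq_zero_of_extBoundary_eq_zero (augMap_surjective hx) le_rfl
        (eq_zero_of_extBoundary_eq_zero (augIdeal 𝒟).mkQ_surjective (n := 2) (by omega) h)
    · intro h
      simp only [Θ]
      rw [h]
      have h1 : extBoundary (augMap_surjective hx) E 1 0 = 0 := Ext.comp_zero _ _ _ _ _
      have h2 : extBoundary (augIdeal 𝒟).mkQ_surjective E 2 0 = 0 := Ext.comp_zero _ _ _ _ _
      exact (congrArg _ h1).trans h2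
  have hact : ∀ f a, Θ ((LinearMap.toSpanSingleton E E a).comp f) = extSMul (Θ f) a := by
    intro f a
    have : ModuleCat.ofHom ((LinearMap.toSpanSingleton E E a).comp f) =
      ModuleCat.ofHom f ≫ ModuleCat.ofHom (LinearMap.toSpanSingleton E E a) := rfl
    simp only [Θ]
    rw [this, ← Ext.mk₀_comp_mk₀, extBoundary_comp]
    exact (congrArg _ (extBoundary_comp _ _ _)).trans (extBoundary_comp _ _ _)
  have hsadd : ∀ (e : Ext (trivialModule 𝒟) (ModuleCat.of E E) 3) (a b : E),
      extSMul e (a + b) = extSMul e a + extSMul e b := by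
    intro e a b
    have : ModuleCat.ofHom (LinearMap.toSpanSingleton E E (a + b)) =
      ModuleCat.ofHom (LinearMap.toSpanSingleton E E a) +
        ModuleCat.ofHom (LinearMap.toSpanSingleton E E b) := by
      ext; simp
    simp only [extSMul]
    rw [this, Ext.mk₀_add, Ext.comp_add]
  -- The Gorenstein condition concerns homogeneous elements of positive degree; additivity extends
  -- it to every element without constant term.
  have hpos : ∀ (e : Ext (trivialModule 𝒟) (ModuleCat.of E E) 3) (a : E), zcomp 𝒟 0 a = 0 →
      extSMul e a = 0 := by
    intro e a ha
    obtain ⟨c, rfl⟩ := φ.surjective e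
    have hz : extSMul (φ c) (0 : E) = 0 := by
      simpa using hsadd (φ c) 0 0
    let f : E →+ Ext (trivialModule 𝒟) (ModuleCat.of E E) 3 :=
      { toFun := extSMul (φ c), map_zero' := hz, map_add' := hsadd (φ c) }
    obtain ⟨N, hN⟩ := exists_sum_zcomp_eq (𝒟 := 𝒟) a
    have : f a = 0 := by
      rw [← hN N le_rfl, map_sum]
      refine Finset.sum_eq_zero fun n _ => ?_
      rcases Nat.eq_zero_or_pos n with rfl | hn
      · rw [Nat.cast_zero, ha, map_zero]
      · exact hφ2 c n _ hn (zcomp_mem 𝒟 n a)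
    exact this
  refine ⟨fun f => φ.symm (Θ f), fun f g => by simp only [hadd, map_add],
    φ.symm.surjective.comp hsurj, fun f a c hac => ?_, fun f => ?_⟩
  · have h0 : zcomp 𝒟 0 (a - algebraMap k E c) = 0 := by
      rw [map_sub, hac, zcomp_of_mem_same (m := 0) (algebraMap_mem_zero c), sub_self]
    have h1 := hsadd (Θ f) (algebraMap k E c) (a - algebraMap k E c)
    rw [add_sub_cancel, hpos _ _ h0, add_zero] at h1
    simp only
    rw [hact, h1, AddEquiv.symm_apply_eq, hφ1, AddEquiv.apply_symm_apply]
  · simp only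
    rw [← hker, AddEquiv.symm_apply_eq, map_zero]

end Resolution

end TypeA

namespace TypeA

/-! ### The last syzygy of a regular algebra of dimension three -/

section LastSyzygy

variable {k : Type u} [Field k] {E : Type u} [Ring E] [Algebra k E] {𝒟 : ℕ → Submodule k E}
  [GradedAlgebra 𝒟] {ι κ : Type} [Fintype ι] [Fintype κ] {x : ι → E}

namespace IsGeneratedBy

theorem zcomp_zero_mul (hx : IsGeneratedBy 𝒟 x) {a : E} (ha : zcomp 𝒟 0 a = 0) (b : E) :
    zcomp 𝒟 0 (a * b) = 0 := by
  obtain ⟨c, rfl⟩ := hx.exists_sum_right ha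
  rw [Finset.sum_mul]
  simp_rw [mul_assoc]
  exact hx.zcomp_zero_sum_right _

/-- An idempotent of positive degree vanishes. -/
theorem eq_zero_of_idempotent (hx : IsGeneratedBy 𝒟 x) {n : E} (hn : zcomp 𝒟 0 n = 0)
    (hnn : n * n = n) : n = 0 := by
  let K : Submodule k (Unit → E) := LinearMap.range (colMap k (Matrix.of fun _ _ : Unit => (1 : E))
    ∘ₗ (LinearMap.mulRight k n).compLeft Unit)
  have hK : ∀ a : E, (fun _ => a * n) ∈ K := fun a =>
    ⟨fun _ => a, by funext i; simp [Matrix.mulVec, dotProduct]⟩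
  have hK' : ∀ z ∈ K, ∃ a : E, z = fun _ => a * n := by
    rintro _ ⟨b, rfl⟩
    exact ⟨b (), by funext i; simp [Matrix.mulVec, dotProduct]⟩
  obtain ⟨b, hb⟩ := hx.exists_sum_right hn
  have hle : K ≤ ⊥ := by
    refine hx.nakayama (by simp) (by simp +contextual [funext_iff]) fun z hz => ?_
    obtain ⟨a, rfl⟩ := hK' z hz
    obtain ⟨c, b', hb'⟩ := hx.exists_right a
    -- Here `n = ∑ xᵢ bᵢ` and `a = c + ∑ xᵢ b'ᵢ`. As `n = n n`, this gives `a n = ∑ xᵢ (c bᵢ + b'ᵢ)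
    -- n`, so `E n` is spanned by the `xᵢ E n` and vanishes by Nakayama.
    refine ⟨0, zero_mem _, fun i _ => (algebraMap k E c * b i + b' i) * n, fun i => hK _, ?_⟩
    funext j
    simp only [zero_add, Finset.sum_apply]
    conv_lhs => rw [hb', add_mul, ← hnn]
    conv_lhs => enter [1, 2, 1]; rw [hb]
    rw [Finset.sum_mul, Finset.sum_mul, Finset.mul_sum, ← Finset.sum_add_distrib]
    refine Finset.sum_congr rfl fun i _ => ?_
    rw [add_mul, mul_add, hnn]
    simp only [← mul_assoc]
    rw [Algebra.commutes c (x i)]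
  have h1 := hle (hK 1)
  rw [Submodule.mem_bot] at h1
  simpa using congrFun h1 ()

end IsGeneratedBy

theorem linearMap_pi_eq_sum (F : (κ → E) →ₗ[E] E) (z : κ → E) :
    ∃ b : κ → E, F z = ∑ i, z i * b i ∧ ∀ w : κ → E, F w = ∑ i, w i * b i := by
  classical
  have : ∀ w : κ → E, F w = ∑ i, w i * F (Pi.single i 1) := by
    intro w
    conv_lhs => rw [← Finset.univ_sum_single w, map_sum]
    refine Finset.sum_congr rfl fun i _ => ?_
    rw [← smul_eq_mul, ← map_smul]
    congr 1
    rw [← Pi.single_smul, smul_eq_mul, mul_one]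
  exact ⟨_, this z, this⟩

/-- In a regular algebra of global dimension three with syzygy matrix `T`, the kernel of `T` is
free of rank one, generated by a row of elements of degree one. -/
theorem exists_last_syzygy (hx : IsGeneratedBy 𝒟 x) {T : Matrix κ ι E} (hT : IsSyzygyMatrix x T)
    {d : ℕ} (hTd : ∀ i j, T i j ∈ 𝒟 d)
    (hmin : ∀ v : κ → k, T.vecMul (fun i => algebraMap k E (v i)) = 0 → v = 0)
    (hpd : HasProjectiveDimensionLT (trivialModule 𝒟) 4) (hG : IsGorensteinLeft 𝒟 3) :
    ∃ t : κ → E, (∀ i, t i ∈ 𝒟 1) ∧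
      (∀ b, T.vecMul b = 0 ↔ ∃ a : E, (fun i => a * t i) = b) ∧
      ∀ a : E, (∀ i, a * t i = 0) → a = 0 := by
  classical
  have hdual := exists_dual_functional hx hT hG
  have hproj := projective_ker_syzMap hx hT hpd
  have hmem : ∀ b, b ∈ LinearMap.ker (syzMap hx hT) ↔ T.vecMul b = 0 :=
    fun b => mem_ker_syzMap hx hT
  set K := LinearMap.ker (syzMap hx hT)
  obtain ⟨ε, hadd, hsurj, hact, hker⟩ := hdual
  have hε0 : ε 0 = 0 := by simpa using hadd 0 0
  have hcomp : ∀ b ∈ K, ∀ m, vcomp 𝒟 κ m b ∈ K := by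
    intro b hb m
    rw [hmem] at hb ⊢
    have := isShift_rowMap (k := k) hTd m b
    simp only [rowMap_apply, hb, map_zero] at this
    exact this.symm
  -- The degree-zero part of a syzygy is a scalar syzygy, which `hmin` excludes; `K` lives in
  -- positive degrees.
  have hzero : ∀ b ∈ K, vcomp 𝒟 κ 0 b = 0 := by
    intro b hb
    choose v hv using fun i => hx.exists_scalar (b i)
    have h1 : vcomp 𝒟 κ 0 b = fun i => algebraMap k E (v i) := funext hv
    have h2 := (hmem _).1 (hcomp b hb 0)
    rw [h1] at h2
    rw [h1, hmin v h2]
    funext i; simp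
  obtain ⟨g, hg⟩ := hsurj 1
  have hrestr : ∀ F : (κ → E) →ₗ[E] E, ∀ z ∈ K, zcomp 𝒟 0 (F z) = 0 := by
    intro F z hz
    obtain ⟨b, hb, -⟩ := linearMap_pi_eq_sum F z
    rw [hb, map_sum]
    exact Finset.sum_eq_zero fun i _ => hx.zcomp_zero_mul (congrFun (hzero z hz) i) _
  -- The functional `f - g · ε(f)` is killed by `ε`, so it extends to the free module and takes
  -- values without constant term on `K`. Thus `g` alone detects constant terms.
  have hA : ∀ (f : K →ₗ[E] E) (z : K), zcomp 𝒟 0 (g z) = 0 → zcomp 𝒟 0 (f z) = 0 := by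
    intro f z hz
    have hs : zcomp 𝒟 0 (algebraMap k E (ε f)) = algebraMap k E (ε f) :=
      zcomp_of_mem_same (m := 0) (algebraMap_mem_zero _)
    have h1 := hact g (algebraMap k E (ε f)) (ε f) hs
    rw [hg, one_mul] at h1
    have h2 := hadd (f - (LinearMap.toSpanSingleton E E (algebraMap k E (ε f))).comp g)
      ((LinearMap.toSpanSingleton E E (algebraMap k E (ε f))).comp g)
    rw [sub_add_cancel, h1] at h2
    obtain ⟨F, hF⟩ := (hker _).1 (by simpa using h2)
    have h3 : f z = F z + g z * algebraMap k E (ε f) := by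
      have := LinearMap.congr_fun hF z
      simp only [LinearMap.sub_apply, LinearMap.comp_apply, LinearMap.toSpanSingleton_apply,
        smul_eq_mul, Submodule.subtype_apply] at this
      rw [← this, sub_add_cancel]
    rw [h3, map_add, hrestr F z z.2, hx.zcomp_zero_mul hz, add_zero]
  obtain ⟨sec, hsec⟩ := hproj.out
  -- By projectivity `z` is the sum of its coordinates times elements of `K`. The coordinates are
  -- functionals, so by `hA` they lie in the augmentation ideal.
  have hB : ∀ z : K, zcomp 𝒟 0 (g z) = 0 → ∃ ζ : ι → K, z = ∑ i, x i • ζ i := by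
    intro z hz
    have h1 : ∀ y : K, ∃ b : ι → E, sec z y = ∑ i, x i * b i := fun y =>
      hx.exists_sum_right (hA ((Finsupp.lapply y).comp sec) z hz)
    choose b hb using h1
    refine ⟨fun i => ∑ y ∈ (sec z).support, b y i • y, ?_⟩
    conv_lhs => rw [← hsec z, Finsupp.linearCombination_apply, Finsupp.sum]
    simp_rw [Finset.smul_sum]
    rw [Finset.sum_comm]
    refine Finset.sum_congr rfl fun y _ => ?_
    rw [hb, Finset.sum_smul]
    simp [mul_smul]
  -- Otherwise every element of `K` is a combination of the `xᵢ K`, so `K = 0` by Nakayama and `g =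
  -- 0`, against `ε g = 1`.
  obtain ⟨z₀, hz₀⟩ : ∃ z : K, zcomp 𝒟 0 (g z) ≠ 0 := by
    by_contra! hcon
    have hle : K.restrictScalars k ≤ ⊥ := by
      refine hx.nakayama (by simp) (by simp +contextual [funext_iff]) fun z hz => ?_
      obtain ⟨ζ, hζ⟩ := hB ⟨z, hz⟩ (hcon _)
      refine ⟨0, zero_mem _, fun i => ζ i, fun i => (ζ i).2, ?_⟩
      have := congrArg Subtype.val hζ
      simp only [AddSubmonoidClass.coe_finsetSum] at this
      rw [zero_add, this]
      rfl
    have hg0 : g = 0 := by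
      ext z
      have : (z : κ → E) = 0 := (Submodule.mem_bot k).1 (hle z.2)
      rw [Subtype.ext (a1 := z) (a2 := 0) this]; simp
    rw [hg0, hε0] at hg
    exact zero_ne_one hg
  obtain ⟨s, y, hyK, hys, hgy⟩ : ∃ (s : ℤ) (y : κ → E) (hy : y ∈ K), y ∈ vpart 𝒟 κ s ∧
      zcomp 𝒟 0 (g ⟨y, hy⟩) ≠ 0 := by
    by_contra! hcon
    obtain ⟨M, hM⟩ := exists_sum_vcomp_eq (𝒟 := 𝒟) (z₀ : κ → E)
    have h1 : z₀ = ∑ n ∈ Finset.range M, ⟨vcomp 𝒟 κ (n : ℤ) z₀, hcomp z₀ z₀.2 n⟩ := by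
      apply Subtype.ext
      rw [AddSubmonoidClass.coe_finsetSum]
      exact (hM M le_rfl).symm
    apply hz₀
    rw [h1, map_sum, map_sum]
    exact Finset.sum_eq_zero fun n _ => hcon n _ _ (vcomp_mem _ _)
  obtain ⟨c, hc⟩ := hx.exists_scalar (g ⟨y, hyK⟩)
  have hc0 : c ≠ 0 := by
    rintro rfl
    rw [map_zero] at hc
    exact hgy hc
  have hy0 : y ≠ 0 := by
    rintro rfl
    apply hgy
    have : g ⟨0, hyK⟩ = 0 := map_zero g
    rw [this, map_zero]
  let p : E →ₗ[E] K := LinearMap.toSpanSingleton E K ⟨y, hyK⟩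
  have hp : ∀ a, ((p a : K) : κ → E) = fun i => a * y i := fun a => rfl
  have hshift : IsShift 𝒟 (rowMap k (Matrix.of fun (_ : Unit) i => y i)) s.toNat := by
    refine isShift_rowMap fun _ i => ?_
    have hi := mem_vpart.1 hys i
    rcases lt_or_ge s 0 with hs | hs
    · exact absurd (eq_zero_of_mem_vpart_of_neg hs hys) hy0
    · rw [← Int.toNat_of_nonneg hs, zpart_natCast] at hi
      exact hi
  have hs0 : 0 ≤ s := by
    by_contra hs
    exact hy0 (eq_zero_of_mem_vpart_of_neg (not_le.1 hs) hys)
  have hvc : ∀ (m : ℤ) (a : E), vcomp 𝒟 κ (m + s) (fun i => a * y i) =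
      fun i => zcomp 𝒟 m a * y i := by
    intro m a
    have := hshift m (fun _ => a)
    rw [Int.toNat_of_nonneg hs0] at this
    simpa [Matrix.vecMul, dotProduct, funext_iff, vcomp_apply] using this
  -- Subtracting the right scalar multiple of `y` makes the constant term of `g z` vanish, and `hB`
  -- applies to the difference; Nakayama concludes that `y` generates `K`.
  have hps : Function.Surjective p := by
    let N : Submodule k (κ → E) := (LinearMap.range (K.subtype ∘ₗ p)).restrictScalars k
    have hle : K.restrictScalars k ≤ N := by
      refine hx.nakayama ?_ ?_ fun z hz => ?_
      · rintro _ ⟨a, rfl⟩ m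
        refine ⟨zcomp 𝒟 (m - s) a, ?_⟩
        have := hvc (m - s) a
        rw [sub_add_cancel] at this
        exact this.symm
      · rintro i _ ⟨a, rfl⟩
        exact ⟨x i * a, by funext j; simp [hp, mul_assoc]⟩
      · obtain ⟨c', hc'⟩ := hx.exists_scalar (g ⟨z, hz⟩)
        obtain ⟨ζ, hζ⟩ := hB (⟨z, hz⟩ - algebraMap k E (c' / c) • ⟨y, hyK⟩) (by
          rw [map_sub, map_sub, hc', map_smul, smul_eq_mul, ← Algebra.smul_def, map_smul, hc,
            Algebra.smul_def, ← map_mul, div_mul_cancel₀ _ hc0, sub_self])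
        refine ⟨fun i => algebraMap k E (c' / c) * y i, ⟨algebraMap k E (c' / c), rfl⟩,
          fun i => ζ i, fun i => (ζ i).2, ?_⟩
        have := congrArg Subtype.val (sub_eq_iff_eq_add'.1 hζ)
        simp only [Submodule.coe_add, AddSubmonoidClass.coe_finsetSum] at this
        rw [this]
        rfl
    rintro ⟨z, hz⟩
    obtain ⟨a, ha⟩ := hle hz
    exact ⟨a, Subtype.ext ha⟩
  -- As `K` is projective, `p` splits, and `e`, the image of `y` under the section, satisfies `e y =
  -- y`, while `a y = 0` implies `a e = 0`. So `1 - e` is idempotent; its constant term kills `y ≠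
  -- 0`, hence vanishes, and then `1 - e = 0`.
  have hfree : ∀ a : E, (∀ i, a * y i = 0) → a = 0 := by
    obtain ⟨sc, hsc⟩ := Module.projective_lifting_property p LinearMap.id hps
    have hsc' : ∀ z, p (sc z) = z := LinearMap.congr_fun hsc
    set e := sc ⟨y, hyK⟩ with he
    have hey : ∀ i, e * y i = y i := by
      intro i
      have := congrArg Subtype.val (hsc' ⟨y, hyK⟩)
      exact congrFun this i
    have hae : ∀ a : E, (∀ i, a * y i = 0) → a * e = 0 := by
      intro a ha
      rw [he, ← smul_eq_mul, ← map_smul]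
      have : a • (⟨y, hyK⟩ : K) = 0 := Subtype.ext (funext ha)
      rw [this, map_zero]
    have hn0 : zcomp 𝒟 0 (1 - e) = 0 := by
      obtain ⟨b, hb⟩ := hx.exists_scalar (1 - e)
      have h1 := hvc 0 (1 - e)
      have h2 : (fun i => (1 - e) * y i) = 0 := by
        funext i; simp [sub_mul, hey]
      rw [h2, map_zero, hb] at h1
      rw [hb]
      by_cases hb0 : b = 0
      · rw [hb0, map_zero]
      · exfalso
        apply hy0
        funext i
        have h3 := congrFun h1 i
        simp only [Pi.zero_apply, ← Algebra.smul_def] at h3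
        exact (smul_eq_zero.1 h3.symm).resolve_left hb0
    have hne : (1 - e) * e = 0 := hae _ fun i => by simp [sub_mul, hey]
    have hn : 1 - e = 0 := hx.eq_zero_of_idempotent hn0 (by rw [mul_sub, hne, mul_one, sub_zero])
    intro a ha
    rw [← mul_one a, sub_eq_zero.1 hn]
    exact hae a ha
  have hpi : Function.Injective p := by
    rw [← LinearMap.ker_eq_bot, LinearMap.ker_eq_bot']
    intro a ha
    exact hfree a (fun i => congrFun (congrArg Subtype.val ha) i)
  let pe : E ≃ₗ[E] K := LinearEquiv.ofBijective p ⟨hpi, hps⟩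
  have hpe : pe.symm ⟨y, hyK⟩ = 1 := by
    rw [LinearEquiv.symm_apply_eq]
    exact Subtype.ext (funext fun i => (one_mul _).symm)
  -- For `a` without constant term, `ε` kills the coordinate functional of `K ≅ E` followed by right
  -- multiplication by `a`. Its extension to `E^κ`, evaluated at `y`, expresses `a` through the
  -- entries of `y`.
  have haug : ∀ a : E, zcomp 𝒟 0 a = 0 → ∃ b : κ → E, a = ∑ i, y i * b i := by
    intro a ha
    have h1 := hact pe.symm.toLinearMap a 0 (by rw [ha, map_zero])
    rw [mul_zero] at h1
    obtain ⟨F, hF⟩ := (hker _).1 h1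
    obtain ⟨b, hb, -⟩ := linearMap_pi_eq_sum F y
    refine ⟨b, ?_⟩
    rw [← hb]
    have := LinearMap.congr_fun hF ⟨y, hyK⟩
    simpa [hpe] using this
  have hxne : ∃ j, x j ≠ 0 := by
    by_contra! hcon
    apply hy0
    funext i
    obtain ⟨b, hb⟩ := hx.exists_sum_left (congrFun (hzero y hyK) i)
    rw [hb]
    simp [hcon]
  -- The degree `s` of `y` is positive by `hzero`. If it exceeded one, no nonzero generator `x j`
  -- could be a right combination of the entries of `y`.
  have hs1 : s = 1 := by
    obtain ⟨j, hj⟩ := hxne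
    have hx1 : x j ∈ zpart 𝒟 1 := hx.mem j
    rcases lt_trichotomy s 1 with h | h | h
    · exfalso
      have : s = 0 := by omega
      subst this
      exact hy0 (by rw [← vcomp_of_mem_same hys, hzero y hyK])
    · exact h
    · exfalso
      obtain ⟨b, hb⟩ := haug (x j) (zcomp_of_mem_ne hx1 (by omega))
      apply hj
      rw [← zcomp_of_mem_same hx1, hb, map_sum]
      refine Finset.sum_eq_zero fun i _ => ?_
      have hi := mem_vpart.1 hys i
      rw [← Int.toNat_of_nonneg hs0, zpart_natCast] at hi
      have := zcomp_mul_of_left_mem hi (1 - s) (b i)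
      rw [Int.toNat_of_nonneg hs0, sub_add_cancel, zcomp_of_neg 𝒟 (m := 1 - s) (by omega),
        mul_zero] at this
      exact this
  subst hs1
  refine ⟨y, fun i => mem_vpart.1 hys i, fun b => ?_, hfree⟩
  rw [← hmem]
  constructor
  · intro hb
    obtain ⟨a, ha⟩ := hps ⟨b, hb⟩
    exact ⟨a, congrArg Subtype.val ha⟩
  · rintro ⟨a, rfl⟩
    exact (p a).2

end LastSyzygy

end TypeA

namespace TypeA

/-! ### Filtered modules and vanishing of `Tor` over their associated graded modules -/

section Filtered

variable {k : Type u} [Field k] {E : Type u} [Ring E] [Algebra k E] (𝒟 : ℕ → Submodule k E)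

section Defs

variable {M : Type u} [AddCommGroup M] [Module E M] [Module k M]

/-- An exhaustive filtration of a module over a graded algebra, starting with `0`. -/
structure IsFiltration (G : ℕ → Submodule k M) : Prop where
  zero : G 0 = ⊥
  mono : Monotone G
  exhaustive : ∀ y, ∃ n, y ∈ G n
  smul_mem : ∀ {d n : ℕ} {a : E} {y : M}, a ∈ 𝒟 d → y ∈ G n → a • y ∈ G (n + d)

/-- The action of a matrix on columns with entries in a module. -/
def act {ι κ : Type} [Fintype ι] (A : Matrix κ ι E) (u : ι → M) : κ → M :=
  fun i => ∑ j, A i j • u j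

/-- Exactness at the middle term of the complex on the associated graded module of a filtration
induced by matrices `A`, `B` of linear forms. -/
def IsExactAt (G : ℕ → Submodule k M) {ι κ σ : Type} [Fintype ι] [Fintype σ]
    (A : Matrix κ ι E) (B : Matrix ι σ E) : Prop :=
  ∀ n, ∀ u : ι → M, (∀ i, u i ∈ G (n + 1)) → (∀ i, act A u i ∈ G (n + 1)) →
    ∃ v : σ → M, (∀ i, v i ∈ G n) ∧ ∀ i, u i - act B v i ∈ G n

end Defs

section Act

variable {M N : Type u} [AddCommGroup M] [Module E M] [AddCommGroup N] [Module E N]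
  {ι κ σ : Type} [Fintype ι] [Fintype σ]

theorem act_sub (A : Matrix κ ι E) (u v : ι → M) : act A (u - v) = act A u - act A v := by
  funext i; simp [act, smul_sub]

theorem act_mul (A : Matrix κ ι E) (B : Matrix ι σ E) (u : σ → M) :
    act A (act B u) = act (A * B) u := by
  funext i
  simp only [act, Matrix.mul_apply, Finset.smul_sum, Finset.sum_smul, mul_smul]
  exact Finset.sum_comm

theorem act_zero_matrix (u : ι → M) : act (0 : Matrix κ ι E) u = 0 := by
  funext i; simp [act]

theorem map_act (f : M →ₗ[E] N) (A : Matrix κ ι E) (u : ι → M) (i : κ) :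
    f (act A u i) = act A (fun j => f (u j)) i := by
  simp [act]

end Act

variable {𝒟}

theorem IsFiltration.act_mem {M : Type u} [AddCommGroup M] [Module E M] [Module k M]
    {G : ℕ → Submodule k M} (hG : IsFiltration 𝒟 G) {ι κ : Type} [Fintype ι] {A : Matrix κ ι E}
    (hA : ∀ i j, A i j ∈ 𝒟 1) {n : ℕ} {u : ι → M} (hu : ∀ i, u i ∈ G n) (i : κ) :
    act A u i ∈ G (n + 1) :=
  Submodule.sum_mem _ fun j _ => hG.smul_mem (hA i j) (hu j)

/-! ### Kernels of strict surjections -/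

section Shift

variable {M P : Type u} [AddCommGroup M] [Module E M] [Module k M] [IsScalarTower k E M]
  [AddCommGroup P] [Module E P] [Module k P] [IsScalarTower k E P]

/-- A strict surjection of filtered modules. -/
structure IsStrictCover (H : ℕ → Submodule k P) (G : ℕ → Submodule k M) (π : P →ₗ[E] M) :
    Prop where
  map_mem : ∀ n y, y ∈ H n → π y ∈ G n
  lift : ∀ n z, z ∈ G n → ∃ y ∈ H n, π y = z

/-- The filtration induced on a kernel. -/
def kerFiltration (H : ℕ → Submodule k P) (π : P →ₗ[E] M) (n : ℕ) :
    Submodule k (LinearMap.ker π) :=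
  (H n).comap ((LinearMap.ker π).subtype.restrictScalars k)

omit [Module k M] [IsScalarTower k E M] in
theorem isFiltration_kerFiltration {H : ℕ → Submodule k P} (hH : IsFiltration 𝒟 H)
    (π : P →ₗ[E] M) : IsFiltration 𝒟 (kerFiltration H π) where
  zero := by
    rw [eq_bot_iff]
    intro y hy
    have : (y : P) ∈ H 0 := hy
    rw [hH.zero] at this
    exact Subtype.ext this
  mono m n h y hy := hH.mono h hy
  exhaustive y := hH.exhaustive y
  smul_mem ha hy := hH.smul_mem ha hy

-- Dimension shifting for `Tor(k, gr -)`: along `0 → ker π → P → M → 0`, exactness at `A, B` for the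
-- kernel follows from exactness at `A, B` for `P` and at `B, C`, one place further, for `M`.
omit [IsScalarTower k E M] in
theorem isExactAt_kerFiltration {H : ℕ → Submodule k P} {G : ℕ → Submodule k M}
    (hH : IsFiltration 𝒟 H) {π : P →ₗ[E] M} (hπ : IsStrictCover H G π)
    {ι κ σ τ : Type} [Fintype ι] [Fintype σ] [Fintype τ]
    {A : Matrix κ ι E} {B : Matrix ι σ E} {C : Matrix σ τ E}
    (hB : ∀ i j, B i j ∈ 𝒟 1) (hC : ∀ i j, C i j ∈ 𝒟 1) (hBC : B * C = 0)
    (hP : IsExactAt H A B) (hM : IsExactAt G B C) :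
    IsExactAt (kerFiltration H π) A B := by
  intro n u hu hAu
  have hcoe : ∀ i, ((act A u i : LinearMap.ker π) : P) = act A (fun j => (u j : P)) i := fun i =>
    map_act (LinearMap.ker π).subtype A u i
  obtain ⟨v, hv, huv⟩ := hP n (fun j => (u j : P)) hu (fun i => by rw [← hcoe]; exact hAu i)
  have hπu : ∀ i, π (u i) = 0 := fun i => (u i).2
  -- The hypothesis on `M` is used one filtration step lower; for `n = 0` there is none, but then `v
  -- = 0`.
  rcases n with _ | n
  · refine ⟨0, fun i => zero_mem _, fun i => ?_⟩
    have h1 : v = 0 := funext fun i => by simpa [hH.zero] using hv i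
    have h2 := huv i
    rw [h1] at h2
    have h3 : act B (0 : σ → P) i = 0 := by simp [act]
    have h4 : act B (0 : σ → LinearMap.ker π) i = 0 := by simp [act]
    rw [h3, sub_zero] at h2
    rw [h4, sub_zero]
    exact h2
  -- The symbol of `π v` is a cycle, because `π u = 0`; so `π v` is `C w` up to lower terms.
  -- Subtracting lifts of `C w` and of the lower terms moves `v` into the kernel. As `B C = 0`, the
  -- image under `B` changes only in lower order.
  obtain ⟨w, hw, hvw⟩ := hM n (fun j => π (v j)) (fun i => hπ.map_mem _ _ (hv i)) (fun i => by
    rw [← map_act]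
    have := hπ.map_mem _ _ (huv i)
    rw [map_sub, hπu, zero_sub] at this
    simpa using neg_mem this)
  choose w' hw' hπw using fun i => hπ.lift n (w i) (hw i)
  choose c hc hπc using fun i => hπ.lift n _ (hvw i)
  have hker : ∀ i, π ((v - act C w' - c) i) = 0 := by
    intro i
    simp only [Pi.sub_apply, map_sub, hπc, map_act, hπw]
    abel
  refine ⟨fun i => ⟨(v - act C w' - c) i, hker i⟩, fun i => ?_, fun i => ?_⟩
  · change (v - act C w' - c) i ∈ H (n + 1)
    exact sub_mem (sub_mem (hv i) (hH.act_mem hC hw' i)) (hH.mono n.le_succ (hc i))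
  · have h1 : (((u i - act B (fun i => (⟨(v - act C w' - c) i, hker i⟩ : LinearMap.ker π)) i :
        LinearMap.ker π)) : P) = (u i : P) - act B v i + act B c i := by
      have := map_act (LinearMap.ker π).subtype B
        (fun i => (⟨(v - act C w' - c) i, hker i⟩ : LinearMap.ker π)) i
      simp only [Submodule.subtype_apply] at this
      rw [AddSubgroupClass.coe_sub, this]
      change (u i : P) - act B (v - act C w' - c) i = _
      rw [act_sub, act_sub, act_mul, hBC, act_zero_matrix]
      simp only [Pi.sub_apply, Pi.zero_apply]
      abel
    have h2 : (u i : P) - act B v i + act B c i ∈ H (n + 1) :=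
      add_mem (huv i) (hH.act_mem hB hc i)
    rw [← h1] at h2
    exact h2

end Shift

/-! ### Filtered free modules -/

section Free

variable [GradedAlgebra 𝒟] {I : Type u}

variable (𝒟) in
/-- The filtration of the free module on generators of prescribed degrees `w`. -/
def freeFiltration (w : I → ℕ) (n : ℕ) : Submodule k (I →₀ E) where
  carrier := {f | ∀ i, ∀ m : ℤ, (n : ℤ) ≤ m + w i → zcomp 𝒟 m (f i) = 0}
  zero_mem' := by simp
  add_mem' := by
    intro f g hf hg i m hm
    rw [Finsupp.add_apply, map_add, hf i m hm, hg i m hm, add_zero]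
  smul_mem' := by
    intro c f hf i m hm
    rw [Finsupp.smul_apply, map_smul, hf i m hm, smul_zero]

variable {w : I → ℕ}

theorem single_mem_freeFiltration {n : ℕ} {i : I} {a : E}
    (h : ∀ m : ℤ, (n : ℤ) ≤ m + w i → zcomp 𝒟 m a = 0) :
    Finsupp.single i a ∈ freeFiltration 𝒟 w n := by
  classical
  intro j m hm
  rw [Finsupp.single_apply]
  split_ifs with hij
  · subst hij; exact h m hm
  · exact map_zero _

theorem isFiltration_freeFiltration : IsFiltration 𝒟 (freeFiltration 𝒟 w) where
  zero := by
    rw [eq_bot_iff]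
    intro f hf
    rw [Submodule.mem_bot]
    ext i
    refine eq_zero_of_zcomp_eq_zero (𝒟 := 𝒟) fun m => ?_
    rcases lt_or_ge m 0 with hm | hm
    · exact zcomp_of_neg 𝒟 hm _
    · exact hf i m (by push_cast; omega)
  mono := by
    intro a b hab f hf i m hm
    exact hf i m (by omega)
  exhaustive := by
    intro f
    have hb : ∀ a : E, ∃ N : ℕ, ∀ m : ℤ, (N : ℤ) ≤ m → zcomp 𝒟 m a = 0 := by
      intro a
      obtain ⟨N, hN⟩ := exists_sum_zcomp_eq (𝒟 := 𝒟) a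
      refine ⟨N, fun m hm => ?_⟩
      rw [← hN N le_rfl, map_sum]
      refine Finset.sum_eq_zero fun n hn => zcomp_of_mem_ne (zcomp_mem 𝒟 n a) ?_
      have := Finset.mem_range.1 hn
      omega
    choose N hN using hb
    refine ⟨f.support.sup fun i => N (f i) + w i, fun i m hm => ?_⟩
    by_cases hi : i ∈ f.support
    · have := Finset.le_sup (f := fun i => N (f i) + w i) hi
      exact hN (f i) m (by omega)
    · rw [Finsupp.notMem_support_iff.1 hi, map_zero]
  smul_mem := by
    intro d n a f ha hf i m hm
    have := zcomp_mul_of_left_mem ha (m - d) (f i)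
    rw [sub_add_cancel] at this
    rw [Finsupp.smul_apply, smul_eq_mul, this, hf i (m - d) (by push_cast at hm; omega), mul_zero]

/-- The associated graded module is a sum of copies of `E` shifted by the `w i`, so exactness over
`E` applies coordinate by coordinate, in degree `n - w i`. -/
theorem isExactAt_freeFiltration {ι κ σ : Type} [Fintype ι] [Fintype σ]
    {A : Matrix κ ι E} {B : Matrix ι σ E} (hA : ∀ i j, A i j ∈ 𝒟 1) (hB : ∀ i j, B i j ∈ 𝒟 1)
    (hAB : ∀ u, A.mulVec u = 0 → ∃ v, B.mulVec v = u) :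
    IsExactAt (freeFiltration 𝒟 w) A B := by
  classical
  intro n u hu hAu
  have hactE : ∀ {α β : Type} [Fintype β] (C : Matrix α β E) (y : β → I →₀ E) (j : α) (i : I),
      act C y j i = C.mulVec (fun b => y b i) j := by
    intro α β _ C y j i
    simp [act, Matrix.mulVec, dotProduct, Finsupp.finsetSum_apply]
  -- The last clause is what makes the chosen solutions finitely supported.
  have key : ∀ i : I, ∃ v : σ → E, v ∈ vpart 𝒟 σ ((n : ℤ) - w i - 1) ∧
      B.mulVec v = vcomp 𝒟 ι ((n : ℤ) - w i) (fun j => u j i) ∧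
      ((∀ j, u j i = 0) → v = 0) := by
    intro i
    by_cases h0 : ∀ j, u j i = 0
    · refine ⟨0, zero_mem _, ?_, fun _ => rfl⟩
      have : (fun j => u j i) = 0 := funext h0
      rw [this, map_zero, Matrix.mulVec_zero]
    · have h1 : A.mulVec (vcomp 𝒟 ι ((n : ℤ) - w i) (fun j => u j i)) = 0 := by
        have := isShift_colMap (k := k) hA ((n : ℤ) - w i) (fun j => u j i)
        rw [colMap_apply, colMap_apply] at this
        rw [← this]
        funext j
        rw [vcomp_apply, ← hactE]
        exact hAu j i _ (by push_cast; omega)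
      obtain ⟨v, hv, hv'⟩ := (isShift_colMap (k := k) hB).exists_homogeneous (vcomp_mem _ _)
        (hAB _ h1)
      exact ⟨v, by exact_mod_cast hv, hv', fun h => absurd h h0⟩
  choose v hv hBv hv0 using key
  refine ⟨fun s => Finsupp.onFinset (Finset.univ.biUnion fun j => (u j).support)
    (fun i => v i s) ?_, fun s i m hm => ?_, fun j i m hm => ?_⟩
  · intro i hi
    by_contra hcon
    apply hi
    rw [hv0 i fun j => ?_]
    · rfl
    · by_contra hj
      exact hcon (Finset.mem_biUnion.2 ⟨j, Finset.mem_univ _, Finsupp.mem_support_iff.2 hj⟩)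
  · exact zcomp_of_mem_ne (mem_vpart.1 (hv i) s) (by omega)
  · rw [Finsupp.sub_apply, hactE, map_sub]
    change zcomp 𝒟 m (u j i) - zcomp 𝒟 m (B.mulVec (v i) j) = 0
    rw [hBv i, vcomp_apply]
    by_cases hmn : m = (n : ℤ) - w i
    · subst hmn
      rw [zcomp_of_mem_same (zcomp_mem 𝒟 _ _), sub_self]
    · rw [zcomp_of_mem_ne (zcomp_mem 𝒟 _ _) (Ne.symm hmn), sub_zero]
      exact hu j i m (by push_cast; omega)

variable {M : Type u} [AddCommGroup M] [Module E M] [Module k M] [IsScalarTower k E M]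
  {G : ℕ → Submodule k M}

omit [IsScalarTower k E M] in
theorem linearCombination_mem_of_mem_freeFiltration (hG : IsFiltration 𝒟 G) {β : I → M}
    (hβ : ∀ i, β i ∈ G (w i + 1)) {n : ℕ} {f : I →₀ E} (hf : f ∈ freeFiltration 𝒟 w n) :
    Finsupp.linearCombination E β f ∈ G n := by
  rw [Finsupp.linearCombination_apply]
  refine Submodule.sum_mem _ fun i _ => ?_
  simp only
  obtain ⟨N, hN⟩ := exists_sum_zcomp_eq (𝒟 := 𝒟) (f i)
  rw [← hN N le_rfl, Finset.sum_smul]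
  refine Submodule.sum_mem _ fun m _ => ?_
  by_cases hm : n ≤ m + w i
  · rw [hf i m (by exact_mod_cast hm), zero_smul]; exact zero_mem _
  · exact hG.mono (by omega) (hG.smul_mem (zcomp_mem 𝒟 m (f i)) (hβ i))

omit [IsScalarTower k E M] in
/-- The free cover of a filtered module on all elements of the pieces of the filtration. -/
theorem isStrictCover_linearCombination (hG : IsFiltration 𝒟 G) :
    IsStrictCover (freeFiltration 𝒟 (fun i : Σ n, G (n + 1) => i.1)) G
      (Finsupp.linearCombination E fun i : Σ n, G (n + 1) => (i.2 : M)) where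
  map_mem n y hy := linearCombination_mem_of_mem_freeFiltration hG (fun i => i.2.2) hy
  lift n z hz := by
    rcases n with _ | n
    · refine ⟨0, zero_mem _, ?_⟩
      rw [hG.zero, Submodule.mem_bot] at hz
      rw [map_zero, hz]
    · refine ⟨Finsupp.single ⟨n, z, hz⟩ 1, single_mem_freeFiltration fun m hm => ?_, by simp⟩
      exact zcomp_of_mem_ne (m := 0) (SetLike.GradedOne.one_mem (A := 𝒟)) (by push_cast at hm; omega)

end Free

/-! ### The criterion for freeness -/

section Criterion

variable [GradedAlgebra 𝒟] {ι : Type} [Fintype ι] {x : ι → E}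
  {M : Type u} [AddCommGroup M] [Module E M] [Module k M] [IsScalarTower k E M]

/-- The part of the next step of a filtration that is generated by the previous steps. -/
def decomposablePart (x : ι → E) (G : ℕ → Submodule k M) (n : ℕ) : Submodule k M where
  carrier := {y | ∃ g ∈ G n, ∃ h : ι → M, (∀ i, h i ∈ G n) ∧ y = g + ∑ i, x i • h i}
  zero_mem' := ⟨0, zero_mem _, 0, fun _ => zero_mem _, by simp⟩
  add_mem' := by
    rintro _ _ ⟨g, hg, h, hh, rfl⟩ ⟨g', hg', h', hh', rfl⟩
    refine ⟨g + g', add_mem hg hg', h + h', fun i => add_mem (hh i) (hh' i), ?_⟩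
    simp only [Pi.add_apply, smul_add, Finset.sum_add_distrib]
    abel
  smul_mem' := by
    rintro c _ ⟨g, hg, h, hh, rfl⟩
    refine ⟨c • g, Submodule.smul_mem _ _ hg, c • h, fun i => Submodule.smul_mem _ _ (hh i), ?_⟩
    rw [smul_add, Finset.smul_sum]
    congr 1
    refine Finset.sum_congr rfl fun i _ => ?_
    rw [Pi.smul_apply, ← algebraMap_smul E c (h i), ← algebraMap_smul E c (x i • h i), smul_smul,
      smul_smul, Algebra.commutes]

/-- The `β j` lift a basis of the degree-`n` part of `gr M` modulo what the generators produce from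
lower degrees, that is, of `k ⊗ gr M`. -/
theorem exists_filtered_generators (x : ι → E) (G : ℕ → Submodule k M) (n : ℕ) :
    ∃ (J : Type u) (β : J → M), (∀ j, β j ∈ G (n + 1)) ∧
      (∀ y ∈ G (n + 1), ∃ c : J →₀ k,
        y - Finsupp.linearCombination k β c ∈ decomposablePart x G n) ∧
      ∀ c : J →₀ k, Finsupp.linearCombination k β c ∈ decomposablePart x G n → c = 0 := by
  let W : Submodule k (G (n + 1)) := (decomposablePart x G n).comap (G (n + 1)).subtype
  let b := Module.Basis.ofVectorSpace k (G (n + 1) ⧸ W)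
  choose β hβ using fun j => W.mkQ_surjective (b j)
  have hlc : ∀ c : _ →₀ k, W.mkQ (Finsupp.linearCombination k β c) =
      Finsupp.linearCombination k b c := by
    intro c
    rw [← LinearMap.comp_apply, ← Finsupp.linearCombination_linear_comp]
    congr 1
    congr 1
    funext j
    exact hβ j
  have hcoe : ∀ c : _ →₀ k, (Finsupp.linearCombination k (fun j => (β j : M)) c) =
      ((Finsupp.linearCombination k β c : G (n + 1)) : M) := by
    intro c
    have := Finsupp.linearCombination_linear_comp (R := k) (G (n + 1)).subtype (v := β)
    exact LinearMap.congr_fun this c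
  refine ⟨_, fun j => β j, fun j => (β j).2, fun y hy => ?_, fun c hc => ?_⟩
  · refine ⟨b.repr (W.mkQ ⟨y, hy⟩), ?_⟩
    rw [hcoe]
    have h1 : (⟨y, hy⟩ : G (n + 1)) - Finsupp.linearCombination k β (b.repr (W.mkQ ⟨y, hy⟩)) ∈ W := by
      rw [← Submodule.Quotient.mk_eq_zero, ← Submodule.mkQ_apply, map_sub, hlc,
        b.linearCombination_repr, sub_self]
    exact h1
  · rw [hcoe] at hc
    have h1 : Finsupp.linearCombination k β c ∈ W := hc
    rw [← Submodule.Quotient.mk_eq_zero, ← Submodule.mkQ_apply, hlc] at h1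
    have h2 := congrArg b.repr h1
    rwa [b.repr_linearCombination, map_zero] at h2

/-- The hypothesis says `Tor₁(k, gr M) = 0`. A minimal free cover of `gr M`, which is bounded below,
is then an isomorphism, and it lifts to the filtered module. The proof works with the filtrations
directly. -/
theorem free_of_isExactAt (hx : IsGeneratedBy 𝒟 x) {G : ℕ → Submodule k M}
    (hG : IsFiltration 𝒟 G) {σ : Type} [Fintype σ] {X : Matrix (Fin 1) ι E} (hX : X = fun _ i => x i)
    {R : Matrix ι σ E} (hR : ∀ i j, R i j ∈ 𝒟 1) (hXR : X * R = 0) (hex : IsExactAt G X R) :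
    Module.Free E M := by
  classical
  choose J β hβ hspan hindep using exists_filtered_generators x G
  let w : (Σ n, J n) → ℕ := fun i => i.1
  let H := freeFiltration 𝒟 w
  have hH : IsFiltration 𝒟 H := isFiltration_freeFiltration
  let π : ((Σ n, J n) →₀ E) →ₗ[E] M := Finsupp.linearCombination E fun i : Σ n, J n => β i.1 i.2
  have hmap : ∀ n f, f ∈ H n → π f ∈ G n := fun n f hf =>
    linearCombination_mem_of_mem_freeFiltration (β := fun i : Σ n, J n => β i.1 i.2) hG
      (fun i => hβ i.1 i.2) hf
  have hactX : ∀ {N : Type u} [AddCommGroup N] [Module E N] (u : ι → N) (i : Fin 1),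
      act X u i = ∑ s, x s • u s := by
    intro N _ _ u i
    simp [act, hX]
  let top : ∀ n, (J n →₀ k) → ((Σ n, J n) →₀ E) := fun n c =>
    c.sum fun j a => Finsupp.single ⟨n, j⟩ (algebraMap k E a)
  have htop : ∀ n c, top n c ∈ H (n + 1) := by
    intro n c
    refine Submodule.sum_mem _ fun j _ => single_mem_freeFiltration fun m hm => ?_
    refine zcomp_of_mem_ne (m := 0) (algebraMap_mem_zero _) ?_
    simp only [w] at hm
    push_cast at hm
    omega
  have hπtop : ∀ n c, π (top n c) = Finsupp.linearCombination k (β n) c := by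
    intro n c
    conv_rhs => rw [Finsupp.linearCombination_apply]
    simp only [top, Finsupp.sum]
    rw [map_sum]
    refine Finset.sum_congr rfl fun j _ => ?_
    simp [π]
  have hlift : ∀ n z, z ∈ G n → ∃ f ∈ H n, π f = z := by
    intro n
    induction n with
    | zero =>
      intro z hz
      refine ⟨0, zero_mem _, ?_⟩
      rw [hG.zero, Submodule.mem_bot] at hz
      rw [map_zero, hz]
    | succ n ih =>
      intro z hz
      obtain ⟨c, g, hg, h, hh, hc⟩ := hspan n z hz
      obtain ⟨g', hg', rfl⟩ := ih g hg
      choose h' hh' hπh using fun i => ih (h i) (hh i)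
      refine ⟨top n c + g' + ∑ i, x i • h' i, ?_, ?_⟩
      · refine add_mem (add_mem (htop n c) (hH.mono n.le_succ hg')) ?_
        exact Submodule.sum_mem _ fun i _ => hH.smul_mem (hx.mem i) (hh' i)
      · rw [map_add, map_add, hπtop, map_sum]
        simp only [map_smul, hπh]
        rw [add_assoc, ← hc]
        abel
  -- The leading term of the coordinate at a generator of degree `l` has degree `n - l`: it is zero
  -- for `l > n`, a scalar for `l = n` and a combination of the `x s` for `l < n`.
  have hdecomp : ∀ n f, f ∈ H (n + 1) → ∃ (c : J n →₀ k) (g : ι → ((Σ n, J n) →₀ E)),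
      (∀ s, g s ∈ H n) ∧ f - top n c - ∑ s, x s • g s ∈ H n := by
    intro n f hf
    have hone : ∀ i, ∃ (c : J n →₀ k) (g : ι → ((Σ n, J n) →₀ E)),
        (∀ s, g s ∈ H n) ∧ Finsupp.single i (f i) - top n c - ∑ s, x s • g s ∈ H n := by
      rintro ⟨l, j⟩
      have hfi := hf ⟨l, j⟩
      simp only [w] at hfi
      set a := f ⟨l, j⟩
      have hrest : Finsupp.single (⟨l, j⟩ : Σ n, J n) (a - zcomp 𝒟 ((n : ℤ) - l) a) ∈ H n := by
        refine single_mem_freeFiltration fun m hm => ?_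
        simp only [w] at hm
        rw [map_sub]
        by_cases hmn : m = (n : ℤ) - l
        · subst hmn
          rw [zcomp_of_mem_same (zcomp_mem 𝒟 _ _), sub_self]
        · rw [zcomp_of_mem_ne (zcomp_mem 𝒟 _ _) (Ne.symm hmn), sub_zero]
          exact hfi m (by push_cast; omega)
      rcases lt_trichotomy n l with hnl | rfl | hnl
      · refine ⟨0, 0, fun _ => zero_mem _, ?_⟩
        rw [zcomp_of_neg 𝒟 (by omega), sub_zero] at hrest
        simpa [top] using hrest
      · obtain ⟨c, hc⟩ := hx.exists_scalar a
        refine ⟨Finsupp.single j c, 0, fun _ => zero_mem _, ?_⟩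
        rw [sub_self, hc, Finsupp.single_sub] at hrest
        simpa [top] using hrest
      · obtain ⟨b, hb⟩ := hx.exists_sum_right (a := zcomp 𝒟 ((n : ℤ) - l) a)
          (zcomp_of_mem_ne (zcomp_mem 𝒟 _ _) (by omega))
        have hb2 : zcomp 𝒟 ((n : ℤ) - l) a = ∑ s, x s * zcomp 𝒟 ((n : ℤ) - l - 1) (b s) := by
          conv_lhs => rw [← zcomp_of_mem_same (zcomp_mem 𝒟 ((n : ℤ) - l) a), hb, map_sum]
          refine Finset.sum_congr rfl fun s _ => ?_
          have := zcomp_mul_of_left_mem (hx.mem s) ((n : ℤ) - l - 1) (b s)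
          rwa [Nat.cast_one, sub_add_cancel] at this
        refine ⟨0, fun s => Finsupp.single ⟨l, j⟩ (zcomp 𝒟 ((n : ℤ) - l - 1) (b s)), fun s => ?_, ?_⟩
        · refine single_mem_freeFiltration fun m hm => ?_
          simp only [w] at hm
          exact zcomp_of_mem_ne (zcomp_mem 𝒟 _ _) (by omega)
        · rw [hb2, Finsupp.single_sub, Finsupp.single_finsetSum] at hrest
          simpa [top] using hrest
    choose c g hg hcg using hone
    refine ⟨∑ i ∈ f.support, c i, fun s => ∑ i ∈ f.support, g i s, fun s =>
      Submodule.sum_mem _ fun i _ => hg i s, ?_⟩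
    have h1 := Submodule.sum_mem (H n) fun i (_ : i ∈ f.support) => hcg i
    have htopsum : ∀ S : Finset (Σ n, J n), top n (∑ i ∈ S, c i) = ∑ i ∈ S, top n (c i) := by
      intro S
      induction S using Finset.induction_on with
      | empty => simp [top]
      | insert i S hi ih =>
        rw [Finset.sum_insert hi, Finset.sum_insert hi, ← ih]
        simp only [top]
        refine Finsupp.sum_add_index' ?_ ?_ <;> simp
    rw [Finset.sum_sub_distrib, Finset.sum_sub_distrib] at h1
    have h2 : ∑ i ∈ f.support, Finsupp.single i (f i) = f := Finsupp.sum_single f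
    rw [h2, ← htopsum, Finset.sum_comm] at h1
    simpa only [Finset.smul_sum] using h1
  -- Strict injectivity: an element cannot drop in filtration under `π`. Injectivity follows because
  -- the filtration is exhaustive and starts with zero.
  have hinj : ∀ n f, f ∈ H (n + 1) → π f ∈ G n → f ∈ H n := by
    intro n
    induction n with
    | zero =>
      intro f hf hπf
      obtain ⟨c, g, hg, hcg⟩ := hdecomp 0 f hf
      have hg0 : ∀ s, g s = 0 := fun s => by simpa [hH.zero] using hg s
      have h1 : f - top 0 c ∈ H 0 := by simpa [hg0] using hcg
      have h2 := hmap _ _ h1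
      rw [map_sub, hπtop] at h2
      have h3 : Finsupp.linearCombination k (β 0) c ∈ decomposablePart x G 0 := by
        refine ⟨Finsupp.linearCombination k (β 0) c, ?_, 0, fun _ => zero_mem _, by simp⟩
        have := sub_mem hπf h2
        rwa [sub_sub_cancel] at this
      rw [hindep 0 c h3] at h1
      simpa [top] using h1
    | succ n ih =>
      intro f hf hπf
      obtain ⟨c, g, hg, hcg⟩ := hdecomp (n + 1) f hf
      have hπg : ∀ s, π (g s) ∈ G (n + 1) := fun s => hmap _ _ (hg s)
      have h2 := hmap _ _ hcg
      rw [map_sub, map_sub, hπtop, map_sum] at h2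
      simp only [map_smul] at h2
      have h3 : Finsupp.linearCombination k (β (n + 1)) c ∈ decomposablePart x G (n + 1) := by
        refine ⟨_, sub_mem hπf h2, fun s => - π (g s), fun s => neg_mem (hπg s), ?_⟩
        simp only [smul_neg, Finset.sum_neg_distrib]
        abel
      have hc := hindep _ c h3
      subst hc
      have ht0 : top (n + 1) 0 = 0 := by simp [top]
      rw [ht0, sub_zero] at hcg
      rw [map_zero, sub_zero] at h2
      have h4 : ∑ s, x s • π (g s) ∈ G (n + 1) := by
        have := sub_mem hπf h2
        rwa [sub_sub_cancel] at this
      -- Independence of the new generators has removed the scalar part, leaving a relation among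
      -- the symbols of the `π (g s)`. By `hex` it comes from `R`. Replacing `g` by `g - R v'`
      -- leaves `∑ x s • g s` unchanged as `X R = 0`, and by induction the new coefficients lie one
      -- step lower.
      obtain ⟨v, hv, hgv⟩ := hex n (fun s => π (g s)) hπg (fun i => by rw [hactX]; exact h4)
      choose v' hv' hπv using fun i => hlift n (v i) (hv i)
      have h5 : ∀ s, g s - act R v' s ∈ H n := by
        intro s
        refine ih _ (sub_mem (hg s) (hH.act_mem hR hv' s)) ?_
        rw [map_sub, map_act]
        simp only [hπv]
        exact hgv s
      have h6 : ∑ s, x s • g s ∈ H (n + 1) := by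
        have h7 : ∑ s, x s • g s = ∑ s, x s • (g s - act R v' s) := by
          rw [← hactX g 0, ← hactX (fun s => g s - act R v' s) 0]
          have h8 := act_sub X g (act R v')
          rw [act_mul, hXR, act_zero_matrix, sub_zero] at h8
          exact (congrFun h8 0).symm
        rw [h7]
        exact Submodule.sum_mem _ fun s _ => hH.smul_mem (hx.mem s) (h5 s)
      have := add_mem hcg h6
      rwa [sub_add_cancel] at this
  have hbij : Function.Bijective π := by
    constructor
    · rw [← LinearMap.ker_eq_bot, LinearMap.ker_eq_bot']
      intro f hf
      have : ∀ n, f ∈ H n → f = 0 := by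
        intro n
        induction n with
        | zero => intro h; simpa [hH.zero] using h
        | succ n ih => intro h; exact ih (hinj n f h (by rw [hf]; exact zero_mem _))
      obtain ⟨n, hn⟩ := hH.exhaustive f
      exact this n hn
    · intro z
      obtain ⟨n, hn⟩ := hG.exhaustive z
      obtain ⟨f, -, hf⟩ := hlift n z hn
      exact ⟨f, hf⟩
  exact Module.Free.of_equiv (LinearEquiv.ofBijective π hbij)

end Criterion

end Filtered

end TypeA

namespace TypeA

/-! ### Bounds for the global dimension from a linear resolution -/

section GlobalDimension

variable {k : Type u} [Field k] {E : Type u} [Ring E] [Algebra k E] {𝒟 : ℕ → Submodule k E}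
  [GradedAlgebra 𝒟]

/-- The filtered free cover on all elements of the pieces of `G`, with the induced filtration on its
kernel; the last clause is the dimension shift of `Tor`. -/
theorem exists_filtered_syzygy {M : Type u} [AddCommGroup M] [Module E M] [Module k M]
    {G : ℕ → Submodule k M} (hG : IsFiltration 𝒟 G) :
    ∃ (I : Type u) (π : (I →₀ E) →ₗ[E] M) (G' : ℕ → Submodule k (LinearMap.ker π)),
      Function.Surjective π ∧ IsFiltration (M := LinearMap.ker π) 𝒟 G' ∧
      ∀ {ι κ σ τ : Type} [Fintype ι] [Fintype σ] [Fintype τ]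
        {A : Matrix κ ι E} {B : Matrix ι σ E} {C : Matrix σ τ E},
        (∀ i j, A i j ∈ 𝒟 1) → (∀ i j, B i j ∈ 𝒟 1) → (∀ i j, C i j ∈ 𝒟 1) → B * C = 0 →
        (∀ u, A.mulVec u = 0 → ∃ v, B.mulVec v = u) →
        IsExactAt G B C → IsExactAt (M := LinearMap.ker π) G' A B := by
  have hπ := isStrictCover_linearCombination (E := E) hG
  refine ⟨Σ n, G (n + 1), Finsupp.linearCombination E fun i : Σ n, G (n + 1) => (i.2 : M),
    kerFiltration (freeFiltration 𝒟 fun i : Σ n, G (n + 1) => i.1) _, fun z => ?_,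
    isFiltration_kerFiltration isFiltration_freeFiltration _, ?_⟩
  · obtain ⟨n, hn⟩ := hG.exhaustive z
    obtain ⟨y, -, hy⟩ := hπ.lift n z hn
    exact ⟨y, hy⟩
  · intro ι κ σ τ _ _ _ A B C hA hB hC hBC hAB hM
    exact isExactAt_kerFiltration isFiltration_freeFiltration hπ hB hC hBC
      (isExactAt_freeFiltration hA hB hAB) hM

/-- The filtration of a module concentrated in one degree. -/
def constFiltration (k : Type u) [Field k] (M : Type u) [AddCommGroup M] [Module k M] :
    ℕ → Submodule k M
  | 0 => ⊥
  | _ + 1 => ⊤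

omit [GradedAlgebra 𝒟] in
theorem isFiltration_constFiltration (M : Type u) [AddCommGroup M] [Module E M] [Module k M] :
    IsFiltration 𝒟 (constFiltration k M) where
  zero := rfl
  mono := by
    refine monotone_nat_of_le_succ fun n => ?_
    exact le_top
  exhaustive y := ⟨1, trivial⟩
  smul_mem := by
    intro d n a y _ hy
    rcases n with _ | n
    · rw [(Submodule.mem_bot k).1 hy, smul_zero]
      exact zero_mem _
    · rw [Nat.succ_add]; trivial

/-- A linear complex of free right modules of length four resolving the trivial module bounds the
projective dimension of all left modules. -/
theorem leftGlobalDimension_le_four {ι κ ι' : Type} [Fintype ι] [Fintype κ] [Fintype ι']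
    {x : ι → E} (hx : IsGeneratedBy 𝒟 x) {A₁ : Matrix (Fin 1) ι E} (hA₁x : A₁ = fun _ i => x i)
    {A₂ : Matrix ι κ E} {A₃ : Matrix κ ι' E} {A₄ : Matrix ι' (Fin 1) E}
    (hA₂ : ∀ i j, A₂ i j ∈ 𝒟 1) (hA₃ : ∀ i j, A₃ i j ∈ 𝒟 1) (hA₄ : ∀ i j, A₄ i j ∈ 𝒟 1)
    (h₁₂ : A₁ * A₂ = 0) (h₂₃ : A₂ * A₃ = 0) (h₃₄ : A₃ * A₄ = 0)
    (ex₁ : ∀ u, A₁.mulVec u = 0 → ∃ v, A₂.mulVec v = u)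
    (ex₂ : ∀ u, A₂.mulVec u = 0 → ∃ v, A₃.mulVec v = u)
    (ex₃ : ∀ u, A₃.mulVec u = 0 → ∃ v, A₄.mulVec v = u)
    (ex₄ : ∀ u, A₄.mulVec u = 0 → u = 0) :
    leftGlobalDimension E ≤ 4 := by
  refine iSup_le fun M => (projectiveDimension_le_iff M 4).2 ?_
  let _ : Module k M := Module.compHom M (algebraMap k E)
  have _ : IsScalarTower k E M := ⟨fun c a y => by
    rw [Algebra.smul_def, mul_smul]; rfl⟩
  have hA₁ : ∀ i j, A₁ i j ∈ 𝒟 1 := fun i j => by rw [hA₁x]; exact hx.mem j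
  -- The resolution is continued by zero modules, so that the vanishing of `Tor₅` is the starting
  -- point of the shifts.
  let Z₁ : Matrix (Fin 1) (Fin 0) E := 0
  let Z₀ : Matrix (Fin 0) (Fin 0) E := 0
  have hZ₁ : ∀ i j, Z₁ i j ∈ 𝒟 1 := fun _ j => j.elim0
  have hZ₀ : ∀ i j, Z₀ i j ∈ 𝒟 1 := fun _ j => j.elim0
  obtain ⟨I₁, π₁, G₁, hs₁, hG₁, e₁⟩ :=
    exists_filtered_syzygy (isFiltration_constFiltration (𝒟 := 𝒟) (M : Type u))
  obtain ⟨I₂, π₂, G₂, hs₂, hG₂, e₂⟩ := exists_filtered_syzygy hG₁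
  obtain ⟨I₃, π₃, G₃, hs₃, hG₃, e₃⟩ := exists_filtered_syzygy hG₂
  obtain ⟨I₄, π₄, G₄, hs₄, hG₄, e₄⟩ := exists_filtered_syzygy hG₃
  have ex₅ : IsExactAt (constFiltration k M) Z₁ Z₀ :=
    fun n u _ _ => ⟨0, fun i => i.elim0, fun i => i.elim0⟩
  -- Each shift moves exactness one place to the left in the resolution; at the fourth syzygy it is
  -- exactness at `A₁, A₂`, that is, `Tor₁ = 0`.
  have f₁ := e₁ hA₄ hZ₁ hZ₀ (by ext i j; exact j.elim0)
    (fun u hu => ⟨0, by rw [ex₄ u hu, Matrix.mulVec_zero]⟩) ex₅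
  have f₂ := e₂ hA₃ hA₄ hZ₁ (by ext i j; exact j.elim0) ex₃ f₁
  have f₃ := e₃ hA₂ hA₃ hA₄ h₃₄ ex₂ f₂
  have f₄ := e₄ hA₁ hA₂ hA₃ h₂₃ ex₁ f₃
  have hfree : Module.Free E (LinearMap.ker π₄) := free_of_isExactAt hx hG₄ hA₁x hA₂ h₁₂ f₄
  have g₄ : HasProjectiveDimensionLT (ModuleCat.of E (LinearMap.ker π₄)) 1 :=
    projective_iff_hasProjectiveDimensionLT_one.1 (projective_of_module_projective _)
  have g₃ := hasProjectiveDimensionLT_of_ker hs₄ g₄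
  have g₂ := hasProjectiveDimensionLT_of_ker hs₃ g₃
  have g₁ := hasProjectiveDimensionLT_of_ker hs₂ g₂
  exact hasProjectiveDimensionLT_of_ker hs₁ g₁

/-- A linear resolution of length four of the trivial left module shows that the left global
dimension is at least four. -/
theorem four_le_leftGlobalDimension [Nontrivial E] {ι κ ι' : Type} [Fintype ι] [Fintype κ]
    [Fintype ι'] {x : ι → E} (hx : IsGeneratedBy 𝒟 x) {T : Matrix κ ι E}
    (hT : IsSyzygyMatrix x T) {L : Matrix ι' κ E} (hL : ∀ b, T.vecMul b = 0 ↔ ∃ a, L.vecMul a = b)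
    {y : ι' → E} (hy : ∀ i, y i ∈ 𝒟 1)
    (hLy : ∀ a, L.vecMul a = 0 ↔ ∃ c : E, (fun i => c * y i) = a)
    (hinj : ∀ c : E, (∀ i, c * y i = 0) → c = 0) :
    4 ≤ leftGlobalDimension E := by
  refine le_trans ((projectiveDimension_ge_iff (trivialModule 𝒟) 4).2 fun hpd => ?_)
    (le_iSup (fun M : ModuleCat.{u} E => projectiveDimension M) (trivialModule 𝒟))
  have hproj := projective_ker_syzMap hx hT hpd
  let π : (ι' → E) →ₗ[E] LinearMap.ker (syzMap hx hT) :=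
    (rowHom L).codRestrict _ fun a => (mem_ker_syzMap hx hT).2 ((hL _).2 ⟨a, rfl⟩)
  have hπ : Function.Surjective π := by
    rintro ⟨b, hb⟩
    obtain ⟨a, rfl⟩ := (hL b).1 ((mem_ker_syzMap hx hT).1 hb)
    exact ⟨a, rfl⟩
  -- If the second syzygy were projective, the inclusion of `E y` in the free module would split,
  -- and `r y = 1` would write `1` as a combination of the degree-one entries of `y`.
  obtain ⟨s, hs⟩ := Module.projective_lifting_property π LinearMap.id hπ
  have hker : ∀ a, π a = 0 ↔ ∃ c : E, (fun i => c * y i) = a := by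
    intro a
    rw [← hLy, ← Subtype.coe_inj]
    rfl
  let p : E →ₗ[E] (ι' → E) := LinearMap.toSpanSingleton E _ y
  have hp : Function.Injective p := by
    rw [← LinearMap.ker_eq_bot, LinearMap.ker_eq_bot']
    intro c hc
    exact hinj c (congrFun hc)
  let ρ : (ι' → E) →ₗ[E] (ι' → E) := LinearMap.id - s ∘ₗ π
  have hρ : ∀ z, ρ z ∈ LinearMap.range p := by
    intro z
    have : π (ρ z) = 0 := by
      have := LinearMap.congr_fun hs (π z)
      simp only [LinearMap.comp_apply, LinearMap.id_apply] at this
      simp [ρ, this]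
    obtain ⟨c, hc⟩ := (hker _).1 this
    exact ⟨c, hc⟩
  let r : (ι' → E) →ₗ[E] E :=
    (LinearEquiv.ofInjective p hp).symm.toLinearMap ∘ₗ ρ.codRestrict _ hρ
  have hr : ∀ z, p (r z) = ρ z := by
    intro z
    have := LinearEquiv.apply_symm_apply (LinearEquiv.ofInjective p hp) ((ρ.codRestrict _ hρ) z)
    exact congrArg Subtype.val this
  have hry : r y = 1 := by
    apply hp
    rw [hr]
    have : π y = 0 := (hker y).2 ⟨1, by simp⟩
    simp [ρ, this, p]
  obtain ⟨b, hb, -⟩ := linearMap_pi_eq_sum r y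
  have h1 : zcomp 𝒟 0 (1 : E) = 0 := by
    rw [← hry, hb, map_sum]
    refine Finset.sum_eq_zero fun i _ => hx.zcomp_zero_mul ?_ _
    exact zcomp_of_mem_ne (m := 1) (hy i) (by omega)
  rw [zcomp_of_mem_same (m := 0) (SetLike.GradedOne.one_mem (A := 𝒟))] at h1
  exact one_ne_zero h1

end GlobalDimension

/-! ### The opposite of a graded algebra -/

section Opposite

variable {k : Type u} [Field k] {E : Type u} [Ring E] [Algebra k E] {𝒟 : ℕ → Submodule k E}

theorem isInternal_of_projections (p : ℕ → E →ₗ[k] E) (hsame : ∀ n, ∀ a ∈ 𝒟 n, p n a = a)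
    (hne : ∀ m n, m ≠ n → ∀ a ∈ 𝒟 m, p n a = 0) (htop : ⨆ n, 𝒟 n = ⊤) :
    DirectSum.IsInternal 𝒟 := by
  rw [DirectSum.isInternal_submodule_iff_iSupIndep_and_iSup_eq_top]
  refine ⟨fun i => ?_, htop⟩
  rw [Submodule.disjoint_def]
  intro a ha ha'
  have hle : ⨆ j, ⨆ (_ : j ≠ i), 𝒟 j ≤ LinearMap.ker (p i) :=
    iSup_le fun j => iSup_le fun hj => fun b hb => hne j i hj b hb
  rw [← hsame i a ha]
  exact hle ha'

theorem mem_opGrading {n : ℕ} {a : Eᵐᵒᵖ} : a ∈ opGrading 𝒟 n ↔ a.unop ∈ 𝒟 n := by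
  constructor
  · rintro ⟨b, hb, rfl⟩
    exact hb
  · intro h
    exact ⟨a.unop, h, rfl⟩

variable [GradedAlgebra 𝒟]

theorem iSup_grading_eq_top : ⨆ n, 𝒟 n = ⊤ := by
  rw [eq_top_iff]
  intro a _
  obtain ⟨N, hN⟩ := exists_sum_zcomp_eq (𝒟 := 𝒟) a
  rw [← hN N le_rfl]
  exact Submodule.sum_mem _ fun n _ => Submodule.mem_iSup_of_mem n (zcomp_mem 𝒟 n a)

/-- The opposite of a graded algebra is graded. -/
@[reducible] noncomputable def opGradedAlgebra : GradedAlgebra (opGrading 𝒟) where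
  one_mem := mem_opGrading.2 (SetLike.GradedOne.one_mem (A := 𝒟))
  mul_mem := by
    intro i j a b ha hb
    rw [mem_opGrading] at ha hb ⊢
    rw [add_comm]
    exact SetLike.GradedMul.mul_mem (A := 𝒟) hb ha
  toDecomposition := by
    let e := MulOpposite.opLinearEquiv k (M := E)
    refine DirectSum.IsInternal.chooseDecomposition _ (isInternal_of_projections
      (fun n => e.toLinearMap ∘ₗ zcomp 𝒟 n ∘ₗ e.symm.toLinearMap) ?_ ?_ ?_)
    · rintro n _ ⟨a, ha, rfl⟩
      exact congrArg MulOpposite.op (zcomp_of_mem_same (m := n) ha)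
    · rintro m n hmn _ ⟨a, ha, rfl⟩
      exact congrArg MulOpposite.op (zcomp_of_mem_ne (m := m) (m' := n) ha (by exact_mod_cast hmn))
    · have : ∀ n, opGrading 𝒟 n = (𝒟 n).map e.toLinearMap := fun n => rfl
      simp_rw [this]
      rw [← Submodule.map_iSup, iSup_grading_eq_top, Submodule.map_top, LinearEquiv.range]

variable {ι : Type} [Fintype ι] {x : ι → E}

omit [GradedAlgebra 𝒟] in
theorem IsGeneratedBy.op (hx : IsGeneratedBy 𝒟 x) :
    IsGeneratedBy (opGrading 𝒟) (fun i => MulOpposite.op (x i)) := by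
  refine ⟨fun i => mem_opGrading.2 (hx.mem i), fun a => ?_, fun a => ?_⟩
  · obtain ⟨c, b, h⟩ := hx.exists_right a.unop
    refine ⟨c, fun i => MulOpposite.op (b i), MulOpposite.unop_injective ?_⟩
    rw [h]
    simp
  · obtain ⟨c, b, h⟩ := hx.exists_left a.unop
    refine ⟨c, fun i => MulOpposite.op (b i), MulOpposite.unop_injective ?_⟩
    rw [h]
    simp

end Opposite

end TypeA

namespace TypeA

/-! ### Presented algebras, their gradings and syzygy matrices -/

section Presentation

variable {k : Type u} [Field k] {X I : Type}

/-- The algebra map out of a presented algebra determined by the images of the generators. -/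
noncomputable def presentedLift {r : I → FreeAlgebra k X} {F : Type*} [Ring F] [Algebra k F]
    (y : X → F) (h : ∀ j, FreeAlgebra.lift k y (r j) = 0) : Presented r →ₐ[k] F :=
  RingQuot.liftAlgHom k ⟨FreeAlgebra.lift k y, by
    rintro _ _ ⟨i, rfl, rfl⟩
    rw [h, map_zero]⟩

theorem presentedLift_gen {r : I → FreeAlgebra k X} {F : Type*} [Ring F] [Algebra k F]
    (y : X → F) (h : ∀ j, FreeAlgebra.lift k y (r j) = 0) (j : X) :
    presentedLift y h (gen r j) = y j := by
  rw [presentedLift, gen, RingQuot.liftAlgHom_mkAlgHom_apply, FreeAlgebra.lift_ι_apply]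

theorem algHom_lift {E F : Type*} [Ring E] [Algebra k E] [Ring F] [Algebra k F] (f : E →ₐ[k] F)
    (x : X → E) (a : FreeAlgebra k X) :
    f (FreeAlgebra.lift k x a) = FreeAlgebra.lift k (fun j => f (x j)) a := by
  have : f.comp (FreeAlgebra.lift k x) = FreeAlgebra.lift k (fun j => f (x j)) := by
    ext j; simp
  exact DFunLike.congr_fun this a

theorem lift_presentedLift {r : I → FreeAlgebra k X} {F : Type*} [Ring F] [Algebra k F]
    (y : X → F) (h : ∀ j, FreeAlgebra.lift k y (r j) = 0) (a : FreeAlgebra k X) :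
    presentedLift y h (FreeAlgebra.lift k (gen r) a) = FreeAlgebra.lift k y a := by
  rw [algHom_lift]
  simp_rw [presentedLift_gen]

theorem presented_hom_ext {r : I → FreeAlgebra k X} {F : Type*} [Ring F] [Algebra k F]
    {f g : Presented r →ₐ[k] F} (h : ∀ j, f (gen r j) = g (gen r j)) : f = g := by
  refine AlgHom.ext fun a => ?_
  obtain ⟨a, rfl⟩ := lift_gen_surjective a
  rw [algHom_lift, algHom_lift]
  simp_rw [h]

theorem word_monomial {E X : Type*} [Ring E] (x : X → E) (w : List X) :
    word (fun j => (Polynomial.monomial 1 (x j) : Polynomial E)) w =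
      Polynomial.monomial w.length (word x w) := by
  induction w with
  | nil => simp [word_nil]
  | cons i w ih => rw [word_cons, ih, Polynomial.monomial_mul_monomial, ← word_cons,
      List.length_cons, add_comm]

variable {E : Type u} [Ring E] [Algebra k E]

/-- The algebra `E` is generated by the `x j`, with the two-sided ideal of relations generated by
the `r i`. -/
structure IsPresentation (x : X → E) (r : I → FreeAlgebra k X) : Prop where
  surjective : Function.Surjective (FreeAlgebra.lift k x)
  mem_idealSpan : ∀ a, FreeAlgebra.lift k x a = 0 → a ∈ idealSpan r
  relation : ∀ j, FreeAlgebra.lift k x (r j) = 0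

theorem isPresentation_gen (r : I → FreeAlgebra k X) : IsPresentation (gen r) r :=
  ⟨lift_gen_surjective, fun _ => mem_idealSpan_of_lift_gen_eq_zero, lift_gen_relation⟩

namespace IsPresentation

variable {x : X → E} {r : I → FreeAlgebra k X} (hp : IsPresentation x r)
include hp

/-- The hypotheses identify `E` with `Presented r`, whose universal property is transported. -/
theorem exists_lift {F : Type*} [Ring F] [Algebra k F] (y : X → F)
    (h : ∀ j, FreeAlgebra.lift k y (r j) = 0) : ∃ f : E →ₐ[k] F, ∀ j, f (x j) = y j := by
  have hb : Function.Bijective (presentedLift x hp.relation) := by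
    constructor
    · rw [injective_iff_map_eq_zero]
      intro a ha
      obtain ⟨a, rfl⟩ := lift_gen_surjective a
      rw [lift_presentedLift] at ha
      have : FreeAlgebra.lift k (gen r) a ∈ (⊥ : Submodule k (Presented r)) := by
        have hle : (idealSpan r).map (FreeAlgebra.lift k (gen r)).toLinearMap ≤ ⊥ := by
          rw [idealSpan, Submodule.map_span_le]
          rintro _ ⟨p, j, q, rfl⟩
          simp [lift_gen_relation]
        exact hle ⟨a, hp.mem_idealSpan a ha, rfl⟩
      simpa using this
    · intro a
      obtain ⟨a, rfl⟩ := hp.surjective a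
      exact ⟨_, lift_presentedLift _ _ a⟩
  let e := AlgEquiv.ofBijective _ hb
  refine ⟨(presentedLift y h).comp e.symm.toAlgHom, fun j => ?_⟩
  have : e.symm (x j) = gen r j := by
    rw [AlgEquiv.symm_apply_eq]
    exact (presentedLift_gen _ _ j).symm
  change presentedLift y h (e.symm (x j)) = y j
  rw [this, presentedLift_gen]

theorem span_word : Submodule.span k (Set.range (word x)) = ⊤ := by
  have h := congrArg (Submodule.map (FreeAlgebra.lift k x).toLinearMap)
    (span_word_eq_top (k := k) (X := X))
  rw [Submodule.map_span, Submodule.map_top, LinearMap.range_eq_top.2 hp.surjective,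
    ← Set.range_comp] at h
  rw [← h]
  congr 2
  funext w
  have := map_word (FreeAlgebra.lift k x) (FreeAlgebra.ι k) w
  simp only [FreeAlgebra.lift_ι_apply] at this
  exact this.symm

/-- An algebra presented by homogeneous relations is graded. -/
@[reducible] noncomputable def gradedAlgebra
    (hr : ∀ j, ∃ N, r j ∈ degreePart k (FreeAlgebra.ι k) N) :
    GradedAlgebra (degreePart k x) where
  one_mem := Submodule.subset_span ⟨[], rfl, rfl⟩
  mul_mem := by
    intro i j a b ha hb
    exact mul_mem_degreePart ha hb
  toDecomposition := by
    -- Homogeneity of the relations makes `xⱼ ↦ xⱼ t` a well-defined map `E → E[t]`; its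
    -- coefficients are the homogeneous components.
    have hex : ∃ f : E →ₐ[k] Polynomial E, ∀ j, f (x j) = Polynomial.monomial 1 (x j) := by
      refine hp.exists_lift _ fun j => ?_
      obtain ⟨N, hN⟩ := hr j
      have key : ∀ a ∈ degreePart k (FreeAlgebra.ι k (X := X)) N,
          FreeAlgebra.lift k (fun j => (Polynomial.monomial 1 (x j) : Polynomial E)) a =
            Polynomial.monomial N (FreeAlgebra.lift k x a) := by
        intro a ha
        induction ha using Submodule.span_induction with
        | mem y hy =>
          obtain ⟨w, rfl, rfl⟩ := hy
          rw [map_word, map_word]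
          simp only [FreeAlgebra.lift_ι_apply]
          exact word_monomial x w
        | zero => simp
        | add a b _ _ ha hb => simp [ha, hb]
        | smul c a _ ha => rw [map_smul, map_smul, ha, Polynomial.smul_monomial]
      rw [key _ hN, hp.relation, Polynomial.monomial_zero_right]
    let f := hex.choose
    have hf : ∀ n, ∀ a ∈ degreePart k x n, f a = Polynomial.monomial n a := by
      intro n a ha
      induction ha using Submodule.span_induction with
      | mem y hy =>
        obtain ⟨w, rfl, rfl⟩ := hy
        rw [map_word]
        simp only [f, hex.choose_spec]
        exact word_monomial x w
      | zero => simp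
      | add a b _ _ ha hb => simp [ha, hb]
      | smul c a _ ha => rw [map_smul, ha, Polynomial.smul_monomial]
    refine DirectSum.IsInternal.chooseDecomposition _ (isInternal_of_projections
      (fun n => ((Polynomial.lcoeff E n).restrictScalars k) ∘ₗ f.toLinearMap) ?_ ?_ ?_)
    · intro n a ha
      simp [hf n a ha]
    · intro m n hmn a ha
      simp [hf m a ha, Polynomial.coeff_monomial, hmn]
    · rw [eq_top_iff, ← hp.span_word, Submodule.span_le]
      rintro _ ⟨w, rfl⟩
      exact Submodule.mem_iSup_of_mem w.length (Submodule.subset_span ⟨w, rfl, rfl⟩)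

omit hp in
theorem finite_degreePart [Fintype X] (n : ℕ) : Module.Finite k (degreePart k x n) := by
  have : {y | ∃ w : List X, w.length = n ∧ word x w = y} = word x '' {w | w.length = n} := rfl
  rw [degreePart, this]
  exact Module.Finite.span_of_finite k ((List.finite_length_eq X n).image _)

variable [Fintype X] [Fintype I]

omit [Fintype I] in
theorem isGeneratedBy : IsGeneratedBy (degreePart k x) x where
  mem i := Submodule.subset_span ⟨[i], rfl, by simp [word]⟩
  exists_left a := by
    obtain ⟨a, rfl⟩ := hp.surjective a
    obtain ⟨c, q, rfl⟩ := exists_eq_algebraMap_add_sum_mul_ι a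
    exact ⟨c, fun i => FreeAlgebra.lift k x (q i), by simp⟩
  exists_right a := by
    obtain ⟨a, rfl⟩ := hp.surjective a
    obtain ⟨c, q, rfl⟩ := exists_eq_algebraMap_add_sum_ι_mul a
    exact ⟨c, fun i => FreeAlgebra.lift k x (q i), by simp⟩

omit [Fintype I] in
theorem map_mulVec_gen {T : Matrix I X (FreeAlgebra k X)}
    (hT : Matrix.mulVec T (FreeAlgebra.ι k) = r) :
    (T.map (FreeAlgebra.lift k x)).mulVec x = 0 := by
  funext j
  have := congrArg (FreeAlgebra.lift k x) (congrFun hT j)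
  rw [hp.relation] at this
  simpa [Matrix.mulVec, dotProduct] using this

omit [Fintype I] in
theorem vecMul_gen_map {R : Matrix X I (FreeAlgebra k X)}
    (hR : Matrix.vecMul (FreeAlgebra.ι k) R = r) :
    Matrix.vecMul x (R.map (FreeAlgebra.lift k x)) = 0 := by
  funext j
  have := congrArg (FreeAlgebra.lift k x) (congrFun hR j)
  rw [hp.relation] at this
  simpa [Matrix.vecMul, dotProduct] using this

theorem isSyzygyMatrix {T : Matrix I X (FreeAlgebra k X)}
    (hT : Matrix.mulVec T (FreeAlgebra.ι k) = r) :
    IsSyzygyMatrix x (T.map (FreeAlgebra.lift k x)) := by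
  intro a
  constructor
  · intro ha
    obtain ⟨b, hb⟩ := exists_vecMul_of_sum_mul_gen_eq_zero hp.surjective hp.mem_idealSpan
      hp.relation hT ha
    exact ⟨b, hb.symm⟩
  · rintro ⟨b, rfl⟩
    change dotProduct (Matrix.vecMul b _) x = 0
    rw [← Matrix.dotProduct_mulVec, hp.map_mulVec_gen hT, dotProduct_zero]

theorem sum_gen_mul_eq_zero_iff {R : Matrix X I (FreeAlgebra k X)}
    (hR : Matrix.vecMul (FreeAlgebra.ι k) R = r) (a : X → E) :
    ∑ i, x i * a i = 0 ↔ ∃ b, (R.map (FreeAlgebra.lift k x)).mulVec b = a := by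
  constructor
  · intro ha
    obtain ⟨b, hb⟩ := exists_mulVec_of_sum_gen_mul_eq_zero hp.surjective hp.mem_idealSpan
      hp.relation hR ha
    exact ⟨b, hb.symm⟩
  · rintro ⟨b, rfl⟩
    change dotProduct x (Matrix.mulVec _ b) = 0
    rw [Matrix.dotProduct_mulVec, hp.vecMul_gen_map hR, zero_dotProduct]

theorem isSyzygyMatrix_op {R : Matrix X I (FreeAlgebra k X)}
    (hR : Matrix.vecMul (FreeAlgebra.ι k) R = r) :
    IsSyzygyMatrix (fun i => MulOpposite.op (x i))
      ((R.map (FreeAlgebra.lift k x)).transpose.map MulOpposite.op) := by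
  intro a
  have h := hp.sum_gen_mul_eq_zero_iff hR (fun i => (a i).unop)
  have h1 : ∑ i, a i * MulOpposite.op (x i) = 0 ↔ ∑ i, x i * (a i).unop = 0 := by
    rw [← MulOpposite.unop_inj]
    simp
  rw [h1, h]
  have key : ∀ b : I → E, (Matrix.vecMul (fun j => MulOpposite.op (b j))
      ((R.map (FreeAlgebra.lift k x)).transpose.map MulOpposite.op)) =
      fun i => MulOpposite.op ((R.map (FreeAlgebra.lift k x)).mulVec b i) := by
    intro b
    funext i
    simp [Matrix.vecMul, Matrix.mulVec, dotProduct]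
  constructor
  · rintro ⟨b, hb⟩
    exact ⟨fun j => MulOpposite.op (b j), by rw [key, hb]; rfl⟩
  · rintro ⟨b, hb⟩
    refine ⟨fun j => (b j).unop, funext fun i => ?_⟩
    have h2 := congrFun (key fun j => (b j).unop) i
    rw [← hb]
    exact (congrArg MulOpposite.unop h2).symm

omit hp [Fintype I] in
theorem exists_leftMatrix {N : ℕ} (hr : ∀ j, r j ∈ degreePart k (FreeAlgebra.ι k) (N + 1)) :
    ∃ T : Matrix I X (FreeAlgebra k X), (∀ i j, T i j ∈ degreePart k (FreeAlgebra.ι k) N) ∧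
      Matrix.mulVec T (FreeAlgebra.ι k) = r := by
  choose T hT h using fun j => exists_sum_mul_ι_of_mem_degreePart (hr j)
  exact ⟨T, hT, funext h⟩

omit hp [Fintype I] in
theorem exists_rightMatrix {N : ℕ} (hr : ∀ j, r j ∈ degreePart k (FreeAlgebra.ι k) (N + 1)) :
    ∃ R : Matrix X I (FreeAlgebra k X), (∀ i j, R i j ∈ degreePart k (FreeAlgebra.ι k) N) ∧
      Matrix.vecMul (FreeAlgebra.ι k) R = r := by
  choose R hR h using fun j => exists_sum_ι_mul_of_mem_degreePart (hr j)
  exact ⟨fun i j => R j i, fun i j => hR j i, funext h⟩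

/-- The relations are minimal syzygies when they are linearly independent. -/
theorem eq_zero_of_vecMul_algebraMap_eq_zero {N : ℕ}
    (hr : ∀ j, r j ∈ degreePart k (FreeAlgebra.ι k) (N + 1)) (hli : LinearIndependent k r)
    {T : Matrix I X (FreeAlgebra k X)} (hTd : ∀ i j, T i j ∈ degreePart k (FreeAlgebra.ι k) N)
    (hT : Matrix.mulVec T (FreeAlgebra.ι k) = r) (v : I → k)
    (hv : (T.map (FreeAlgebra.lift k x)).vecMul (fun i => algebraMap k E (v i)) = 0) : v = 0 := by
  -- These elements lie in the ideal but have degree `N`, below the degree `N + 1` of its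
  -- generators, so they vanish in the free algebra.
  have h1 : ∀ i, ∑ j, v j • T j i = 0 := by
    intro i
    refine eq_zero_of_mem_idealSpan_of_mem_degreePart hr (Nat.lt_succ_self N)
      (hp.mem_idealSpan _ ?_) (Submodule.sum_mem _ fun j _ => Submodule.smul_mem _ _ (hTd j i))
    have := congrFun hv i
    simp only [Matrix.vecMul, dotProduct, Matrix.map_apply, Pi.zero_apply] at this
    rw [map_sum, ← this]
    exact Finset.sum_congr rfl fun j _ => by rw [map_smul, Algebra.smul_def]
  have h2 : ∑ j, v j • r j = 0 := by
    have : ∀ j, v j • r j = ∑ i, (v j • T j i) * FreeAlgebra.ι k i := by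
      intro j
      rw [← congrFun hT j, Matrix.mulVec, dotProduct, Finset.smul_sum]
      exact Finset.sum_congr rfl fun i _ => by rw [smul_mul_assoc]
    simp_rw [this]
    rw [Finset.sum_comm]
    refine Finset.sum_eq_zero fun i _ => ?_
    rw [← Finset.sum_mul, h1, zero_mul]
  exact funext (Fintype.linearIndependent_iff.1 hli v h2)

end IsPresentation

/-- Relations with distinct leading monomials are linearly independent. -/
theorem linearIndependent_of_leading {n : ℕ} {I : Type} [Fintype I]
    {r : I → FreeAlgebra k (Fin n)} {lead : I → List (Fin n)} (hinj : Function.Injective lead)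
    (hr : ∀ j, word (FreeAlgebra.ι k) (lead j) - r j ∈ lowerForms k (lead j)) :
    LinearIndependent k r := by
  classical
  rw [Fintype.linearIndependent_iff]
  intro c hc
  by_contra hne
  push Not at hne
  obtain ⟨i₀, hi₀⟩ := hne
  -- The largest leading word with nonzero coefficient occurs in no other term of the relation.
  obtain ⟨i, hi, hmax⟩ := Finset.exists_max_image (Finset.univ.filter fun i => c i ≠ 0) lead
    ⟨i₀, by simpa using hi₀⟩
  have hcoef : ∀ j, (wordBasis k (Fin n)).repr (r j) (lead i) =
      (if lead j = lead i then 1 else 0) -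
        (wordBasis k (Fin n)).repr (word (FreeAlgebra.ι k) (lead j) - r j) (lead i) := by
    intro j
    rw [map_sub, Finsupp.sub_apply, repr_word, sub_sub_cancel]
  have h := congrArg (fun a => (wordBasis k (Fin n)).repr a (lead i)) hc
  simp only [map_sum, map_smul, Finsupp.coe_finsetSum, Finset.sum_apply, Finsupp.smul_apply,
    smul_eq_mul, map_zero, Finsupp.zero_apply] at h
  rw [Finset.sum_eq_single i] at h
  · rw [hcoef, if_pos rfl, repr_lowerForms_eq_zero (lt_irrefl _) (hr i), sub_zero, mul_one] at h
    exact (Finset.mem_filter.1 hi).2 h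
  · intro j _ hji
    by_cases hcj : c j = 0
    · rw [hcj, zero_mul]
    · have hle := hmax j (by simpa using hcj)
      rw [hcoef, if_neg fun h => hji (hinj h), repr_lowerForms_eq_zero (not_lt.2 hle) (hr j),
        sub_zero, mul_zero]
  · simp

end Presentation

/-! ### Hilbert functions and ranks in each degree -/

section Hilbert

variable {k : Type u} [Field k] {E : Type u} [Ring E] [Algebra k E] (𝒟 : ℕ → Submodule k E)

/-- The Hilbert function, extended by zero to negative degrees. -/
noncomputable def hilb (m : ℤ) : ℤ := Module.finrank k (zpart 𝒟 m)

theorem hilb_of_neg {m : ℤ} (hm : m < 0) : hilb 𝒟 m = 0 := by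
  rw [hilb, zpart_of_neg 𝒟 hm, finrank_bot]; rfl

variable {𝒟} (hfin : ∀ n, Module.Finite k (𝒟 n))

include hfin in
theorem finite_zpart (m : ℤ) : Module.Finite k (zpart 𝒟 m) := by
  cases m with
  | ofNat n => exact hfin n
  | negSucc n => exact inferInstanceAs (Module.Finite k (⊥ : Submodule k E))

/-- Vectors with homogeneous entries. -/
noncomputable def vpartEquiv (ι : Type) (m : ℤ) : vpart 𝒟 ι m ≃ₗ[k] (ι → zpart 𝒟 m) where
  toFun u i := ⟨u.1 i, mem_vpart.1 u.2 i⟩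
  map_add' _ _ := rfl
  map_smul' _ _ := rfl
  invFun v := ⟨fun i => v i, mem_vpart.2 fun i => (v i).2⟩
  left_inv _ := rfl
  right_inv _ := rfl

include hfin in
theorem finite_vpart (ι : Type) [Fintype ι] (m : ℤ) : Module.Finite k (vpart 𝒟 ι m) := by
  have := finite_zpart hfin m
  exact Module.Finite.equiv (vpartEquiv ι m).symm

include hfin in
theorem finrank_vpart (ι : Type) [Fintype ι] (m : ℤ) :
    (Module.finrank k (vpart 𝒟 ι m) : ℤ) = Fintype.card ι * hilb 𝒟 m := by
  have := finite_zpart hfin m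
  rw [(vpartEquiv ι m).finrank_eq, Module.finrank_pi_fintype, hilb]
  simp

/-- The rank of a linear map in a given degree. -/
noncomputable def degreeRank (𝒟 : ℕ → Submodule k E) {ι κ : Type} (f : (ι → E) →ₗ[k] (κ → E))
    (m : ℤ) : ℤ :=
  Module.finrank k ((vpart 𝒟 ι m).map f)

include hfin in
theorem degreeRank_add_finrank_ker {ι κ : Type} [Fintype ι] (f : (ι → E) →ₗ[k] (κ → E)) (m : ℤ) :
    degreeRank 𝒟 f m + Module.finrank k ↥(vpart 𝒟 ι m ⊓ LinearMap.ker f) =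
      Fintype.card ι * hilb 𝒟 m := by
  have := finite_vpart hfin ι m
  rw [← finrank_vpart hfin, degreeRank]
  have h := (f.domRestrict (vpart 𝒟 ι m)).finrank_range_add_finrank_ker
  rw [← h, LinearMap.range_domRestrict, LinearMap.ker_domRestrict]
  push_cast
  congr 2
  rw [← (Submodule.comapSubtypeEquivOfLe (p := vpart 𝒟 ι m ⊓ LinearMap.ker f)
    (q := vpart 𝒟 ι m) inf_le_left).finrank_eq, Submodule.comap_inf,
    Submodule.comap_subtype_self, top_inf_eq]

include hfin in
theorem degreeRank_of_injective {ι κ : Type} [Fintype ι] {f : (ι → E) →ₗ[k] (κ → E)}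
    (hf : ∀ u, f u = 0 → u = 0) (m : ℤ) : degreeRank 𝒟 f m = Fintype.card ι * hilb 𝒟 m := by
  rw [← degreeRank_add_finrank_ker hfin f, LinearMap.ker_eq_bot'.2 hf, inf_bot_eq, finrank_bot]
  simp

include hfin in
theorem eq_zero_of_degreeRank [GradedAlgebra 𝒟] {ι κ : Type} [Fintype ι]
    {f : (ι → E) →ₗ[k] (κ → E)} {d : ℕ} (hs : IsShift 𝒟 f d)
    (hf : ∀ m, degreeRank 𝒟 f m = Fintype.card ι * hilb 𝒟 m) (u : ι → E) (hu : f u = 0) :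
    u = 0 := by
  refine eq_zero_of_vcomp_eq_zero (𝒟 := 𝒟) fun m => ?_
  have := finite_vpart hfin ι m
  have h := degreeRank_add_finrank_ker hfin f m
  rw [hf, add_eq_left, Nat.cast_eq_zero] at h
  have hbot := Submodule.finrank_eq_zero.1 h
  rw [← Submodule.mem_bot k, ← hbot]
  exact ⟨vcomp_mem m u, LinearMap.mem_ker.2 (by rw [← hs, hu, map_zero])⟩

variable [GradedAlgebra 𝒟]

include hfin in
theorem IsShift.degreeRank_add {ι κ σ : Type} [Fintype ι] [Fintype κ] {f : (ι → E) →ₗ[k] (κ → E)}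
    {g : (κ → E) →ₗ[k] (σ → E)} {d : ℕ} (hf : IsShift 𝒟 f d)
    (h : ∀ u, g u = 0 ↔ ∃ v, f v = u) (m : ℤ) :
    degreeRank 𝒟 g m + degreeRank 𝒟 f (m - d) = Fintype.card κ * hilb 𝒟 m := by
  rw [← degreeRank_add_finrank_ker hfin g, hf.exact_degree h]
  rfl

include hfin in
/-- Exactness of a complex from the ranks in each degree. -/
theorem IsShift.exact_of_degreeRank {ι κ σ : Type} [Fintype ι] [Fintype κ]
    {f : (ι → E) →ₗ[k] (κ → E)} {g : (κ → E) →ₗ[k] (σ → E)} {d e : ℕ} (hf : IsShift 𝒟 f d)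
    (hg : IsShift 𝒟 g e) (hfg : ∀ v, g (f v) = 0)
    (h : ∀ m, degreeRank 𝒟 g m + degreeRank 𝒟 f (m - d) = Fintype.card κ * hilb 𝒟 m) (u : κ → E)
    (hu : g u = 0) : ∃ v, f v = u := by
  refine hg.exact_of_forall_degree (f := f) (fun m u hu hgu => ?_) u hu
  have := finite_vpart hfin κ m
  have hle : (vpart 𝒟 ι (m - d)).map f ≤ vpart 𝒟 κ m ⊓ LinearMap.ker g := by
    rintro _ ⟨v, hv, rfl⟩
    refine ⟨?_, hfg v⟩
    have := hf.mem hv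
    rwa [sub_add_cancel] at this
  have hfin' : Module.Finite k ↥(vpart 𝒟 κ m ⊓ LinearMap.ker g) :=
    Submodule.finiteDimensional_of_le inf_le_left
  have heq := Submodule.eq_of_le_of_finrank_eq hle (by
    have h1 := h m
    have h2 := degreeRank_add_finrank_ker hfin g m
    unfold degreeRank at h1 h2
    omega)
  obtain ⟨v, -, hv⟩ := heq.ge ⟨hu, hgu⟩
  exact ⟨v, hv⟩

variable {ι : Type} [Fintype ι] {x : ι → E}

omit hfin [GradedAlgebra 𝒟] in
theorem hilb_zero [GradedAlgebra 𝒟] (hx : IsGeneratedBy 𝒟 x) [Nontrivial E] : hilb 𝒟 0 = 1 := by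
  have : zpart 𝒟 0 = Submodule.span k {(1 : E)} := by
    refine le_antisymm (fun a ha => ?_) ?_
    · obtain ⟨c, rfl⟩ := hx.exists_scalar_of_mem ha
      rw [Algebra.algebraMap_eq_smul_one]
      exact Submodule.smul_mem _ _ (Submodule.mem_span_singleton_self 1)
    · rw [Submodule.span_singleton_le_iff_mem]
      exact SetLike.GradedOne.one_mem (A := 𝒟)
  rw [hilb, this, finrank_span_singleton one_ne_zero]
  rfl

omit [Fintype ι] in
theorem map_vpart_eq_of_range {κ : Type} [Unique κ]
    (f : (ι → E) →ₗ[k] (κ → E)) (hs : IsShift 𝒟 f 1)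
    (hf : ∀ a : E, zcomp 𝒟 0 a = 0 ↔ ∃ b, f b = fun _ => a) {m : ℤ} (hm : m ≠ 0) :
    (vpart 𝒟 ι (m - 1)).map f = vpart 𝒟 κ m := by
  refine le_antisymm ?_ fun u hu => ?_
  · rintro _ ⟨v, hv, rfl⟩
    have := hs.mem hv
    rwa [Nat.cast_one, sub_add_cancel] at this
  · have hu0 := mem_vpart.1 hu default
    have h0 : zcomp 𝒟 0 (u default) = 0 := zcomp_of_mem_ne hu0 hm
    obtain ⟨v, hv, h⟩ := hs.exists_homogeneous hu (by
      obtain ⟨b, hb⟩ := (hf _).1 h0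
      exact ⟨b, hb.trans (funext fun i => by rw [Unique.eq_default i])⟩)
    exact ⟨v, by simpa using hv, h⟩

-- The generators span everything except the constants, which form a line in degree zero; the
-- correction is the class of `k`.
include hfin in
theorem degreeRank_augmentation (hx : IsGeneratedBy 𝒟 x) [Nontrivial E] {κ : Type} [Unique κ]
    (f : (ι → E) →ₗ[k] (κ → E)) (hs : IsShift 𝒟 f 1)
    (hf : ∀ a : E, zcomp 𝒟 0 a = 0 ↔ ∃ b, f b = fun _ => a) (m : ℤ) :
    degreeRank 𝒟 f (m - 1) + (if m = 0 then 1 else 0) = hilb 𝒟 m := by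
  split_ifs with hm
  · subst hm
    have hbot : (vpart 𝒟 ι (0 - 1)).map f = ⊥ := by
      rw [eq_bot_iff]
      rintro _ ⟨v, hv, rfl⟩
      rw [eq_zero_of_mem_vpart_of_neg (by omega) hv, map_zero]
      exact zero_mem _
    rw [degreeRank, hbot, finrank_bot, hilb_zero hx]
    rfl
  · rw [degreeRank, map_vpart_eq_of_range f hs hf hm, finrank_vpart hfin]
    simp

end Hilbert

end TypeA

namespace TypeA

/-! ### The Hilbert series of a regular algebra of dimension three -/

section Regular

variable {k : Type u} [Field k] {E : Type u} [Ring E] [Algebra k E] {𝒟 : ℕ → Submodule k E} {d : ℕ}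

namespace IsASRegular

theorem nontrivial (h : IsASRegular 𝒟 d) : Nontrivial E := by
  by_contra hE
  rw [not_nontrivial_iff_subsingleton] at hE
  have := h.connected
  rw [Module.finrank_zero_of_subsingleton] at this
  exact zero_ne_one this

theorem hasProjectiveDimensionLT (h : IsASRegular 𝒟 3) :
    HasProjectiveDimensionLT (trivialModule 𝒟) 4 := by
  refine (projectiveDimension_le_iff (trivialModule 𝒟) 3).1 ?_
  have h1 : leftGlobalDimension E = ((3 : ℕ) : ℕ∞) := h.globalDimension.2
  have h2 := le_iSup (fun M : ModuleCat.{u} E => projectiveDimension M) (trivialModule 𝒟)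
  exact h2.trans h1.le

end IsASRegular

theorem rowMap_single {ι : Type} (t : ι → E) (b : Unit → E) :
    rowMap k (fun (_ : Unit) i => t i : Matrix Unit ι E) b = fun i => b () * t i := by
  funext i
  exact Fintype.sum_unique fun u : Unit => b u * t i

theorem rowMap_column {ι : Type} [Fintype ι] (x : ι → E) (b : ι → E) :
    rowMap k (fun i (_ : Unit) => x i : Matrix ι Unit E) b = fun _ => ∑ i, b i * x i := by
  rfl

namespace IsPresentation

variable {X I : Type} [Fintype X] [Fintype I] {x : X → E} {r : I → FreeAlgebra k X}
  (hp : IsPresentation x r) [GradedAlgebra (degreePart k x)]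
  (hreg : IsASRegular (degreePart k x) 3)
include hp hreg

omit [Fintype I] in
theorem eq_zero_of_gen_mul {a : E} (ha : ∀ i, x i * a = 0) : a = 0 :=
  eq_zero_of_gen_mul_eq_zero hp.isGeneratedBy (hreg.gorensteinLeft.1 0 (by omega)) ha

theorem exists_eq_gen_mul {T : Matrix I X (FreeAlgebra k X)}
    (hT : Matrix.mulVec T (FreeAlgebra.ι k) = r) {u : X → E}
    (hu : (T.map (FreeAlgebra.lift k x)).mulVec u = 0) : ∃ a : E, ∀ i, u i = x i * a :=
  exists_eq_gen_mul_of_mulVec_eq_zero hp.isGeneratedBy (hp.isSyzygyMatrix hT)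
    (hreg.gorensteinLeft.1 1 (by omega)) hu

/-- Over the opposite algebra `Ext¹(k, -) = 0` gives `v i = a x i` for some `a`, and the right side
has no constant term. -/
theorem eq_zero_of_vecMul_rightMatrix {R : Matrix X I (FreeAlgebra k X)}
    (hR : Matrix.vecMul (FreeAlgebra.ι k) R = r) {v : X → k}
    (hv : (R.map (FreeAlgebra.lift k x)).vecMul (fun i => algebraMap k E (v i)) = 0) : v = 0 := by
  have := hreg.nontrivial
  have : GradedAlgebra (opGrading (degreePart k x)) := opGradedAlgebra
  have h := exists_eq_gen_mul_of_mulVec_eq_zero hp.isGeneratedBy.op (hp.isSyzygyMatrix_op hR)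
    (hreg.gorensteinRight.1 1 (by omega)) (u := fun i => MulOpposite.op (algebraMap k E (v i))) (by
      funext j
      have := congrFun hv j
      simp only [Matrix.vecMul, dotProduct, Pi.zero_apply] at this
      refine MulOpposite.unop_injective ?_
      simpa [Matrix.mulVec, dotProduct] using this)
  obtain ⟨a, ha⟩ := h
  funext i
  have h1 : algebraMap k E (v i) = a.unop * x i := MulOpposite.op_injective (ha i)
  have h2 : zcomp (degreePart k x) 0 (algebraMap k E (v i)) = algebraMap k E (v i) :=
    zcomp_of_mem_same (m := 0) (algebraMap_mem_zero _)
  classical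
  have h3 := hp.isGeneratedBy.zcomp_zero_sum_left (Pi.single i a.unop)
  rw [Finset.sum_eq_single i (by simp +contextual) (by simp), Pi.single_eq_same, ← h1, h2] at h3
  exact (algebraMap k E).injective (h3.trans (map_zero _).symm)

/-- The recursion for the Hilbert function of a regular algebra of dimension three whose
relations have degree `N + 1`. -/
theorem hilb_recursion {N : ℕ} (hr : ∀ j, r j ∈ degreePart k (FreeAlgebra.ι k) (N + 1))
    (hli : LinearIndependent k r) (m : ℤ) :
    hilb (degreePart k x) m - (if m = 0 then 1 else 0) =
      Fintype.card X * hilb (degreePart k x) (m - 1) -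
        Fintype.card I * hilb (degreePart k x) (m - 1 - N) +
        hilb (degreePart k x) (m - 2 - N) := by
  have := hreg.nontrivial
  have hfin := fun n => finite_degreePart (k := k) (x := x) n
  have hx := hp.isGeneratedBy
  obtain ⟨T, hTd, hT⟩ := exists_leftMatrix hr
  have hS := hp.isSyzygyMatrix hT
  have hTd' : ∀ i j, T.map (FreeAlgebra.lift k x) i j ∈ degreePart k x N :=
    fun i j => lift_mem_degreePart (hTd i j)
  -- The maps given by `t`, `T` and `x` now resolve `k`; their generators sit in degrees `N + 2`, `N
  -- + 1`, `1` and `0`, and the recursion is the alternating sum of dimensions in degree `m`.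
  obtain ⟨t, ht, htT, hinj⟩ := exists_last_syzygy hx hS hTd'
    (hp.eq_zero_of_vecMul_algebraMap_eq_zero hr hli hTd hT) hreg.hasProjectiveDimensionLT
    hreg.gorensteinLeft
  have sx : IsShift (degreePart k x) (rowMap k (fun i (_ : Unit) => x i : Matrix X Unit E)) 1 :=
    isShift_rowMap fun i _ => hx.mem i
  have sT := isShift_rowMap hTd'
  have st : IsShift (degreePart k x) (rowMap k (fun (_ : Unit) i => t i : Matrix Unit I E)) 1 :=
    isShift_rowMap fun _ i => ht i
  have e1 := degreeRank_augmentation hfin hx _ sx (fun a => by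
    constructor
    · intro ha
      obtain ⟨b, hb⟩ := hx.exists_sum_left ha
      exact ⟨b, by rw [rowMap_column, ← hb]⟩
    · rintro ⟨b, hb⟩
      rw [rowMap_column] at hb
      rw [← congrFun hb (), hx.zcomp_zero_sum_left]) m
  have e2 := sT.degreeRank_add hfin
    (g := rowMap k (fun i (_ : Unit) => x i : Matrix X Unit E)) (fun u => by
      rw [rowMap_column, funext_iff]
      simp only [Pi.zero_apply, forall_const, rowMap_apply]
      exact hS u) (m - 1)
  have e3 := st.degreeRank_add hfin (g := rowMap k (T.map (FreeAlgebra.lift k x))) (fun u => by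
      simp_rw [rowMap_single]
      rw [rowMap_apply, htT]
      exact ⟨fun ⟨a, h⟩ => ⟨fun _ => a, h⟩, fun ⟨v, h⟩ => ⟨v (), h⟩⟩) (m - 1 - N)
  have e4 := degreeRank_of_injective hfin
    (f := rowMap k (fun (_ : Unit) i => t i : Matrix Unit I E)) (fun u hu => by
      rw [rowMap_single] at hu
      funext i
      exact hinj _ (congrFun hu)) (m - 1 - N - 1)
  simp only [Nat.cast_one, Fintype.card_unit, one_mul] at e1 e2 e3 e4
  rw [show m - 2 - (N : ℤ) = m - 1 - N - 1 by ring]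
  linarith

end IsPresentation

/-- Functions vanishing in negative degrees that satisfy the same recursion agree. -/
theorem eq_of_recursion {a b : ℤ → ℤ} (F : (ℤ → ℤ) → ℤ → ℤ)
    (hF : ∀ f g m, (∀ n < m, f n = g n) → F f m = F g m)
    (ha0 : ∀ m < 0, a m = 0) (hb0 : ∀ m < 0, b m = 0) (ha : ∀ m, a m = F a m)
    (hb : ∀ m, b m = F b m) : a = b := by
  have key : ∀ (N : ℕ) (m : ℤ), m < N → a m = b m := by
    intro N
    induction N with
    | zero => exact fun m hm => by rw [ha0 m (by simpa using hm), hb0 m (by simpa using hm)]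
    | succ N ih =>
      intro m hm
      rw [ha, hb]
      exact hF _ _ _ fun n hn => ih n (by push_cast at hm; omega)
  funext m
  exact key (m.toNat + 1) m (by omega)

/-- In generating functions, `(1 - t)³(1 + t) = 1 - 2t + 2t³ - t⁴`; so `(1 + t)` times the series of
`c` obeys the recursion of `a`. -/
theorem hilb_eq_add {a c : ℤ → ℤ} (ha0 : ∀ m < 0, a m = 0) (hc0 : ∀ m < 0, c m = 0)
    (ha : ∀ m, a m - (if m = 0 then 1 else 0) = 3 * a (m - 1) - 3 * a (m - 2) + a (m - 3))
    (hc : ∀ m, c m - (if m = 0 then 1 else 0) = 2 * c (m - 1) - 2 * c (m - 3) + c (m - 4)) (m : ℤ) :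
    a m = c m + c (m - 1) := by
  have := eq_of_recursion (a := a) (b := fun m => c m + c (m - 1))
    (fun f m => (if m = 0 then 1 else 0) + (3 * f (m - 1) - 3 * f (m - 2) + f (m - 3)))
    (fun f g m h => by
      simp only [h (m - 1) (by omega), h (m - 2) (by omega), h (m - 3) (by omega)])
    ha0 (fun m hm => by simp only [hc0 m hm, hc0 (m - 1) (by omega), add_zero])
    (fun m => by linarith [ha m])
    (fun m => by
      have h1 := hc m
      simp only [show m - 1 - 1 = m - 2 by ring, show m - 2 - 1 = m - 3 by ring,
        show m - 3 - 1 = m - 4 by ring]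
      linarith)
  exact congrFun this m

end Regular

end TypeA

namespace TypeA

/-! ### Algebras of the form `E = F ⊕ F y` -/

section Extension

variable {k : Type u} [Field k] {E F : Type u} [Ring E] [Algebra k E] [Ring F] [Algebra k F]

/-- The map `F ⊕ F → E`, `(c, c') ↦ c + c' y`. -/
noncomputable def extensionMap (i : F →ₐ[k] E) (y : E) : F × F →ₗ[k] E :=
  i.toLinearMap.coprod (LinearMap.mulRight k y ∘ₗ i.toLinearMap)

theorem extensionMap_apply (i : F →ₐ[k] E) (y : E) (p : F × F) :
    extensionMap i y p = i p.1 + i p.2 * y := rfl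

theorem mul_mem_range_extensionMap {i : F →ₐ[k] E} {y a : E} (c : F)
    (ha : a ∈ LinearMap.range (extensionMap i y)) :
    i c * a ∈ LinearMap.range (extensionMap i y) := by
  obtain ⟨p, rfl⟩ := ha
  exact ⟨(c * p.1, c * p.2), by simp [extensionMap_apply, mul_add, mul_assoc]⟩

section Generated

variable {x : Fin 3 → E} {z : Fin 2 → F} {i : F →ₐ[k] E} (hi : ∀ j, i (z j) = x j.castSucc)
include hi

theorem gen_mem_range_extensionMap (b : Fin 3) :
    x b ∈ LinearMap.range (extensionMap i (x 2)) := by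
  induction b using Fin.lastCases with
  | last => exact ⟨(0, 1), by simp [extensionMap_apply]⟩
  | cast b => exact ⟨(z b, 0), by simp [extensionMap_apply, hi]⟩

/-- Induction on `j`: a monomial below the leading one begins either with a letter coming from `F`,
or with the last letter followed by one smaller than `j`. -/
theorem last_mul_mem_range_extensionMap
    (h : ∀ j : Fin 3, ∃ f ∈ lowerForms k [2, j], x 2 * x j = FreeAlgebra.lift k x f) (j : Fin 3) :
    x 2 * x j ∈ LinearMap.range (extensionMap i (x 2)) := by
  induction j using WellFoundedLT.induction with
  | ind j ih =>
    obtain ⟨f, hf, hj⟩ := h j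
    rw [hj]
    clear hj
    induction hf using Submodule.span_induction with
    | mem y hy =>
      obtain ⟨w, hw, hlt, rfl⟩ := hy
      obtain ⟨a, b, rfl⟩ := List.length_eq_two.1 hw
      have : FreeAlgebra.lift k x (word (FreeAlgebra.ι k) [a, b]) = x a * x b := by
        simp [word]
      rw [this]
      induction a using Fin.lastCases with
      | cast a =>
        rw [← hi]
        exact mul_mem_range_extensionMap _ (gen_mem_range_extensionMap hi b)
      | last =>
        refine ih b ?_
        rcases List.cons_lt_cons_iff.1 hlt with h | ⟨-, h⟩
        · exact absurd h (lt_irrefl _)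
        · rcases List.cons_lt_cons_iff.1 h with h | ⟨-, h⟩
          · exact h
          · exact absurd h (lt_irrefl _)
    | zero => rw [map_zero]; exact zero_mem _
    | add a b _ _ ha hb => rw [map_add]; exact add_mem ha hb
    | smul c a _ ha => rw [map_smul]; exact Submodule.smul_mem _ _ ha

theorem extensionMap_surjective (hx : Function.Surjective (FreeAlgebra.lift k x))
    (h : ∀ j : Fin 3, ∃ f ∈ lowerForms k [2, j], x 2 * x j = FreeAlgebra.lift k x f) :
    Function.Surjective (extensionMap i (x 2)) := by
  rw [← LinearMap.range_eq_top, eq_top_iff]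
  have hmul : ∀ (j : Fin 3), ∀ a ∈ LinearMap.range (extensionMap i (x 2)),
      a * x j ∈ LinearMap.range (extensionMap i (x 2)) := by
    rintro j _ ⟨p, rfl⟩
    rw [extensionMap_apply, add_mul, mul_assoc]
    exact add_mem (mul_mem_range_extensionMap _ (gen_mem_range_extensionMap hi j))
      (mul_mem_range_extensionMap _ (last_mul_mem_range_extensionMap hi h j))
  rintro a -
  obtain ⟨a, rfl⟩ := hx a
  induction a using freeAlgebra_induction_word with
  | hw w =>
    induction w using List.reverseRecOn with
    | nil => exact ⟨(1, 0), by simp [extensionMap_apply, word_nil]⟩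
    | append_singleton w j ih =>
      rw [word_concat, map_mul, FreeAlgebra.lift_ι_apply]
      exact hmul _ _ ih
  | h0 => rw [map_zero]; exact zero_mem _
  | hadd a b ha hb => rw [map_add]; exact add_mem ha hb
  | hsmul c a ha => rw [map_smul]; exact Submodule.smul_mem _ _ ha

end Generated

theorem map_mem_degreePart {X Y : Type} {x : X → E} {z : Y → F} {i : F →ₐ[k] E} {σ : Y → X}
    (hi : ∀ j, i (z j) = x (σ j)) {n : ℕ} {a : F} (ha : a ∈ degreePart k z n) :
    i a ∈ degreePart k x n := by
  induction ha using Submodule.span_induction with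
  | mem y hy =>
    obtain ⟨w, rfl, rfl⟩ := hy
    refine Submodule.subset_span ⟨w.map σ, by simp, ?_⟩
    rw [map_word]
    simp only [hi, word, List.map_map]
    rfl
  | zero => rw [map_zero]; exact zero_mem _
  | add a b _ _ ha hb => rw [map_add]; exact add_mem ha hb
  | smul c a _ ha => rw [map_smul]; exact Submodule.smul_mem _ _ ha

theorem zcomp_map {𝒟 : ℕ → Submodule k E} [GradedAlgebra 𝒟] {𝒞 : ℕ → Submodule k F}
    [GradedAlgebra 𝒞] {i : F →ₐ[k] E} (hi : ∀ n, ∀ a ∈ 𝒞 n, i a ∈ 𝒟 n) (m : ℤ) (a : F) :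
    zcomp 𝒟 m (i a) = i (zcomp 𝒞 m a) := by
  have hz : ∀ n : ℤ, ∀ a ∈ zpart 𝒞 n, i a ∈ zpart 𝒟 n := by
    intro n a ha
    cases n with
    | ofNat n => exact hi n a ha
    | negSucc n => rw [(Submodule.mem_bot k).1 ha, map_zero]; exact zero_mem _
  obtain ⟨N, hN⟩ := exists_sum_zcomp_eq (𝒟 := 𝒞) a
  rw [← hN N le_rfl]
  simp only [map_sum]
  refine Finset.sum_congr rfl fun n _ => ?_
  by_cases h : (n : ℤ) = m
  · rw [← h, zcomp_of_mem_same (hz _ _ (zcomp_mem 𝒞 n a)), zcomp_of_mem_same (zcomp_mem 𝒞 n a)]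
  · rw [zcomp_of_mem_ne (hz _ _ (zcomp_mem 𝒞 n a)) h, zcomp_of_mem_ne (zcomp_mem 𝒞 n a) h, map_zero]

/-- In each degree the map is a surjection between spaces of the same finite dimension. -/
theorem extensionMap_injective {𝒟 : ℕ → Submodule k E} [GradedAlgebra 𝒟]
    {𝒞 : ℕ → Submodule k F} [GradedAlgebra 𝒞] {i : F →ₐ[k] E} {y : E}
    (hi : ∀ n, ∀ a ∈ 𝒞 n, i a ∈ 𝒟 n) (hy : y ∈ 𝒟 1) (hC : ∀ n, Module.Finite k (𝒞 n))
    (hD : ∀ n, Module.Finite k (𝒟 n))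
    (hsurj : Function.Surjective (extensionMap i y))
    (hilbEq : ∀ m, hilb 𝒟 m = hilb 𝒞 m + hilb 𝒞 (m - 1)) :
    Function.Injective (extensionMap i y) := by
  have hcomp : ∀ (m : ℤ) (p : F × F), zcomp 𝒟 m (extensionMap i y p) =
      extensionMap i y (zcomp 𝒞 m p.1, zcomp 𝒞 (m - 1) p.2) := by
    intro m p
    rw [extensionMap_apply, map_add, zcomp_map hi]
    have := zcomp_mul_of_right_mem hy (m - 1) (i p.2)
    rw [Nat.cast_one, sub_add_cancel] at this
    rw [this, zcomp_map hi, extensionMap_apply]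
  rw [injective_iff_map_eq_zero]
  intro p hp
  have key : ∀ m, zcomp 𝒞 m p.1 = 0 ∧ zcomp 𝒞 (m - 1) p.2 = 0 := by
    intro m
    have := finite_zpart hC m
    have := finite_zpart hC (m - 1)
    have := finite_zpart hD m
    have hmem : ∀ q : zpart 𝒞 m × zpart 𝒞 (m - 1),
        extensionMap i y (q.1, q.2) ∈ zpart 𝒟 m := by
      intro q
      have := hcomp m (q.1, q.2)
      rw [zcomp_of_mem_same q.1.2, zcomp_of_mem_same q.2.2] at this
      rw [← this]
      exact zcomp_mem 𝒟 _ _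
    let f : zpart 𝒞 m × zpart 𝒞 (m - 1) →ₗ[k] zpart 𝒟 m :=
      (extensionMap i y ∘ₗ (zpart 𝒞 m).subtype.prodMap (zpart 𝒞 (m - 1)).subtype).codRestrict _ hmem
    have hf : Function.Surjective f := by
      rintro ⟨a, ha⟩
      obtain ⟨q, rfl⟩ := hsurj a
      refine ⟨(⟨_, zcomp_mem 𝒞 m q.1⟩, ⟨_, zcomp_mem 𝒞 (m - 1) q.2⟩), Subtype.ext ?_⟩
      exact (hcomp m q).symm.trans (zcomp_of_mem_same ha)
    have hrank : Module.finrank k (zpart 𝒞 m × zpart 𝒞 (m - 1)) = Module.finrank k (zpart 𝒟 m) := by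
      have := hilbEq m
      unfold hilb at this
      rw [Module.finrank_prod]
      exact_mod_cast this.symm
    have hinj := (LinearMap.injective_iff_surjective_of_finrank_eq_finrank hrank).2 hf
    have h0 := @hinj (⟨_, zcomp_mem 𝒞 m p.1⟩, ⟨_, zcomp_mem 𝒞 (m - 1) p.2⟩) 0 (by
      rw [map_zero]
      refine Subtype.ext ?_
      have := hcomp m p
      rw [hp, map_zero] at this
      exact this.symm)
    exact ⟨congrArg (fun q => (q.1 : F)) h0, congrArg (fun q => (q.2 : F)) h0⟩
  refine Prod.ext (eq_zero_of_zcomp_eq_zero (𝒟 := 𝒞) fun m => (key m).1)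
    (eq_zero_of_zcomp_eq_zero (𝒟 := 𝒞) fun m => ?_)
  have := (key (m + 1)).2
  rwa [add_sub_cancel_right] at this

/-- The linear map sending `(c + c' y) eₙ` to `c eₙ + c' e₋₍ₙ₊₁₎`, where `e` inverts
`(c, c') ↦ c + c' y`. -/
noncomputable def foldMap (e : E →ₗ[k] F × F) : (ℕ →₀ E) →ₗ[k] (ℤ →₀ F) :=
  Finsupp.lsum k fun n : ℕ => Finsupp.lsingle (n : ℤ) ∘ₗ LinearMap.fst k F F ∘ₗ e +
    Finsupp.lsingle (Int.negSucc n) ∘ₗ LinearMap.snd k F F ∘ₗ e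

theorem foldMap_single (e : E →ₗ[k] F × F) (n : ℕ) (a : E) :
    foldMap e (Finsupp.single n a) =
      Finsupp.single (n : ℤ) (e a).1 + Finsupp.single (Int.negSucc n) (e a).2 := by
  rw [foldMap, Finsupp.lsum_single]
  rfl

/-- The inverse of `foldMap`. -/
noncomputable def unfoldMap (i : F →ₐ[k] E) (y : E) : (ℤ →₀ F) →ₗ[k] (ℕ →₀ E) :=
  Finsupp.lsum k fun z : ℤ => Int.casesOn z (fun n => Finsupp.lsingle n ∘ₗ i.toLinearMap)
    fun n => Finsupp.lsingle n ∘ₗ LinearMap.mulRight k y ∘ₗ i.toLinearMap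

theorem unfoldMap_single_natCast (i : F →ₐ[k] E) (y : E) (n : ℕ) (c : F) :
    unfoldMap i y (Finsupp.single (n : ℤ) c) = Finsupp.single n (i c) := by
  rw [unfoldMap, Finsupp.lsum_single]
  rfl

theorem unfoldMap_single_negSucc (i : F →ₐ[k] E) (y : E) (n : ℕ) (c : F) :
    unfoldMap i y (Finsupp.single (Int.negSucc n) c) = Finsupp.single n (i c * y) := by
  rw [unfoldMap, Finsupp.lsum_single]
  rfl

/-- The decomposition of a free left module over an algebra `E = F ⊕ F y` into copies of `F`. -/
noncomputable def foldEquiv {i : F →ₐ[k] E} {y : E}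
    (h : Function.Bijective (extensionMap i y)) : (ℕ →₀ E) ≃ₗ[k] (ℤ →₀ F) :=
  LinearEquiv.ofLinearMap (foldMap (LinearEquiv.ofBijective _ h).symm.toLinearMap) (unfoldMap i y)
    (by
      refine Finsupp.lhom_ext fun z c => ?_
      rw [LinearMap.comp_apply, LinearMap.id_apply]
      rcases z with n | n
      · have : (LinearEquiv.ofBijective _ h).symm (i c) = (c, 0) := by
          rw [LinearEquiv.symm_apply_eq]
          simp [extensionMap_apply]
        rw [Int.ofNat_eq_natCast, unfoldMap_single_natCast, foldMap_single, LinearEquiv.coe_coe,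
          this, Finsupp.single_zero, add_zero]
      · have : (LinearEquiv.ofBijective _ h).symm (i c * y) = (0, c) := by
          rw [LinearEquiv.symm_apply_eq]
          simp [extensionMap_apply]
        rw [unfoldMap_single_negSucc, foldMap_single, LinearEquiv.coe_coe,
          this, Finsupp.single_zero, zero_add])
    (by
      refine Finsupp.lhom_ext fun n a => ?_
      obtain ⟨p, rfl⟩ := h.2 a
      have : (LinearEquiv.ofBijective _ h).symm (extensionMap i y p) = p :=
        (LinearEquiv.ofBijective _ h).symm_apply_apply p
      rw [LinearMap.comp_apply, LinearMap.id_apply, foldMap_single, map_add,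
        unfoldMap_single_natCast, unfoldMap_single_negSucc, LinearEquiv.coe_coe, this,
        ← Finsupp.single_add, extensionMap_apply])

theorem foldEquiv_single {i : F →ₐ[k] E} {y : E} (h : Function.Bijective (extensionMap i y))
    (n : ℕ) (c c' : F) : foldEquiv h (Finsupp.single n (i c + i c' * y)) =
      Finsupp.single (n : ℤ) c + Finsupp.single (Int.negSucc n) c' := by
  have h1 : (LinearEquiv.ofBijective _ h).symm (i c + i c' * y) = (c, c') :=
    (LinearEquiv.ofBijective _ h).symm_apply_apply (c, c')
  have h2 := foldMap_single (LinearEquiv.ofBijective _ h).symm.toLinearMap n (i c + i c' * y)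
  rw [LinearEquiv.coe_coe, h1] at h2
  exact h2

theorem foldEquiv_smul {i : F →ₐ[k] E} {y : E} (h : Function.Bijective (extensionMap i y))
    (c : F) (v : ℕ →₀ E) : foldEquiv h (i c • v) = c • foldEquiv h v := by
  induction v using Finsupp.induction_linear with
  | zero => simp
  | add f g hf hg => rw [smul_add, map_add, map_add, hf, hg, smul_add]
  | single n a =>
    obtain ⟨p, rfl⟩ := h.2 a
    rw [extensionMap_apply, foldEquiv_single, Finsupp.smul_single, smul_eq_mul, mul_add,
      ← mul_assoc, ← map_mul, ← map_mul, foldEquiv_single]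
    simp

end Extension

end TypeA

namespace TypeA

/-! ### Amalgamated products of algebras -/

section Amalgam

variable {k : Type u} [Field k] {F E₁ E₂ D : Type u} [Ring F] [Algebra k F] [Ring E₁] [Algebra k E₁]
  [Ring E₂] [Algebra k E₂] [Ring D] [Algebra k D]

/-- The universal property of an amalgamated product of algebras. -/
structure IsAmalgam (i₁ : F →ₐ[k] E₁) (i₂ : F →ₐ[k] E₂) (j₁ : E₁ →ₐ[k] D) (j₂ : E₂ →ₐ[k] D) :
    Prop where
  comm : ∀ c, j₁ (i₁ c) = j₂ (i₂ c)
  exists_desc : ∀ {G : Type u} [Ring G] [Algebra k G] (f₁ : E₁ →ₐ[k] G) (f₂ : E₂ →ₐ[k] G),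
    (∀ c, f₁ (i₁ c) = f₂ (i₂ c)) → ∃ f : D →ₐ[k] G, (∀ a, f (j₁ a) = f₁ a) ∧ ∀ b, f (j₂ b) = f₂ b
  hom_ext : ∀ {G : Type u} [Ring G] [Algebra k G] (f g : D →ₐ[k] G),
    (∀ a, f (j₁ a) = g (j₁ a)) → (∀ b, f (j₂ b) = g (j₂ b)) → f = g

theorem isAmalgam_of_isPushout {i₁ : F →ₐ[k] E₁} {i₂ : F →ₐ[k] E₂} {j₁ : E₁ →ₐ[k] D}
    {j₂ : E₂ →ₐ[k] D}
    (h : IsPushout (AlgCat.ofHom i₁) (AlgCat.ofHom i₂) (AlgCat.ofHom j₁) (AlgCat.ofHom j₂)) :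
    IsAmalgam i₁ i₂ j₁ j₂ where
  comm c := congrArg (fun f : AlgCat.of k F ⟶ AlgCat.of k D => f.hom c) h.w
  exists_desc {G} _ _ f₁ f₂ hf := by
    have hw : AlgCat.ofHom i₁ ≫ AlgCat.ofHom f₁ = AlgCat.ofHom i₂ ≫ AlgCat.ofHom f₂ :=
      AlgCat.hom_ext _ (AlgHom.ext hf)
    refine ⟨(h.desc _ _ hw).hom, fun a => ?_, fun b => ?_⟩
    · exact congrArg (fun f : AlgCat.of k E₁ ⟶ AlgCat.of k G => f.hom a) (h.inl_desc _ _ hw)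
    · exact congrArg (fun f : AlgCat.of k E₂ ⟶ AlgCat.of k G => f.hom b) (h.inr_desc _ _ hw)
  hom_ext {G} _ _ f g h₁ h₂ := by
    have : AlgCat.ofHom f = AlgCat.ofHom g := h.hom_ext (AlgCat.hom_ext _ (AlgHom.ext h₁))
      (AlgCat.hom_ext _ (AlgHom.ext h₂))
    exact congrArg AlgCat.Hom.hom this

variable {i₁ : F →ₐ[k] E₁} {i₂ : F →ₐ[k] E₂} {j₁ : E₁ →ₐ[k] D} {j₂ : E₂ →ₐ[k] D}

/-- The two maps descend to `S`; followed by the inclusion, the induced map is the identity by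
uniqueness. -/
theorem IsAmalgam.mem_of_mem (h : IsAmalgam i₁ i₂ j₁ j₂) {S : Subalgebra k D}
    (h₁ : ∀ a, j₁ a ∈ S) (h₂ : ∀ b, j₂ b ∈ S) (d : D) : d ∈ S := by
  obtain ⟨f, hf₁, hf₂⟩ := h.exists_desc (j₁.codRestrict S h₁) (j₂.codRestrict S h₂)
    fun c => Subtype.ext (h.comm c)
  have : S.val.comp f = AlgHom.id k D := h.hom_ext _ _
    (fun a => by simp [hf₁]) (fun b => by simp [hf₂])
  rw [← AlgHom.id_apply (R := k) d, ← this]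
  exact (f d).2

end Amalgam

/-! ### Normal forms in an amalgamated product by alternating words -/

section NormalForm

variable {k : Type u} [Field k] {D : Type u} [Ring D] [Algebra k D]

/-- The map `⊕ E → D`, `a eₙ ↦ j(a) wₙ`. -/
noncomputable def leftCombination {E : Type u} {J : Type} [Ring E] [Algebra k E] (j : E →ₐ[k] D)
    (w : J → D) : (J →₀ E) →ₗ[k] D :=
  Finsupp.lsum k fun n => LinearMap.mulRight k (w n) ∘ₗ j.toLinearMap

theorem leftCombination_single {E : Type u} {J : Type} [Ring E] [Algebra k E] (j : E →ₐ[k] D)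
    (w : J → D) (n : J) (a : E) : leftCombination j w (Finsupp.single n a) = j a * w n := by
  rw [leftCombination, Finsupp.lsum_single]
  rfl

theorem leftCombination_smul {E : Type u} {J : Type} [Ring E] [Algebra k E] (j : E →ₐ[k] D)
    (w : J → D) (a : E) (v : J →₀ E) :
    leftCombination j w (a • v) = j a * leftCombination j w v := by
  induction v using Finsupp.induction_linear with
  | zero => simp
  | add f g hf hg => rw [smul_add, map_add, map_add, hf, hg, mul_add]
  | single n b => rw [Finsupp.smul_single, leftCombination_single, leftCombination_single,
      smul_eq_mul, map_mul, mul_assoc]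

/-- The alternating words in `y₁`, `y₂` of length `n`, starting with `y₂`, resp. `y₁`. -/
def altPair (y₁ y₂ : D) : ℕ → D × D
  | 0 => (1, 1)
  | n + 1 => (y₂ * (altPair y₁ y₂ n).2, y₁ * (altPair y₁ y₂ n).1)

/-- The alternating words in two letters, indexed by the integers. -/
def altWord (y₁ y₂ : D) : ℤ → D
  | Int.ofNat n => (altPair y₁ y₂ n).1
  | Int.negSucc n => (altPair y₁ y₂ (n + 1)).2

theorem altWord_neg (y₁ y₂ : D) (n : ℕ) : altWord y₁ y₂ (-n) = (altPair y₁ y₂ n).2 := by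
  cases n with
  | zero => rfl
  | succ n => rfl

theorem altPair_mem {X : Type} {x : X → D} {y₁ y₂ : D} (h₁ : y₁ ∈ degreePart k x 1)
    (h₂ : y₂ ∈ degreePart k x 1) (n : ℕ) :
    (altPair y₁ y₂ n).1 ∈ degreePart k x n ∧ (altPair y₁ y₂ n).2 ∈ degreePart k x n := by
  induction n with
  | zero =>
    have : (1 : D) ∈ degreePart k x 0 := Submodule.subset_span ⟨[], rfl, rfl⟩
    exact ⟨this, this⟩
  | succ n ih =>
    have h₂' := mul_mem_degreePart h₂ ih.2
    have h₁' := mul_mem_degreePart h₁ ih.1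
    rw [add_comm 1 n] at h₁' h₂'
    exact ⟨h₂', h₁'⟩

variable {F E₁ E₂ : Type u} [Ring F] [Algebra k F] [Ring E₁] [Algebra k E₁]
  [Ring E₂] [Algebra k E₂]
  {i₁ : F →ₐ[k] E₁} {i₂ : F →ₐ[k] E₂} {j₁ : E₁ →ₐ[k] D} {j₂ : E₂ →ₐ[k] D} {y₁ : E₁} {y₂ : E₂}

/-- The normal form of the elements of an amalgamated product `E₁ ⨿ E₂` over `F`, where
`E₁ = F ⊕ F y₁` and `E₂ = F ⊕ F y₂`. -/
theorem IsAmalgam.bijective_leftCombination (h : IsAmalgam i₁ i₂ j₁ j₂)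
    (h₁ : Function.Bijective (extensionMap i₁ y₁)) (h₂ : Function.Bijective (extensionMap i₂ y₂)) :
    Function.Bijective (leftCombination (j₁.comp i₁) (altWord (j₁ y₁) (j₂ y₂))) ∧
    Function.Bijective (leftCombination j₁ fun n : ℕ => altWord (j₁ y₁) (j₂ y₂) n) ∧
    Function.Bijective (leftCombination j₂ fun n : ℕ => altWord (j₁ y₁) (j₂ y₂) (-n)) := by
  -- The space `⊕_ℤ F` becomes a free `E₁`-module by pairing the index `n` with `-(n + 1)`, and a
  -- free `E₂`-module by pairing `-n` with `n + 1`. This mirrors `y₁ wₙ = w₋₍ₙ₊₁₎` and `y₂ w₋ₙ =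
  -- wₙ₊₁`.
  let ψ₁ := foldEquiv h₁
  let ψ₂ : (ℕ →₀ E₂) ≃ₗ[k] (ℤ →₀ F) := foldEquiv h₂ ≪≫ₗ Finsupp.domLCongr (Equiv.neg ℤ)
  have hψ₂s : ∀ (c : F) v, ψ₂ (i₂ c • v) = c • ψ₂ v := by
    intro c v
    simp only [ψ₂, LinearEquiv.trans_apply, foldEquiv_smul]
    ext z
    simp [Finsupp.domLCongr_apply]
  have hψ₂ : ∀ (n : ℕ) (c c' : F), ψ₂ (Finsupp.single n (i₂ c + i₂ c' * y₂)) =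
      Finsupp.single (-(n : ℤ)) c + Finsupp.single ((n + 1 : ℕ) : ℤ) c' := by
    intro n c c'
    simp only [ψ₂, LinearEquiv.trans_apply, foldEquiv_single, map_add, Finsupp.domLCongr_single]
    rfl
  have hψ₁ : ∀ (n : ℕ) (c c' : F), ψ₁ (Finsupp.single n (i₁ c + i₁ c' * y₁)) =
      Finsupp.single (n : ℤ) c + Finsupp.single (-((n + 1 : ℕ) : ℤ)) c' := foldEquiv_single h₁
  set w := altWord (j₁ y₁) (j₂ y₂) with hw
  have hw₁ : ∀ n : ℕ, w (-((n + 1 : ℕ) : ℤ)) = j₁ y₁ * w n := fun n => by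
    rw [hw, altWord_neg]; rfl
  have hw₂ : ∀ n : ℕ, w ((n + 1 : ℕ) : ℤ) = j₂ y₂ * w (-n) := fun n => by
    rw [hw, altWord_neg]; rfl
  set Ψ := leftCombination (j₁.comp i₁) w
  have hΨ : ∀ z c, Ψ (Finsupp.single z c) = j₁ (i₁ c) * w z :=
    fun z c => leftCombination_single _ _ z c
  have e₁ : Ψ ∘ₗ ψ₁.toLinearMap = leftCombination j₁ fun n : ℕ => w n := by
    refine Finsupp.lhom_ext fun n a => ?_
    obtain ⟨p, rfl⟩ := h₁.2 a
    rw [leftCombination_single, LinearMap.comp_apply, LinearEquiv.coe_coe, extensionMap_apply,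
      hψ₁, map_add, hΨ, hΨ, hw₁, map_add, map_mul, add_mul, mul_assoc]
  have e₂ : Ψ ∘ₗ ψ₂.toLinearMap = leftCombination j₂ fun n : ℕ => w (-n) := by
    refine Finsupp.lhom_ext fun n a => ?_
    obtain ⟨p, rfl⟩ := h₂.2 a
    rw [leftCombination_single, LinearMap.comp_apply, LinearEquiv.coe_coe, extensionMap_apply,
      hψ₂, map_add, hΨ, hΨ, hw₂, map_add, map_mul, add_mul, mul_assoc, h.comm, h.comm]
  -- The candidate normal forms are made into a `D`-module: the actions of `E₁` and `E₂` agree on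
  -- `F`, so the universal property gives an action of `D`.
  let ρ₁ : E₁ →ₐ[k] Module.End k (ℤ →₀ F) :=
    (LinearEquiv.conjAlgEquiv k ψ₁).toAlgHom.comp (Algebra.lsmul k k (ℕ →₀ E₁))
  let ρ₂ : E₂ →ₐ[k] Module.End k (ℤ →₀ F) :=
    (LinearEquiv.conjAlgEquiv k ψ₂).toAlgHom.comp (Algebra.lsmul k k (ℕ →₀ E₂))
  have hρ₁ : ∀ a v, ρ₁ a (ψ₁ v) = ψ₁ (a • v) := by
    intro a v
    change ψ₁ (a • ψ₁.symm (ψ₁ v)) = _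
    rw [LinearEquiv.symm_apply_apply]
  have hρ₂ : ∀ a v, ρ₂ a (ψ₂ v) = ψ₂ (a • v) := by
    intro a v
    change ψ₂ (a • ψ₂.symm (ψ₂ v)) = _
    rw [LinearEquiv.symm_apply_apply]
  have hc₁ : ∀ (c : F) v, ρ₁ (i₁ c) v = c • v := by
    intro c v
    obtain ⟨v, rfl⟩ := ψ₁.surjective v
    rw [hρ₁]
    exact foldEquiv_smul h₁ c v
  have hc₂ : ∀ (c : F) v, ρ₂ (i₂ c) v = c • v := by
    intro c v
    obtain ⟨v, rfl⟩ := ψ₂.surjective v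
    rw [hρ₂, hψ₂s]
  obtain ⟨ρ, hj₁, hj₂⟩ := h.exists_desc (G := Module.End k (ℤ →₀ F)) ρ₁ ρ₂
    fun c => LinearMap.ext fun v => by rw [hc₁, hc₂]
  have hint : ∀ d : D, ∀ v, Ψ (ρ d v) = d * Ψ v := by
    let S : Subalgebra k D :=
      { carrier := {d | ∀ v, Ψ (ρ d v) = d * Ψ v}
        mul_mem' := fun {a b} ha hb v => by
          rw [map_mul, Module.End.mul_apply, ha, hb, mul_assoc]
        add_mem' := fun {a b} ha hb v => by
          rw [map_add, LinearMap.add_apply, map_add, ha, hb, add_mul]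
        algebraMap_mem' := fun c v => by
          rw [AlgHom.commutes, Module.algebraMap_end_apply, map_smul, Algebra.smul_def] }
    refine h.mem_of_mem (S := S) (fun a v => ?_) (fun b v => ?_)
    · obtain ⟨v, rfl⟩ := ψ₁.surjective v
      rw [hj₁, hρ₁]
      have := leftCombination_smul j₁ (fun n : ℕ => w n) a v
      rwa [← e₁] at this
    · obtain ⟨v, rfl⟩ := ψ₂.surjective v
      rw [hj₂, hρ₂]
      have := leftCombination_smul j₂ (fun n : ℕ => w (-n)) b v
      rwa [← e₂] at this
  have hy₁ : ∀ n : ℕ, ρ (j₁ y₁) (Finsupp.single (n : ℤ) 1) =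
      Finsupp.single (-((n + 1 : ℕ) : ℤ)) 1 := by
    intro n
    have a := hψ₁ n 1 0
    have b := hψ₁ n 0 1
    rw [map_one, map_zero, zero_mul, add_zero, Finsupp.single_zero, add_zero] at a
    rw [map_one, map_zero, one_mul, zero_add, Finsupp.single_zero, zero_add] at b
    rw [hj₁, ← a, hρ₁, Finsupp.smul_single, smul_eq_mul, mul_one, b]
  have hy₂ : ∀ n : ℕ, ρ (j₂ y₂) (Finsupp.single (-(n : ℤ)) 1) =
      Finsupp.single ((n + 1 : ℕ) : ℤ) 1 := by
    intro n
    have a := hψ₂ n 1 0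
    have b := hψ₂ n 0 1
    rw [map_one, map_zero, zero_mul, add_zero, Finsupp.single_zero, add_zero] at a
    rw [map_one, map_zero, one_mul, zero_add, Finsupp.single_zero, zero_add] at b
    rw [hj₂, ← a, hρ₂, Finsupp.smul_single, smul_eq_mul, mul_one, b]
  have hwn : ∀ n : ℕ, ρ (w n) (Finsupp.single 0 1) = Finsupp.single (n : ℤ) 1 ∧
      ρ (w (-n)) (Finsupp.single 0 1) = Finsupp.single (-(n : ℤ)) 1 := by
    intro n
    induction n with
    | zero =>
      have : w 0 = 1 := rfl
      simp [this]
    | succ n ih =>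
      rw [hw₁, hw₂, map_mul, map_mul, Module.End.mul_apply, Module.End.mul_apply, ih.1, ih.2, hy₁,
        hy₂]
      exact ⟨rfl, rfl⟩
  have hwz : ∀ z : ℤ, ρ (w z) (Finsupp.single 0 1) = Finsupp.single z 1 := by
    intro z
    obtain ⟨n, rfl | rfl⟩ := z.eq_nat_or_neg
    · exact (hwn n).1
    · exact (hwn n).2
  -- The inverse lets `d` act on the basis vector of the empty word.
  have hΨbij : Function.Bijective Ψ := by
    refine Function.bijective_iff_has_inverse.2 ⟨fun d => ρ d (Finsupp.single 0 1), ?_, ?_⟩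
    · intro v
      induction v using Finsupp.induction_linear with
      | zero => simp
      | add f g hf hg =>
        change ρ _ _ = _ at hf hg
        change ρ _ _ = _
        rw [map_add, map_add, LinearMap.add_apply, hf, hg]
      | single z c =>
        change ρ _ _ = _
        rw [hΨ, map_mul, Module.End.mul_apply, hwz, hj₁, hc₁, Finsupp.smul_single, smul_eq_mul,
          mul_one]
    · intro d
      change Ψ (ρ d _) = d
      have : w 0 = 1 := rfl
      rw [hint, hΨ, map_one, map_one, this, mul_one, mul_one]
  refine ⟨hΨbij, ?_, ?_⟩
  · rw [← e₁]
    exact hΨbij.comp ψ₁.bijective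
  · rw [← e₂]
    exact hΨbij.comp ψ₂.bijective

end NormalForm

end TypeA

namespace TypeA

/-! ### Descent of exactness along an extension free as a left module -/

section FreeExtension

variable {k : Type u} [Field k] {E D : Type u} [Ring E] [Algebra k E] [Ring D] [Algebra k D]
  {j : E →ₐ[k] D} {J : Type} {w : J → D}

theorem injective_of_leftCombination (h : Function.Injective (leftCombination j w)) (n : J) :
    Function.Injective j := by
  rw [injective_iff_map_eq_zero]
  intro a ha
  have : leftCombination j w (Finsupp.single n a) = leftCombination j w 0 := by
    rw [leftCombination_single, ha, zero_mul, map_zero]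
  simpa using h this

variable {X I : Type} [Fintype X] {x : X → E}

omit [Fintype X] in
theorem eq_zero_of_leftCombination (h : Function.Bijective (leftCombination j w))
    (hx : ∀ a : E, (∀ i, x i * a = 0) → a = 0) {d : D} (hd : ∀ i, j (x i) * d = 0) : d = 0 := by
  obtain ⟨f, rfl⟩ := h.2 d
  have hf : f = 0 := by
    ext n
    refine hx _ fun i => ?_
    have h1 : leftCombination j w (x i • f) = leftCombination j w 0 := by
      rw [leftCombination_smul, hd, map_zero]
    simpa using DFunLike.congr_fun (h.1 h1) n
  rw [hf, map_zero]

/-- Exactness of a complex of free right modules passes to an extension that is free as a left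
module. -/
theorem exists_eq_mul_of_leftCombination (h : Function.Bijective (leftCombination j w))
    (hx : ∀ a : E, (∀ i, x i * a = 0) → a = 0) {T : Matrix I X E}
    (hT : ∀ u, T.mulVec u = 0 → ∃ a, ∀ i, u i = x i * a) {u : X → D}
    (hu : ∀ l, ∑ i, j (T l i) * u i = 0) : ∃ d, ∀ i, u i = j (x i) * d := by
  classical
  choose f hf using fun i => h.2 (u i)
  have h0 : ∀ n, T.mulVec (fun i => f i n) = 0 := by
    intro n
    funext l
    have h1 : leftCombination j w (∑ i, T l i • f i) = leftCombination j w 0 := by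
      rw [map_sum, map_zero, ← hu l]
      exact Finset.sum_congr rfl fun i _ => by rw [leftCombination_smul, hf]
    have h2 := DFunLike.congr_fun (h.1 h1) n
    simpa [Finsupp.finsetSum_apply, Matrix.mulVec, dotProduct] using h2
  choose a ha using fun n => hT _ (h0 n)
  -- The support is finite: where all `f i` vanish, `x i * a n = 0` for every `i`, so `a n = 0` by
  -- `hx`.
  let g : J →₀ E := Finsupp.onFinset (Finset.univ.biUnion fun i => (f i).support) a (by
    intro n hn
    by_contra hmem
    refine hn (hx _ fun i => ?_)
    rw [← ha]
    by_contra hne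
    exact hmem (Finset.mem_biUnion.2 ⟨i, Finset.mem_univ _, Finsupp.mem_support_iff.2 hne⟩))
  refine ⟨leftCombination j w g, fun i => ?_⟩
  rw [← leftCombination_smul, ← hf]
  congr 1
  ext n
  exact ha n i

end FreeExtension

/-! ### The Hilbert series of a free extension -/

section FreeHilbert

variable {k : Type u} [Field k] {E D : Type u} [Ring E] [Algebra k E] [Ring D] [Algebra k D]
  {ℰ : ℕ → Submodule k E} [GradedAlgebra ℰ] {𝒟 : ℕ → Submodule k D} [GradedAlgebra 𝒟]
  {j : E →ₐ[k] D} {w : ℕ → D}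

theorem zcomp_leftCombination (hj : ∀ n, ∀ a ∈ ℰ n, j a ∈ 𝒟 n) (hw : ∀ n, w n ∈ 𝒟 n) (n : ℕ)
    (f : ℕ →₀ E) : zcomp 𝒟 n (leftCombination j w f) =
      ∑ i ∈ Finset.range (n + 1), j (zcomp ℰ ((n : ℤ) - i) (f i)) * w i := by
  induction f using Finsupp.induction_linear with
  | zero => simp
  | add f g hf hg =>
    rw [map_add, map_add, hf, hg, ← Finset.sum_add_distrib]
    exact Finset.sum_congr rfl fun i _ => by simp [add_mul]
  | single l a =>
    have h1 : zcomp 𝒟 n (leftCombination j w (Finsupp.single l a)) =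
        j (zcomp ℰ ((n : ℤ) - l) a) * w l := by
      have := zcomp_mul_of_right_mem (hw l) ((n : ℤ) - l) (j a)
      rw [sub_add_cancel] at this
      rw [leftCombination_single, this, zcomp_map hj]
    rw [h1]
    by_cases hl : l ∈ Finset.range (n + 1)
    · rw [Finset.sum_eq_single_of_mem l hl, Finsupp.single_eq_same]
      intro i _ hi
      rw [Finsupp.single_eq_of_ne hi, map_zero, map_zero, zero_mul]
    · rw [zcomp_of_neg ℰ (by rw [Finset.mem_range] at hl; omega), map_zero, zero_mul]
      refine (Finset.sum_eq_zero fun i hi => ?_).symm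
      rw [Finsupp.single_eq_of_ne (by rintro rfl; exact hl hi), map_zero, map_zero, zero_mul]

theorem hilb_eq_sum_of_leftCombination (hfin : ∀ n, Module.Finite k (ℰ n))
    (hj : ∀ n, ∀ a ∈ ℰ n, j a ∈ 𝒟 n)
    (hw : ∀ n, w n ∈ 𝒟 n) (h : Function.Bijective (leftCombination j w)) (n : ℕ) :
    hilb 𝒟 n = ∑ i ∈ Finset.range (n + 1), hilb ℰ ((n : ℤ) - i) := by
  have hfin' : ∀ m, Module.Finite k (zpart ℰ m) := finite_zpart hfin
  have hjz : ∀ n : ℤ, ∀ a ∈ zpart ℰ n, j a ∈ zpart 𝒟 n := by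
    intro n a ha
    cases n with
    | ofNat n => exact hj n a ha
    | negSucc n => rw [(Submodule.mem_bot k).1 ha, map_zero]; exact zero_mem _
  let g : ((i : Fin (n + 1)) → zpart ℰ ((n : ℤ) - (i : ℕ))) →ₗ[k] (ℕ →₀ E) :=
    ∑ i : Fin (n + 1), Finsupp.lsingle (i : ℕ) ∘ₗ (zpart ℰ ((n : ℤ) - (i : ℕ))).subtype ∘ₗ
      LinearMap.proj i
  have hg : ∀ v, g v = ∑ i : Fin (n + 1), Finsupp.single (i : ℕ) (v i : E) := by
    intro v
    simp [g]
  have hgi : ∀ v (i : Fin (n + 1)), g v (i : ℕ) = v i := by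
    intro v i
    rw [hg, Finsupp.finsetSum_apply, Finset.sum_eq_single i, Finsupp.single_eq_same]
    · intro l _ hl
      exact Finsupp.single_eq_of_ne fun h => hl (Fin.ext h.symm)
    · simp
  have hmem : ∀ v, (leftCombination j w ∘ₗ g) v ∈ zpart 𝒟 n := by
    intro v
    rw [LinearMap.comp_apply, hg, map_sum]
    refine Submodule.sum_mem _ fun i _ => ?_
    rw [leftCombination_single]
    have := zcomp_mul_mem (𝒟 := 𝒟) (hjz _ _ (v i).2) (n := (i : ℕ)) (hw i)
    rwa [sub_add_cancel] at this
  let G := (leftCombination j w ∘ₗ g).codRestrict _ hmem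
  have hbij : Function.Bijective G := by
    constructor
    · intro v v' hv
      have h1 : g v = g v' := h.1 (congrArg Subtype.val hv)
      funext i
      exact Subtype.ext (by rw [← hgi, h1, hgi])
    · rintro ⟨d, hd⟩
      obtain ⟨f, hf⟩ := h.2 d
      refine ⟨fun i => ⟨zcomp ℰ ((n : ℤ) - (i : ℕ)) (f i), zcomp_mem ℰ _ _⟩, Subtype.ext ?_⟩
      change leftCombination j w (g _) = d
      rw [hg, map_sum, ← zcomp_of_mem_same hd, ← hf, zcomp_leftCombination hj hw,
        Finset.sum_range]
      exact Finset.sum_congr rfl fun i _ => leftCombination_single _ _ _ _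
  have := (LinearEquiv.ofBijective G hbij).finrank_eq
  rw [hilb, ← this, Module.finrank_pi_fintype, Finset.sum_range]
  simp [hilb]

/-- There is one free generator in each degree, so the Hilbert series of `D` is that of `E` divided
by `1 - t`. -/
theorem hilb_sub_of_leftCombination (hfin : ∀ n, Module.Finite k (ℰ n))
    (hj : ∀ n, ∀ a ∈ ℰ n, j a ∈ 𝒟 n)
    (hw : ∀ n, w n ∈ 𝒟 n) (h : Function.Bijective (leftCombination j w)) (m : ℤ) :
    hilb 𝒟 m - hilb 𝒟 (m - 1) = hilb ℰ m := by
  have hs := hilb_eq_sum_of_leftCombination hfin hj hw h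
  rcases lt_or_ge m 0 with hm | hm
  · rw [hilb_of_neg _ hm, hilb_of_neg _ hm, hilb_of_neg _ (by omega), sub_zero]
  · obtain ⟨n, rfl⟩ := Int.eq_ofNat_of_zero_le hm
    cases n with
    | zero =>
      rw [hs, hilb_of_neg 𝒟 (m := ((0 : ℕ) : ℤ) - 1) (by simp)]
      simp
    | succ n =>
      rw [show (((n + 1 : ℕ) : ℤ) - 1) = (n : ℤ) by push_cast; ring, hs, hs,
        Finset.sum_range_succ']
      have : ∀ i : ℕ, ((n + 1 : ℕ) : ℤ) - ((i + 1 : ℕ) : ℤ) = (n : ℤ) - i := fun i => by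
        push_cast; ring
      simp only [this]
      simp

end FreeHilbert

/-! ### Coefficients of relations under an inclusion of letters -/

section Coefficients

variable {k : Type u} [Field k] {D : Type u} [Ring D] [Algebra k D] {X Y : Type} [Fintype X]
  [Fintype Y] {σ : X → Y} {f : FreeAlgebra k X} {t : X → FreeAlgebra k X} {s : Y → FreeAlgebra k Y}

omit [Fintype X] [Fintype Y] in
theorem lift_lift_ι (x : Y → D) (a : FreeAlgebra k X) :
    FreeAlgebra.lift k x (FreeAlgebra.lift k (fun i => FreeAlgebra.ι k (σ i)) a) =
      FreeAlgebra.lift k (fun i => x (σ i)) a := by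
  rw [algHom_lift]
  simp

/-- By uniqueness of right coefficients, `s` is the image of `t` at the letters `σ i` and zero
elsewhere. So any matrix `T` for `D` restricts to the ones for `A` and `B`. -/
theorem sum_rightCoefficients_mul (ht : ∑ i, t i * FreeAlgebra.ι k i = f)
    (hs : ∑ l, s l * FreeAlgebra.ι k l = FreeAlgebra.lift k (fun i => FreeAlgebra.ι k (σ i)) f)
    (x u : Y → D) : ∑ l, FreeAlgebra.lift k x (s l) * u l =
      ∑ i, FreeAlgebra.lift k (fun i => x (σ i)) (t i) * u (σ i) := by
  classical
  have h : s = fun l => ∑ i, if σ i = l then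
      FreeAlgebra.lift k (fun i => FreeAlgebra.ι k (σ i)) (t i) else 0 := by
    apply eq_of_sum_mul_ι_eq
    rw [hs, ← ht]
    simp only [map_sum, map_mul, FreeAlgebra.lift_ι_apply, Finset.sum_mul, ite_mul, zero_mul]
    rw [Finset.sum_comm]
    simp
  rw [h]
  simp only [map_sum, Finset.sum_mul, apply_ite (FreeAlgebra.lift k x), map_zero, ite_mul,
    zero_mul, lift_lift_ι]
  rw [Finset.sum_comm]
  simp

theorem sum_mul_leftCoefficients (ht : ∑ i, FreeAlgebra.ι k i * t i = f)
    (hs : ∑ l, FreeAlgebra.ι k l * s l = FreeAlgebra.lift k (fun i => FreeAlgebra.ι k (σ i)) f)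
    (x u : Y → D) : ∑ l, u l * FreeAlgebra.lift k x (s l) =
      ∑ i, u (σ i) * FreeAlgebra.lift k (fun i => x (σ i)) (t i) := by
  classical
  have h : s = fun l => ∑ i, if σ i = l then
      FreeAlgebra.lift k (fun i => FreeAlgebra.ι k (σ i)) (t i) else 0 := by
    apply eq_of_sum_ι_mul_eq
    rw [hs, ← ht]
    simp only [map_sum, map_mul, FreeAlgebra.lift_ι_apply, Finset.mul_sum, mul_ite, mul_zero]
    rw [Finset.sum_comm]
    simp
  rw [h]
  simp only [map_sum, Finset.mul_sum, apply_ite (FreeAlgebra.lift k x), map_zero, mul_ite,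
    mul_zero, lift_lift_ι]
  rw [Finset.sum_comm]
  simp

end Coefficients

end TypeA

namespace TypeA

/-! ### Exactness of the linear complex and of its transpose -/

section Linear

variable {k : Type u} [Field k] {D : Type u} [Ring D] [Algebra k D] {𝒟 : ℕ → Submodule k D}

/-- A linear complex of free right modules, `D → D⁴ → D⁶ → D⁴ → D` with differentials `xᵗ`, `T`, `R`
and `x`, that is known to be exact outside `D⁶`, over an algebra with Hilbert series
`(1 - t)⁻⁴`. -/
structure LinearComplex (𝒟 : ℕ → Submodule k D) (x : Fin 4 → D) (R : Matrix (Fin 4) (Fin 6) D)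
    (T : Matrix (Fin 6) (Fin 4) D) : Prop where
  gen : IsGeneratedBy 𝒟 x
  finite : ∀ n, Module.Finite k (𝒟 n)
  R_mem : ∀ i j, R i j ∈ 𝒟 1
  T_mem : ∀ i j, T i j ∈ 𝒟 1
  R_mul_T : R * T = 0
  gen_vecMul : Matrix.vecMul x R = 0
  mulVec_gen : T.mulVec x = 0
  left_gen : ∀ a : Fin 4 → D, ∑ i, a i * x i = 0 → ∃ b, Matrix.vecMul b T = a
  right_gen : ∀ a : Fin 4 → D, ∑ i, x i * a i = 0 → ∃ b, R.mulVec b = a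
  right_T : ∀ u, T.mulVec u = 0 → ∃ d, ∀ i, u i = x i * d
  right_inj : ∀ d, (∀ i, x i * d = 0) → d = 0
  minimal : ∀ v : Fin 4 → k, Matrix.vecMul (fun i => algebraMap k D (v i)) R = 0 → v = 0
  recursion : ∀ m, hilb 𝒟 m - (if m = 0 then 1 else 0) =
    4 * hilb 𝒟 (m - 1) - 6 * hilb 𝒟 (m - 2) + 4 * hilb 𝒟 (m - 3) - hilb 𝒟 (m - 4)

theorem colMap_row {ι : Type} [Fintype ι] (x : ι → D) (b : ι → D) :
    colMap k (fun (_ : Unit) i => x i : Matrix Unit ι D) b = fun _ => ∑ i, x i * b i := rfl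

theorem colMap_column {ι : Type} (x : ι → D) (b : Unit → D) :
    colMap k (fun i (_ : Unit) => x i : Matrix ι Unit D) b = fun i => x i * b () := by
  funext i
  exact Fintype.sum_unique fun u : Unit => x i * b u

variable [GradedAlgebra 𝒟]

/-- An induction on degrees: a homogeneous subspace of vectors, all of whose elements in degrees
at least two are combinations of its elements of smaller degree. -/
theorem le_of_low_degree {ι κ : Type} [Fintype ι] [Fintype κ] {x : ι → D} (hx : ∀ i, x i ∈ 𝒟 1)
    {K N : Submodule k (κ → D)} (hK : ∀ u ∈ K, ∀ m, vcomp 𝒟 κ m u ∈ K)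
    (hxN : ∀ i, ∀ u ∈ N, (fun j => x i * u j) ∈ N)
    (h0 : ∀ u ∈ K, u ∈ vpart 𝒟 κ 0 → u ∈ N) (h1 : ∀ u ∈ K, u ∈ vpart 𝒟 κ 1 → u ∈ N)
    (h : ∀ m, 2 ≤ m → ∀ u ∈ K, u ∈ vpart 𝒟 κ m → ∃ ζ : ι → κ → D, (∀ i, ζ i ∈ K) ∧
      u = ∑ i, fun j => x i * ζ i j) : K ≤ N := by
  have key : ∀ (M : ℕ) (m : ℤ), m < M → ∀ u ∈ K, u ∈ vpart 𝒟 κ m → u ∈ N := by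
    intro M
    induction M with
    | zero =>
      intro m hm u _ hu
      rw [eq_zero_of_mem_vpart_of_neg (by simpa using hm) hu]
      exact zero_mem _
    | succ M ih =>
      intro m hm u huK hu
      rcases lt_or_ge m 2 with hm2 | hm2
      · rcases lt_or_ge m 0 with hm0 | hm0
        · rw [eq_zero_of_mem_vpart_of_neg hm0 hu]
          exact zero_mem _
        · obtain rfl | rfl : m = 0 ∨ m = 1 := by omega
          · exact h0 u huK hu
          · exact h1 u huK hu
      · obtain ⟨ζ, hζ, hsum⟩ := h m hm2 u huK hu
        have : u = ∑ i, fun j => x i * vcomp 𝒟 κ (m - 1) (ζ i) j := by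
          rw [← vcomp_of_mem_same hu]
          conv_lhs => rw [hsum]
          rw [map_sum]
          refine Finset.sum_congr rfl fun i _ => funext fun j => ?_
          have := zcomp_mul_of_left_mem (hx i) (m - 1) (ζ i j)
          rwa [Nat.cast_one, sub_add_cancel] at this
        rw [this]
        refine Submodule.sum_mem _ fun i _ => hxN i _ ?_
        exact ih (m - 1) (by push_cast at hm; omega) _ (hK _ (hζ i) _) (vcomp_mem _ _)
  intro u hu
  refine mem_of_vcomp_mem (𝒟 := 𝒟) fun m => ?_
  exact key (m.toNat + 1) m (by omega) _ (hK u hu m) (vcomp_mem _ _)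

theorem matrix_exists_eq_gen_mul {ι κ : Type} [Fintype ι] [Fintype κ] {x : ι → D}
    (hx : IsGeneratedBy 𝒟 x) {m : ℤ} (hm : m ≠ 0) {z : κ → D} (hz : z ∈ vpart 𝒟 κ m) :
    ∃ ζ : Matrix ι κ D, (∀ i j, ζ i j ∈ zpart 𝒟 (m - 1)) ∧ Matrix.vecMul x ζ = z := by
  choose b hb using fun j => hx.exists_sum_right (zcomp_of_mem_ne (mem_vpart.1 hz j) hm)
  refine ⟨fun i j => zcomp 𝒟 (m - 1) (b j i), fun i j => zcomp_mem 𝒟 _ _, funext fun j => ?_⟩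
  rw [← zcomp_of_mem_same (mem_vpart.1 hz j)]
  conv_rhs => rw [hb]
  rw [map_sum]
  refine Finset.sum_congr rfl fun i _ => ?_
  have := zcomp_mul_of_left_mem (hx.mem i) (m - 1) (b j i)
  rw [Nat.cast_one, sub_add_cancel] at this
  exact this.symm

/-- The matrix form of a lifting along a linear complex of free right modules. -/
theorem matrix_exists_mul {ι κ σ τ : Type} [Fintype ι] [Fintype κ] [Fintype σ] {M : Matrix κ ι D}
    {M' : Matrix σ κ D} (hM : ∀ i j, M i j ∈ 𝒟 1)
    (h : ∀ u, M'.mulVec u = 0 → ∃ v, M.mulVec v = u) {m : ℤ} {U : Matrix κ τ D}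
    (hU : ∀ i j, U i j ∈ zpart 𝒟 m) (h0 : M' * U = 0) :
    ∃ V : Matrix ι τ D, (∀ i j, V i j ∈ zpart 𝒟 (m - 1)) ∧ M * V = U := by
  have := fun j => (isShift_colMap (k := k) hM).exists_homogeneous (m := m) (u := fun i => U i j)
    (mem_vpart.2 fun i => hU i j) (h _ (funext fun l => congrFun (congrFun h0 l) j))
  choose V hV hMV using this
  refine ⟨fun i j => V j i, fun i j => mem_vpart.1 (hV j) i, ?_⟩
  ext i j
  exact congrFun (hMV j) i

theorem mul_mem_zpart_of_mem {ι κ τ : Type} [Fintype κ] {m : ℤ} {U : Matrix ι κ D}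
    {M : Matrix κ τ D} (hU : ∀ i j, U i j ∈ zpart 𝒟 (m - 1)) (hM : ∀ i j, M i j ∈ 𝒟 1) (i : ι)
    (j : τ) : (U * M) i j ∈ zpart 𝒟 m := by
  rw [Matrix.mul_apply]
  refine Submodule.sum_mem _ fun l _ => ?_
  have := zcomp_mul_mem (𝒟 := 𝒟) (hU i l) (n := ((1 : ℕ) : ℤ)) (hM l j)
  rwa [Nat.cast_one, sub_add_cancel] at this

namespace LinearComplex

variable {x : Fin 4 → D} {R : Matrix (Fin 4) (Fin 6) D} {T : Matrix (Fin 6) (Fin 4) D}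
  (h : LinearComplex 𝒟 x R T) [Nontrivial D]
include h

-- The first coefficients of `(1 - t)⁻⁴`; only these enter the dimension counts in degrees zero and
-- one.
omit [GradedAlgebra 𝒟] [Nontrivial D] in
theorem hilb_values : hilb 𝒟 0 = 1 ∧ hilb 𝒟 1 = 4 ∧ hilb 𝒟 2 = 10 ∧ hilb 𝒟 3 = 20 ∧
    hilb 𝒟 4 = 35 := by
  have hn : ∀ m < 0, hilb 𝒟 m = 0 := fun m hm => hilb_of_neg 𝒟 hm
  have h0 := h.recursion 0
  have h1 := h.recursion 1
  have h2 := h.recursion 2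
  have h3 := h.recursion 3
  have h4 := h.recursion 4
  have n1 := hn (-1) (by norm_num)
  have n2 := hn (-2) (by norm_num)
  have n3 := hn (-3) (by norm_num)
  have n4 := hn (-4) (by norm_num)
  norm_num at h0 h1 h2 h3 h4
  omega

/-- The right complex is exact at every other place, so its ranks are known. By the recursion the
ranks of `R` and `T` add up to the dimension of the middle term, which leaves no homology at `D⁶`.
-/
theorem exists_T_mulVec (u : Fin 6 → D) (hu : R.mulVec u = 0) : ∃ v, T.mulVec v = u := by
  have sR := isShift_colMap (k := k) h.R_mem
  have sT := isShift_colMap (k := k) h.T_mem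
  have sx : IsShift 𝒟 (colMap k (fun (_ : Unit) i => x i : Matrix Unit (Fin 4) D)) 1 :=
    isShift_colMap fun _ i => h.gen.mem i
  have sy : IsShift 𝒟 (colMap k (fun i (_ : Unit) => x i : Matrix (Fin 4) Unit D)) 1 :=
    isShift_colMap fun i _ => h.gen.mem i
  have e1 := degreeRank_augmentation h.finite h.gen _ sx fun a => by
    constructor
    · intro ha
      obtain ⟨b, hb⟩ := h.gen.exists_sum_right ha
      exact ⟨b, by rw [colMap_row, ← hb]⟩
    · rintro ⟨b, hb⟩
      rw [colMap_row] at hb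
      rw [← congrFun hb (), h.gen.zcomp_zero_sum_right]
  have e2 := sR.degreeRank_add h.finite
    (g := colMap k (fun (_ : Unit) i => x i : Matrix Unit (Fin 4) D)) fun u => by
      rw [colMap_row, funext_iff]
      simp only [Pi.zero_apply, forall_const, colMap_apply]
      refine ⟨h.right_gen u, ?_⟩
      rintro ⟨b, rfl⟩
      change dotProduct x (Matrix.mulVec _ b) = 0
      rw [Matrix.dotProduct_mulVec, h.gen_vecMul, zero_dotProduct]
  have e3 := sy.degreeRank_add h.finite (g := colMap k T) fun u => by
    simp_rw [colMap_column]
    constructor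
    · intro hu
      obtain ⟨d, hd⟩ := h.right_T u hu
      exact ⟨fun _ => d, (funext hd).symm⟩
    · rintro ⟨v, rfl⟩
      have : (fun i => x i * v ()) = MulOpposite.op (v ()) • x := rfl
      rw [colMap_apply, this, Matrix.mulVec_smul, h.mulVec_gen, smul_zero]
  have e4 := degreeRank_of_injective h.finite
    (f := colMap k (fun i (_ : Unit) => x i : Matrix (Fin 4) Unit D)) fun u hu => by
      rw [colMap_column] at hu
      funext i
      exact h.right_inj _ (congrFun hu)
  refine sT.exact_of_degreeRank h.finite sR (fun v => ?_) (fun m => ?_) u hu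
  · rw [colMap_apply, colMap_apply, Matrix.mulVec_mulVec, h.R_mul_T, Matrix.zero_mulVec]
  · have a1 := e1 (m + 2)
    have a2 := e2 (m + 1)
    have a3 := e3 (m - 1)
    have a4 := e4 (m - 2)
    have a5 := h.recursion (m + 2)
    simp only [show m + 2 - 1 = m + 1 by ring, show m + 1 - 1 = m by ring, Nat.cast_one,
      show m - 1 - 1 = m - 2 by ring, show m + 2 - 2 = m by ring, show m + 2 - 3 = m - 1 by ring,
      show m + 2 - 4 = m - 2 by ring, Fintype.card_fin, Fintype.card_unit] at a1 a2 a3 a4 a5 ⊢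
    norm_num at a2 a3 a4 ⊢
    linarith

theorem degreeRank_T (m : ℤ) : degreeRank 𝒟 (rowMap k T) m =
    4 * hilb 𝒟 (m + 1) - hilb 𝒟 (m + 2) + (if m + 2 = 0 then 1 else 0) := by
  have sT := isShift_rowMap (k := k) h.T_mem
  have sx : IsShift 𝒟 (rowMap k (fun i (_ : Unit) => x i : Matrix (Fin 4) Unit D)) 1 :=
    isShift_rowMap fun i _ => h.gen.mem i
  have a1 := degreeRank_augmentation h.finite h.gen _ sx (fun a => by
    constructor
    · intro ha
      obtain ⟨b, hb⟩ := h.gen.exists_sum_left ha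
      exact ⟨b, by rw [rowMap_column, ← hb]⟩
    · rintro ⟨b, hb⟩
      rw [rowMap_column] at hb
      rw [← congrFun hb (), h.gen.zcomp_zero_sum_left]) (m + 2)
  have a2 := sT.degreeRank_add h.finite
    (g := rowMap k (fun i (_ : Unit) => x i : Matrix (Fin 4) Unit D)) (fun u => by
      rw [rowMap_column, funext_iff]
      simp only [Pi.zero_apply, forall_const, rowMap_apply]
      refine ⟨h.left_gen u, ?_⟩
      rintro ⟨b, rfl⟩
      change dotProduct (Matrix.vecMul b _) x = 0
      rw [← Matrix.dotProduct_mulVec, h.mulVec_gen, dotProduct_zero]) (m + 1)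
  simp only [show m + 2 - 1 = m + 1 by ring, show m + 1 - 1 = m by ring, Nat.cast_one,
    Fintype.card_fin] at a1 a2
  push_cast at a2
  linarith

omit [Nontrivial D] in
theorem degreeRank_R_zero : degreeRank 𝒟 (rowMap k R) 0 = 4 := by
  have h1 := degreeRank_add_finrank_ker h.finite (rowMap k R) 0
  have hbot : vpart 𝒟 (Fin 4) 0 ⊓ LinearMap.ker (rowMap k R) = ⊥ := by
    rw [eq_bot_iff]
    rintro u ⟨hu, hu0⟩
    choose c hc using fun i => h.gen.exists_scalar_of_mem (mem_vpart.1 hu i)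
    have hc' : u = fun i => algebraMap k D (c i) := funext hc
    have hc0 : c = 0 := h.minimal c (by rw [← hc']; exact hu0)
    rw [Submodule.mem_bot, hc', hc0]
    funext i
    exact map_zero _
  rw [hbot, finrank_bot, h.hilb_values.1] at h1
  simpa using h1

/-- No Euler characteristic count is available yet, as the left complex is only known to be exact
near `k`; the exactness of the right complex is used instead to reduce the degree. -/
theorem exists_vecMul_R (z : Fin 6 → D) (hz : Matrix.vecMul z T = 0) :
    ∃ a, Matrix.vecMul a R = z := by
  have hRT : ∀ v, rowMap k T (rowMap k R v) = 0 := fun v => by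
    rw [rowMap_apply, rowMap_apply, Matrix.vecMul_vecMul, h.R_mul_T, Matrix.vecMul_zero]
  have sR := isShift_rowMap (k := k) h.R_mem
  have sT := isShift_rowMap (k := k) h.T_mem
  obtain ⟨v0, v1, v2, v3, v4⟩ := h.hilb_values
  have hle : LinearMap.ker (rowMap k T) ≤ LinearMap.range (rowMap k R) := by
    refine le_of_low_degree (𝒟 := 𝒟) h.gen.mem (fun u hu m => ?_) ?_ ?_ ?_ ?_
    · have := sT m u
      rw [LinearMap.mem_ker.1 hu, map_zero] at this
      exact LinearMap.mem_ker.2 this.symm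
    · rintro i _ ⟨a, rfl⟩
      refine ⟨x i • a, ?_⟩
      rw [rowMap_apply, Matrix.smul_vecMul]
      rfl
    -- In degree zero `T` has rank `4·4 - 10 = 6`, so it is injective.
    · intro u hu hu0
      have a1 := degreeRank_add_finrank_ker h.finite (rowMap k T) 0
      have a2 := h.degreeRank_T 0
      norm_num [v0, v1, v2] at a1 a2
      rw [a2] at a1
      have := finite_vpart h.finite (Fin 6) 0
      have hbot := Submodule.finrank_eq_zero.1 (show Module.finrank k
        ↥(vpart 𝒟 (Fin 6) 0 ⊓ LinearMap.ker (rowMap k T)) = 0 by omega)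
      have : u ∈ vpart 𝒟 (Fin 6) 0 ⊓ LinearMap.ker (rowMap k T) := ⟨hu0, hu⟩
      rw [hbot, Submodule.mem_bot] at this
      rw [this]
      exact zero_mem _
    -- In degree one the kernel of `T` has dimension `6·4 - 20 = 4`, the rank of `R` on scalars.
    · intro u hu hu1
      have a1 := degreeRank_add_finrank_ker h.finite (rowMap k T) 1
      have a2 := h.degreeRank_T 1
      have a3 := h.degreeRank_R_zero
      norm_num [v1, v2, v3] at a1 a2
      rw [a2] at a1
      have := finite_vpart h.finite (Fin 6) 1
      have hle : (vpart 𝒟 (Fin 4) 0).map (rowMap k R) ≤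
          vpart 𝒟 (Fin 6) 1 ⊓ LinearMap.ker (rowMap k T) := by
        rintro _ ⟨v, hv, rfl⟩
        exact ⟨by simpa using sR.mem hv, hRT v⟩
      have hfin : Module.Finite k ↥(vpart 𝒟 (Fin 6) 1 ⊓ LinearMap.ker (rowMap k T)) :=
        Submodule.finiteDimensional_of_le inf_le_left
      have heq := Submodule.eq_of_le_of_finrank_eq hle (by
        unfold degreeRank at a3
        omega)
      obtain ⟨v, -, hv⟩ := heq.ge ⟨hu1, hu⟩
      exact ⟨v, hv⟩
    -- With `z = x ζ`, the right complex gives `ζ T = R θ` and `θ y = T λ`. The entries of `λ` have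
    -- degree `m - 1 > 0`, so `λ = μ y`; then `θ - T μ` kills `y` and equals `ν T`. Consequently `ζ
    -- - R ν` has rows in the kernel of `T`, and `x (ζ - R ν) = z`.
    · intro m hm z hz hzm
      obtain ⟨ζ, hζ, hxζ⟩ := matrix_exists_eq_gen_mul h.gen (by omega) hzm
      have hz0 : Matrix.vecMul z T = 0 := hz
      obtain ⟨θ, hθ, hRθ⟩ := matrix_exists_mul h.R_mem (M' := fun (_ : Unit) i => x i)
        (fun u hu => h.right_gen u (congrFun hu ())) (U := ζ * T)
        (mul_mem_zpart_of_mem hζ h.T_mem) (by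
          ext i j
          have : Matrix.vecMul x (ζ * T) j = 0 := by
            rw [← Matrix.vecMul_vecMul, hxζ, hz0]; rfl
          exact this)
      let y : Matrix (Fin 4) Unit D := fun i _ => x i
      have hTy : T * y = 0 := by
        ext i j
        exact congrFun h.mulVec_gen i
      obtain ⟨lam, hlam, hTlam⟩ := matrix_exists_mul h.T_mem (M' := R) h.exists_T_mulVec
        (U := θ * y) (mul_mem_zpart_of_mem hθ fun i _ => h.gen.mem i) (by
          rw [← Matrix.mul_assoc, hRθ, Matrix.mul_assoc, hTy, Matrix.mul_zero])
      choose mu hmu using fun i => h.gen.exists_sum_left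
        (zcomp_of_mem_ne (hlam i ()) (by omega : m - 1 ≠ 0))
      have hmu' : lam = Matrix.of mu * y := by
        ext i j
        exact hmu i
      choose nu hnu using fun l => h.left_gen ((θ - T * Matrix.of mu) l) (by
        have : (θ - T * Matrix.of mu) * y = 0 := by
          rw [Matrix.sub_mul, Matrix.mul_assoc, ← hmu', hTlam, sub_self]
        exact congrFun (congrFun this l) ())
      have hnu' : Matrix.of nu * T = θ - T * Matrix.of mu := by
        ext l j
        exact congrFun (hnu l) j
      have hker : (ζ - R * Matrix.of nu) * T = 0 := by
        rw [Matrix.sub_mul, Matrix.mul_assoc, hnu', Matrix.mul_sub, ← Matrix.mul_assoc, h.R_mul_T,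
          Matrix.zero_mul, sub_zero, hRθ, sub_self]
      refine ⟨ζ - R * Matrix.of nu, fun i => congrFun hker i, ?_⟩
      have hz' : Matrix.vecMul x (ζ - R * Matrix.of nu) = z := by
        rw [Matrix.vecMul_sub, hxζ, ← Matrix.vecMul_vecMul, h.gen_vecMul, Matrix.zero_vecMul,
          sub_zero]
      rw [← hz']
      funext j
      rw [Finset.sum_apply]
      rfl
  exact hle hz

theorem vecMul_T_eq_zero_iff (b : Fin 6 → D) :
    Matrix.vecMul b T = 0 ↔ ∃ a, Matrix.vecMul a R = b := by
  refine ⟨h.exists_vecMul_R b, ?_⟩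
  rintro ⟨a, rfl⟩
  rw [Matrix.vecMul_vecMul, h.R_mul_T, Matrix.vecMul_zero]

theorem degreeRank_R (m : ℤ) : degreeRank 𝒟 (rowMap k R) m = 6 * hilb 𝒟 (m + 1) -
    4 * hilb 𝒟 (m + 2) + hilb 𝒟 (m + 3) - (if m + 3 = 0 then 1 else 0) := by
  have a1 := h.degreeRank_T (m + 1)
  have a2 := (isShift_rowMap (k := k) h.R_mem).degreeRank_add h.finite (g := rowMap k T)
    h.vecMul_T_eq_zero_iff (m + 1)
  simp only [show m + 1 + 1 = m + 2 by ring, show m + 1 + 2 = m + 3 by ring,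
    show m + 1 - 1 = m by ring, Nat.cast_one, Fintype.card_fin] at a1 a2
  push_cast at a2
  linarith

/-- The same reduction of degree as in `exists_vecMul_R`, one place further along the right complex,
with the previous exactness as an input. -/
theorem exists_mul_gen (z : Fin 4 → D) (hz : Matrix.vecMul z R = 0) :
    ∃ c : D, (fun i => c * x i) = z := by
  have sR := isShift_rowMap (k := k) h.R_mem
  have sx : IsShift 𝒟 (rowMap k (fun (_ : Unit) i => x i : Matrix Unit (Fin 4) D)) 1 :=
    isShift_rowMap fun _ i => h.gen.mem i
  obtain ⟨v0, v1, v2, v3, v4⟩ := h.hilb_values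
  have hle : LinearMap.ker (rowMap k R) ≤
      LinearMap.range (rowMap k (fun (_ : Unit) i => x i : Matrix Unit (Fin 4) D)) := by
    refine le_of_low_degree (𝒟 := 𝒟) h.gen.mem (fun u hu m => ?_) ?_ ?_ ?_ ?_
    · have := sR m u
      rw [LinearMap.mem_ker.1 hu, map_zero] at this
      exact LinearMap.mem_ker.2 this.symm
    · rintro i _ ⟨a, rfl⟩
      refine ⟨x i • a, ?_⟩
      rw [rowMap_single, rowMap_single]
      funext j
      exact mul_assoc _ _ _
    · intro u hu hu0
      have a1 := degreeRank_add_finrank_ker h.finite (rowMap k R) 0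
      rw [h.degreeRank_R_zero, v0] at a1
      have := finite_vpart h.finite (Fin 4) 0
      norm_num at a1
      have : u ∈ vpart 𝒟 (Fin 4) 0 ⊓ LinearMap.ker (rowMap k R) := ⟨hu0, hu⟩
      rw [a1, Submodule.mem_bot] at this
      rw [this]
      exact zero_mem _
    -- In degree one `R` has rank `6·10 - 4·20 + 35 = 15` on a space of dimension `16`, and `x`
    -- spans the kernel.
    · intro u hu hu1
      have a1 := degreeRank_add_finrank_ker h.finite (rowMap k R) 1
      have a2 := h.degreeRank_R 1
      norm_num [v1, v2, v3, v4] at a1 a2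
      rw [a2] at a1
      have hxu : x ∈ vpart 𝒟 (Fin 4) 1 ⊓ LinearMap.ker (rowMap k R) :=
        ⟨mem_vpart.2 h.gen.mem, h.gen_vecMul⟩
      have hx0 : (⟨x, hxu⟩ : ↥(vpart 𝒟 (Fin 4) 1 ⊓ LinearMap.ker (rowMap k R))) ≠ 0 := by
        intro h0
        have h0' : x = 0 := congrArg Subtype.val h0
        exact one_ne_zero (h.right_inj 1 fun i => by rw [h0']; simp)
      have hone : Module.finrank k ↥(vpart 𝒟 (Fin 4) 1 ⊓ LinearMap.ker (rowMap k R)) = 1 := by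
        omega
      obtain ⟨c, hc⟩ := (finrank_eq_one_iff_of_nonzero' _ hx0).1 hone ⟨u, hu1, hu⟩
      refine ⟨fun _ => algebraMap k D c, ?_⟩
      have hc' : c • x = u := congrArg Subtype.val hc
      rw [rowMap_single, ← hc']
      funext i
      exact (Algebra.smul_def c (x i)).symm
    -- The chase now reads `ζ R = R θ`, `θ T = T λ`, `λ y = y ρ`, and `ρ = s y` because its degree
    -- `m - 1` is positive. Returning, `λ - y s = t T` and `θ - T t = ν R`, so the rows of `ζ - R ν`
    -- are killed by `R`.
    · intro m hm z hz hzm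
      obtain ⟨ζ, hζ, hxζ⟩ := matrix_exists_eq_gen_mul h.gen (by omega) hzm
      have hz0 : Matrix.vecMul z R = 0 := hz
      obtain ⟨θ, hθ, hRθ⟩ := matrix_exists_mul h.R_mem (M' := fun (_ : Unit) i => x i)
        (fun u hu => h.right_gen u (congrFun hu ())) (U := ζ * R)
        (mul_mem_zpart_of_mem hζ h.R_mem) (by
          ext i j
          have : Matrix.vecMul x (ζ * R) j = 0 := by
            rw [← Matrix.vecMul_vecMul, hxζ, hz0]; rfl
          exact this)
      let y : Matrix (Fin 4) Unit D := fun i _ => x i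
      have hTy : T * y = 0 := by
        ext i j
        exact congrFun h.mulVec_gen i
      obtain ⟨lam, hlam, hTlam⟩ := matrix_exists_mul h.T_mem (M' := R) h.exists_T_mulVec
        (U := θ * T) (mul_mem_zpart_of_mem hθ h.T_mem) (by
          rw [← Matrix.mul_assoc, hRθ, Matrix.mul_assoc, h.R_mul_T, Matrix.mul_zero])
      have hcol : ∀ u, T.mulVec u = 0 → ∃ v, y.mulVec v = u := by
        intro u hu
        obtain ⟨d, hd⟩ := h.right_T u hu
        exact ⟨fun _ => d, (colMap_column (k := k) x fun _ => d).trans (funext hd).symm⟩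
      obtain ⟨rho, hrho, hyrho⟩ := matrix_exists_mul (M := y) (fun i _ => h.gen.mem i) (M' := T)
        hcol
        (U := lam * y) (mul_mem_zpart_of_mem hlam fun i _ => h.gen.mem i) (by
          rw [← Matrix.mul_assoc, hTlam, Matrix.mul_assoc, hTy, Matrix.mul_zero])
      choose s hs using fun i => h.gen.exists_sum_left
        (zcomp_of_mem_ne (hrho i ()) (by omega : m - 1 ≠ 0))
      have hs' : rho = Matrix.of s * y := by
        ext i j
        exact hs i
      choose t ht using fun l => h.left_gen ((lam - y * Matrix.of s) l) (by
        have : (lam - y * Matrix.of s) * y = 0 := by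
          rw [Matrix.sub_mul, Matrix.mul_assoc, ← hs', hyrho, sub_self]
        exact congrFun (congrFun this l) ())
      have ht' : Matrix.of t * T = lam - y * Matrix.of s := by
        ext l j
        exact congrFun (ht l) j
      have hT0 : (θ - T * Matrix.of t) * T = 0 := by
        rw [Matrix.sub_mul, Matrix.mul_assoc, ht', Matrix.mul_sub, hTlam, ← Matrix.mul_assoc, hTy,
          Matrix.zero_mul, sub_zero, sub_self]
      choose nu hnu using fun l => h.exists_vecMul_R ((θ - T * Matrix.of t) l) (congrFun hT0 l)
      have hnu' : Matrix.of nu * R = θ - T * Matrix.of t := by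
        ext l j
        exact congrFun (hnu l) j
      have hker : (ζ - R * Matrix.of nu) * R = 0 := by
        rw [Matrix.sub_mul, Matrix.mul_assoc, hnu', Matrix.mul_sub, ← Matrix.mul_assoc, h.R_mul_T,
          Matrix.zero_mul, sub_zero, hRθ, sub_self]
      refine ⟨ζ - R * Matrix.of nu, fun i => congrFun hker i, ?_⟩
      have hz' : Matrix.vecMul x (ζ - R * Matrix.of nu) = z := by
        rw [Matrix.vecMul_sub, hxζ, ← Matrix.vecMul_vecMul, h.gen_vecMul, Matrix.zero_vecMul,
          sub_zero]
      rw [← hz']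
      funext j
      rw [Finset.sum_apply]
      rfl
  obtain ⟨v, hv⟩ := hle hz
  exact ⟨v (), by rw [← hv, rowMap_single]⟩

theorem vecMul_R_eq_zero_iff (a : Fin 4 → D) :
    Matrix.vecMul a R = 0 ↔ ∃ c : D, (fun i => c * x i) = a := by
  refine ⟨h.exists_mul_gen a, ?_⟩
  rintro ⟨c, rfl⟩
  have : (fun i => c * x i) = c • x := rfl
  rw [this, Matrix.smul_vecMul, h.gen_vecMul, smul_zero]

/-- Exactness at all other places determines the rank of multiplication by `x` in each degree, and
by the recursion it is the full dimension. -/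
theorem left_inj (c : D) (hc : ∀ i, c * x i = 0) : c = 0 := by
  have sx : IsShift 𝒟 (rowMap k (fun (_ : Unit) i => x i : Matrix Unit (Fin 4) D)) 1 :=
    isShift_rowMap fun _ i => h.gen.mem i
  have := eq_zero_of_degreeRank h.finite sx (fun m => by
    have a1 := sx.degreeRank_add h.finite (g := rowMap k R) (fun u => by
      simp_rw [rowMap_single]
      rw [rowMap_apply, h.vecMul_R_eq_zero_iff]
      exact ⟨fun ⟨a, h⟩ => ⟨fun _ => a, h⟩, fun ⟨v, h⟩ => ⟨v (), h⟩⟩) (m + 1)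
    have a2 := h.degreeRank_R (m + 1)
    have a3 := h.recursion (m + 4)
    simp only [show m + 1 + 1 = m + 2 by ring, show m + 1 + 2 = m + 3 by ring,
      show m + 1 + 3 = m + 4 by ring, show m + 1 - 1 = m by ring, Nat.cast_one,
      show m + 4 - 1 = m + 3 by ring, show m + 4 - 2 = m + 2 by ring,
      show m + 4 - 3 = m + 1 by ring, show m + 4 - 4 = m by ring, Fintype.card_fin,
      Fintype.card_unit] at a1 a2 a3 ⊢
    push_cast at a1
    linarith) (fun _ => c) (by
      rw [rowMap_single]
      exact funext hc)
  exact congrFun this ()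

end LinearComplex

end Linear

end TypeA

namespace TypeA

/-! ### Transposition to the opposite ring and the global dimension -/

section Opposite

variable {D : Type u} [Ring D] {ι κ τ : Type} [Fintype ι] [Fintype κ]

/-- The transpose of a matrix, with entries in the opposite ring. -/
def opMatrix {ι κ : Type} (M : Matrix ι κ D) : Matrix κ ι Dᵐᵒᵖ := M.transpose.map MulOpposite.op

omit [Fintype κ] in
theorem opMatrix_mulVec (M : Matrix ι κ D) (u : ι → Dᵐᵒᵖ) :
    (opMatrix M).mulVec u = fun i => MulOpposite.op (Matrix.vecMul (fun j => (u j).unop) M i) := by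
  funext i
  refine MulOpposite.unop_injective ?_
  simp [opMatrix, Matrix.mulVec, Matrix.vecMul, dotProduct]

omit [Fintype ι] in
theorem vecMul_opMatrix (M : Matrix ι κ D) (u : κ → Dᵐᵒᵖ) :
    Matrix.vecMul u (opMatrix M) =
      fun i => MulOpposite.op (M.mulVec (fun j => (u j).unop) i) := by
  funext i
  refine MulOpposite.unop_injective ?_
  simp [opMatrix, Matrix.mulVec, Matrix.vecMul, dotProduct]

omit [Fintype ι] in
theorem opMatrix_mul (M : Matrix ι κ D) (N : Matrix κ τ D) :
    opMatrix (M * N) = opMatrix N * opMatrix M := by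
  ext i j
  refine MulOpposite.unop_injective ?_
  simp [opMatrix, Matrix.mul_apply]

theorem opMatrix_zero {ι κ : Type} : opMatrix (0 : Matrix ι κ D) = 0 := by
  ext i j
  rfl

omit [Ring D] [Fintype ι] in
theorem op_funext_iff {u : ι → D} {v : ι → Dᵐᵒᵖ} :
    (fun i => MulOpposite.op (u i)) = v ↔ u = fun i => (v i).unop := by
  constructor
  · rintro rfl; rfl
  · rintro rfl; rfl

end Opposite

namespace LinearComplex

variable {k : Type u} [Field k] {D : Type u} [Ring D] [Algebra k D] {𝒟 : ℕ → Submodule k D}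
  [GradedAlgebra 𝒟] {x : Fin 4 → D} {R : Matrix (Fin 4) (Fin 6) D} {T : Matrix (Fin 6) (Fin 4) D}
  (h : LinearComplex 𝒟 x R T) [Nontrivial D]
include h

/-- The upper bound uses the resolution of `k` by right modules, through `Tor`; the lower bound uses
the one by left modules. -/
theorem leftGlobalDimension_eq : leftGlobalDimension D = 4 := by
  refine le_antisymm ?_ ?_
  · refine leftGlobalDimension_le_four h.gen (A₁ := fun _ i => x i) rfl (A₂ := R) (A₃ := T)
      (A₄ := fun i _ => x i) h.R_mem h.T_mem (fun i _ => h.gen.mem i) ?_ h.R_mul_T ?_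
      (fun u hu => h.right_gen u (congrFun hu 0)) h.exists_T_mulVec (fun u hu => ?_) fun u hu => ?_
    · ext i j
      exact congrFun h.gen_vecMul j
    · ext i j
      exact congrFun h.mulVec_gen i
    · obtain ⟨d, hd⟩ := h.right_T u hu
      refine ⟨fun _ => d, funext fun i => ?_⟩
      rw [hd]
      exact Fintype.sum_unique fun _ : Fin 1 => x i * d
    · funext j
      rw [Subsingleton.elim j 0]
      refine h.right_inj _ fun i => ?_
      exact (Fintype.sum_unique fun l : Fin 1 => x i * u l).symm.trans (congrFun hu i)
  · refine four_le_leftGlobalDimension h.gen (T := T) (fun a => ⟨h.left_gen a, ?_⟩) (L := R)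
      h.vecMul_T_eq_zero_iff h.gen.mem h.vecMul_R_eq_zero_iff h.left_inj
    rintro ⟨b, rfl⟩
    change dotProduct (Matrix.vecMul b _) x = 0
    rw [← Matrix.dotProduct_mulVec, h.mulVec_gen, dotProduct_zero]

/-- Over `Dᵐᵒᵖ` the transposes of `T` and `R` exchange roles, and so do the two resolutions. -/
theorem rightGlobalDimension_eq : rightGlobalDimension D = 4 := by
  have hgr : GradedAlgebra (opGrading 𝒟) := opGradedAlgebra
  have hx := h.gen.op
  have hRop : ∀ i j, opMatrix R i j ∈ opGrading 𝒟 1 := fun i j => mem_opGrading.2 (h.R_mem j i)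
  have hTop : ∀ i j, opMatrix T i j ∈ opGrading 𝒟 1 := fun i j => mem_opGrading.2 (h.T_mem j i)
  have hsum : ∀ u : Fin 4 → Dᵐᵒᵖ, ∑ i, MulOpposite.op (x i) * u i = 0 →
      ∑ i, (u i).unop * x i = 0 := by
    intro u hu
    simpa using congrArg MulOpposite.unop hu
  have hsum' : ∀ u : Fin 4 → Dᵐᵒᵖ, ∑ i, u i * MulOpposite.op (x i) = 0 ↔
      ∑ i, x i * (u i).unop = 0 := by
    intro u
    rw [← MulOpposite.unop_inj]
    simp
  have hmul : ∀ (c : Dᵐᵒᵖ) (a : Fin 4 → Dᵐᵒᵖ), (fun i => c * MulOpposite.op (x i)) = a ↔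
      (fun i => x i * c.unop) = fun i => (a i).unop := by
    intro c a
    rw [← op_funext_iff]
    rfl
  refine le_antisymm ?_ ?_
  · refine leftGlobalDimension_le_four (E := Dᵐᵒᵖ) hx (A₁ := fun _ i => MulOpposite.op (x i)) rfl
      (A₂ := opMatrix T) (A₃ := opMatrix R) (A₄ := fun i _ => MulOpposite.op (x i)) hTop hRop
      (fun i _ => hx.mem i) ?_ ?_ ?_
      (fun u hu => ?_) (fun u hu => ?_) (fun u hu => ?_) fun u hu => ?_
    · ext i j
      let y : Matrix (Fin 4) (Fin 1) D := fun i _ => x i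
      have h1 := opMatrix_mul T y
      have h2 : T * y = 0 := by
        ext i j
        exact congrFun h.mulVec_gen i
      rw [h2, opMatrix_zero] at h1
      exact (congrFun (congrFun h1 i) j).symm
    · rw [← opMatrix_mul, h.R_mul_T, opMatrix_zero]
    · let y : Matrix (Fin 1) (Fin 4) D := fun _ i => x i
      have h1 := opMatrix_mul y R
      have h2 : y * R = 0 := by
        ext i j
        exact congrFun h.gen_vecMul j
      rw [h2, opMatrix_zero] at h1
      exact h1.symm
    · obtain ⟨b, hb⟩ := h.left_gen _ (hsum u (congrFun hu 0))
      refine ⟨fun j => MulOpposite.op (b j), ?_⟩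
      rw [opMatrix_mulVec, op_funext_iff]
      exact hb
    · rw [opMatrix_mulVec, op_funext_iff] at hu
      obtain ⟨a, ha⟩ := h.exists_vecMul_R _ hu
      refine ⟨fun j => MulOpposite.op (a j), ?_⟩
      rw [opMatrix_mulVec, op_funext_iff]
      exact ha
    · rw [opMatrix_mulVec, op_funext_iff] at hu
      obtain ⟨c, hc⟩ := h.exists_mul_gen _ hu
      refine ⟨fun _ => MulOpposite.op c, ?_⟩
      refine Eq.trans ?_ (op_funext_iff.2 hc)
      funext i
      exact Fintype.sum_unique fun _ : Fin 1 => MulOpposite.op (x i) * MulOpposite.op c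
    · funext j
      rw [Subsingleton.elim j 0]
      refine MulOpposite.unop_injective (h.left_inj _ fun i => ?_)
      have h1 := congrFun hu i
      have h2 : MulOpposite.op (x i) * u 0 = 0 :=
        (Fintype.sum_unique fun l : Fin 1 => MulOpposite.op (x i) * u l).symm.trans h1
      exact congrArg MulOpposite.unop h2
  · refine four_le_leftGlobalDimension (E := Dᵐᵒᵖ) hx (T := opMatrix R) (fun a => ?_)
      (L := opMatrix T) (fun b => ?_) hx.mem (fun a => ?_) fun c hc => ?_
    · rw [hsum']
      constructor
      · intro ha
        obtain ⟨b, hb⟩ := h.right_gen _ ha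
        refine ⟨fun j => MulOpposite.op (b j), ?_⟩
        rw [vecMul_opMatrix, op_funext_iff]
        exact hb
      · rintro ⟨b, hb⟩
        rw [vecMul_opMatrix, op_funext_iff] at hb
        change dotProduct x (fun i => (a i).unop) = 0
        rw [← hb, Matrix.dotProduct_mulVec, h.gen_vecMul, zero_dotProduct]
    · rw [vecMul_opMatrix, op_funext_iff]
      constructor
      · intro hb
        obtain ⟨v, hv⟩ := h.exists_T_mulVec _ hb
        refine ⟨fun j => MulOpposite.op (v j), ?_⟩
        rw [vecMul_opMatrix, op_funext_iff]
        exact hv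
      · rintro ⟨v, hv⟩
        rw [vecMul_opMatrix, op_funext_iff] at hv
        rw [← hv, Matrix.mulVec_mulVec, h.R_mul_T, Matrix.zero_mulVec]
        rfl
    · rw [vecMul_opMatrix, op_funext_iff]
      constructor
      · intro ha
        obtain ⟨d, hd⟩ := h.right_T _ ha
        exact ⟨MulOpposite.op d, (hmul _ _).2 (funext hd).symm⟩
      · rintro ⟨c, hc⟩
        rw [hmul] at hc
        rw [← hc]
        have : (fun i => x i * c.unop) = c • x := rfl
        rw [this, Matrix.mulVec_smul, h.mulVec_gen, smul_zero]
        rfl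
    · refine MulOpposite.unop_injective (h.right_inj _ fun i => ?_)
      exact congrArg MulOpposite.unop (hc i)

theorem hasGlobalDimension : HasGlobalDimension D 4 :=
  ⟨h.rightGlobalDimension_eq, h.leftGlobalDimension_eq⟩

end LinearComplex

end TypeA

namespace TypeA

/-! ### Leading monomials and gradings of the algebras `A`, `B`, `C` -/

namespace Relations

variable {k : Type u} [Field k] (P : Relations k)

/-- The vector `![2, 0, 1]` records the order of the relations of `A`, with leading monomials `x₃²`,
`x₃x₁`, `x₃x₂`. -/
theorem relA_lower (j : Fin 3) : word (FreeAlgebra.ι k) [2, ![2, 0, 1] j] - P.relA j ∈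
    lowerForms k [2, (![2, 0, 1] : Fin 3 → Fin 3) j] := by
  fin_cases j
  · simpa [relA] using P.lower₁
  · simpa [relA] using P.lower₂
  · simpa [relA] using P.lower₃

theorem relB_lower (j : Fin 3) : word (FreeAlgebra.ι k) [2, j] - P.relB j ∈
    lowerForms k [2, j] := by
  fin_cases j
  · simpa [relB] using P.lower₄
  · simpa [relB] using P.lower₅
  · simpa [relB] using P.lower₆

theorem relC_lower (j : Fin 2) : word (FreeAlgebra.ι k) [1, ![1, 0] j, 0] - P.relC j ∈
    lowerForms k [1, (![1, 0] : Fin 2 → Fin 2) j, 0] := by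
  fin_cases j
  · simpa [relC] using P.lower₇
  · simpa [relC] using P.lower₈

theorem mem_degreePart_of_lower {n N : ℕ} {lead : List (Fin n)} {r : FreeAlgebra k (Fin n)}
    (hN : lead.length = N) (h : word (FreeAlgebra.ι k) lead - r ∈ lowerForms k lead) :
    r ∈ degreePart k (FreeAlgebra.ι k) N := by
  subst hN
  have := word_sub_mem_degreePart h
  rwa [sub_sub_cancel] at this

theorem relA_mem (j : Fin 3) : P.relA j ∈ degreePart k (FreeAlgebra.ι k) (1 + 1) :=
  mem_degreePart_of_lower rfl (P.relA_lower j)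

theorem relB_mem (j : Fin 3) : P.relB j ∈ degreePart k (FreeAlgebra.ι k) (1 + 1) :=
  mem_degreePart_of_lower rfl (P.relB_lower j)

theorem relC_mem (j : Fin 2) : P.relC j ∈ degreePart k (FreeAlgebra.ι k) (2 + 1) :=
  mem_degreePart_of_lower rfl (P.relC_lower j)

theorem linearIndependent_relA : LinearIndependent k P.relA :=
  linearIndependent_of_leading (lead := fun j => [2, (![2, 0, 1] : Fin 3 → Fin 3) j])
    (by decide) P.relA_lower

theorem linearIndependent_relB : LinearIndependent k P.relB :=
  linearIndependent_of_leading (lead := fun j => [2, j]) (by decide) P.relB_lower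

theorem linearIndependent_relC : LinearIndependent k P.relC :=
  linearIndependent_of_leading (lead := fun j => [1, (![1, 0] : Fin 2 → Fin 2) j, 0])
    (by decide) P.relC_lower

theorem gen_mul_gen_of_lower {r : Fin 3 → FreeAlgebra k (Fin 3)} {σ : Fin 3 → Fin 3}
    (hσ : Function.Surjective σ)
    (h : ∀ j, word (FreeAlgebra.ι k) [2, σ j] - r j ∈ lowerForms k [2, σ j]) (j : Fin 3) :
    ∃ f ∈ lowerForms k [2, j], gen r 2 * gen r j = FreeAlgebra.lift k (gen r) f := by
  obtain ⟨j, rfl⟩ := hσ j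
  refine ⟨_, h j, ?_⟩
  rw [map_sub, lift_gen_relation, sub_zero]
  simp [word]

/-- The letters of `A` among those of `D`. -/
def lettersA : Fin 3 → Fin 4 := ![0, 1, 2]

/-- The letters of `B` among those of `D`. -/
def lettersB : Fin 3 → Fin 4 := ![0, 1, 3]

theorem relD_A (j : Fin 3) : P.relD (j.castLE (by omega)) =
    FreeAlgebra.lift k (fun i => FreeAlgebra.ι k (lettersA i)) (P.relA j) := by
  fin_cases j <;> rfl

theorem relD_B (j : Fin 3) : P.relD (j.natAdd 3) =
    FreeAlgebra.lift k (fun i => FreeAlgebra.ι k (lettersB i)) (P.relB j) := by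
  fin_cases j <;> rfl

theorem relD_cases {p : FreeAlgebra k (Fin 4) → Prop}
    (hA : ∀ j, p (FreeAlgebra.lift k (fun i => FreeAlgebra.ι k (lettersA i)) (P.relA j)))
    (hB : ∀ j, p (FreeAlgebra.lift k (fun i => FreeAlgebra.ι k (lettersB i)) (P.relB j)))
    (j : Fin 6) : p (P.relD j) := by
  fin_cases j
  · exact hA 0
  · exact hA 1
  · exact hA 2
  · exact hB 0
  · exact hB 1
  · exact hB 2

theorem lift_ι_mem_degreePart {X Y : Type} (σ : X → Y) {n : ℕ} {f : FreeAlgebra k X}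
    (hf : f ∈ degreePart k (FreeAlgebra.ι k) n) :
    FreeAlgebra.lift k (fun i => FreeAlgebra.ι k (σ i)) f ∈
      degreePart k (FreeAlgebra.ι k (X := Y)) n := by
  have h1 := lift_mem_degreePart (x := fun i => FreeAlgebra.ι k (σ i)) hf
  refine Submodule.span_mono ?_ h1
  rintro _ ⟨w, rfl, rfl⟩
  exact ⟨w.map σ, by simp, by simp [word, Function.comp_def]⟩

theorem relD_mem (j : Fin 6) : P.relD j ∈ degreePart k (FreeAlgebra.ι k) 2 :=
  P.relD_cases (p := fun f => f ∈ degreePart k (FreeAlgebra.ι k) 2)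
    (fun j => lift_ι_mem_degreePart _ (P.relA_mem j))
    (fun j => lift_ι_mem_degreePart _ (P.relB_mem j)) j

noncomputable instance : GradedAlgebra (degreePart k (gen P.relA)) :=
  (isPresentation_gen P.relA).gradedAlgebra fun j => ⟨_, P.relA_mem j⟩

noncomputable instance : GradedAlgebra (degreePart k (gen P.relB)) :=
  (isPresentation_gen P.relB).gradedAlgebra fun j => ⟨_, P.relB_mem j⟩

noncomputable instance : GradedAlgebra (degreePart k (gen P.relC)) :=
  (isPresentation_gen P.relC).gradedAlgebra fun j => ⟨_, P.relC_mem j⟩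

end Relations

/-! ### The structure of a type A algebra and its linear complex -/

namespace TypeAAlgebra

open Relations

variable {k : Type u} [Field k] {D : Type u} [Ring D] [Algebra k D] (P : TypeAAlgebra k D)

theorem isAmalgam : IsAmalgam P.i₁ P.i₂ P.j₁ P.j₂ := isAmalgam_of_isPushout P.isPushout

theorem j₁_gen (i : Fin 3) : P.j₁ (gen P.relA i) = P.x (lettersA i) := by
  fin_cases i <;> rfl

theorem j₂_gen (i : Fin 3) : P.j₂ (gen P.relB i) = P.x (lettersB i) := by
  have h : ∀ j : Fin 2, P.j₂ (gen P.relB j.castSucc) = P.j₁ (gen P.relA j.castSucc) := fun j => by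
    rw [← P.i₂_gen, ← P.i₁_gen, P.isAmalgam.comm]
  fin_cases i
  · exact h 0
  · exact h 1
  · rfl

theorem lift_lettersA (f : FreeAlgebra k (Fin 3)) :
    FreeAlgebra.lift k (fun i => P.x (lettersA i)) f =
      P.j₁ (FreeAlgebra.lift k (gen P.relA) f) := by
  rw [algHom_lift]
  simp_rw [j₁_gen]

theorem lift_lettersB (f : FreeAlgebra k (Fin 3)) :
    FreeAlgebra.lift k (fun i => P.x (lettersB i)) f =
      P.j₂ (FreeAlgebra.lift k (gen P.relB) f) := by
  rw [algHom_lift]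
  simp_rw [j₂_gen]

/-- For the kernel, the maps from `A` and `B` to the presented algebra agree on `C`, so they induce
a map from `D` to it that carries generators to generators. -/
theorem isPresentation : IsPresentation P.x P.relD where
  surjective d := by
    refine P.isAmalgam.mem_of_mem (S := (FreeAlgebra.lift k P.x).range) (fun a => ?_)
      (fun b => ?_) d
    · obtain ⟨a, rfl⟩ := lift_gen_surjective a
      rw [← lift_lettersA, ← lift_lift_ι]
      exact ⟨_, rfl⟩
    · obtain ⟨b, rfl⟩ := lift_gen_surjective b
      rw [← lift_lettersB, ← lift_lift_ι]
      exact ⟨_, rfl⟩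
  relation j := by
    refine P.relD_cases (p := fun f => FreeAlgebra.lift k P.x f = 0) (fun j => ?_) (fun j => ?_) j
    · rw [lift_lift_ι, lift_lettersA, lift_gen_relation, map_zero]
    · rw [lift_lift_ι, lift_lettersB, lift_gen_relation, map_zero]
  mem_idealSpan a ha := by
    have hA : ∀ j, FreeAlgebra.lift k (fun i => gen P.relD (lettersA i)) (P.relA j) = 0 := by
      intro j
      rw [← lift_lift_ι, ← relD_A, lift_gen_relation]
    have hB : ∀ j, FreeAlgebra.lift k (fun i => gen P.relD (lettersB i)) (P.relB j) = 0 := by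
      intro j
      rw [← lift_lift_ι, ← relD_B, lift_gen_relation]
    have hcomm : (presentedLift _ hA).comp P.i₁ = (presentedLift _ hB).comp P.i₂ := by
      refine presented_hom_ext fun j => ?_
      rw [AlgHom.comp_apply, AlgHom.comp_apply, P.i₁_gen, P.i₂_gen, presentedLift_gen,
        presentedLift_gen]
      fin_cases j <;> rfl
    obtain ⟨f, hf₁, hf₂⟩ := P.isAmalgam.exists_desc (presentedLift _ hA) (presentedLift _ hB)
      (DFunLike.congr_fun hcomm)
    have hx : ∀ j, f (P.x j) = gen P.relD j := by
      intro j
      have h₁ := fun i => (hf₁ (gen P.relA i)).trans (presentedLift_gen _ hA i)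
      have h₂ := fun i => (hf₂ (gen P.relB i)).trans (presentedLift_gen _ hB i)
      fin_cases j
      · exact h₁ 0
      · exact h₁ 1
      · exact h₁ 2
      · exact h₂ 2
    refine mem_idealSpan_of_lift_gen_eq_zero ?_
    have := algHom_lift f P.x a
    rw [ha, map_zero] at this
    simp_rw [hx] at this
    exact this.symm

noncomputable instance : GradedAlgebra (degreePart k P.x) :=
  P.isPresentation.gradedAlgebra fun j => ⟨_, P.relD_mem j⟩

theorem hilb_C (m : ℤ) : hilb (degreePart k (gen P.relC)) m - (if m = 0 then 1 else 0) =
    2 * hilb (degreePart k (gen P.relC)) (m - 1) - 2 * hilb (degreePart k (gen P.relC)) (m - 3) +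
      hilb (degreePart k (gen P.relC)) (m - 4) := by
  have := (isPresentation_gen P.relC).hilb_recursion P.regularC P.relC_mem
    P.linearIndependent_relC m
  rw [this]
  norm_num [show m - 1 - 2 = m - 3 by ring, show m - 2 - 2 = m - 4 by ring]

theorem hilb_A (m : ℤ) : hilb (degreePart k (gen P.relA)) m - (if m = 0 then 1 else 0) =
    3 * hilb (degreePart k (gen P.relA)) (m - 1) - 3 * hilb (degreePart k (gen P.relA)) (m - 2) +
      hilb (degreePart k (gen P.relA)) (m - 3) := by
  have := (isPresentation_gen P.relA).hilb_recursion P.regularA P.relA_mem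
    P.linearIndependent_relA m
  rw [this]
  norm_num [show m - 1 - 1 = m - 2 by ring, show m - 2 - 1 = m - 3 by ring]

theorem hilb_B (m : ℤ) : hilb (degreePart k (gen P.relB)) m - (if m = 0 then 1 else 0) =
    3 * hilb (degreePart k (gen P.relB)) (m - 1) - 3 * hilb (degreePart k (gen P.relB)) (m - 2) +
      hilb (degreePart k (gen P.relB)) (m - 3) := by
  have := (isPresentation_gen P.relB).hilb_recursion P.regularB P.relB_mem
    P.linearIndependent_relB m
  rw [this]
  norm_num [show m - 1 - 1 = m - 2 by ring, show m - 2 - 1 = m - 3 by ring]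

theorem gen_mem {X I : Type} (r : I → FreeAlgebra k X) (j : X) :
    gen r j ∈ degreePart k (gen r) 1 :=
  Submodule.subset_span ⟨[j], rfl, by simp [word]⟩

/-- Leading monomials give `A = C + C x₃`; directness follows from the series of `A` being `(1 + t)`
times that of `C`. -/
theorem bijective_extensionMap_A : Function.Bijective (extensionMap P.i₁ (gen P.relA 2)) := by
  have hlow := gen_mul_gen_of_lower (r := P.relA) (σ := ![2, 0, 1]) (by decide) P.relA_lower
  have hsurj := extensionMap_surjective (x := gen P.relA) (z := gen P.relC) P.i₁_gen
    lift_gen_surjective hlow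
  exact ⟨extensionMap_injective (𝒞 := degreePart k (gen P.relC))
    (𝒟 := degreePart k (gen P.relA)) (fun n a ha => map_mem_degreePart P.i₁_gen ha) (gen_mem _ 2)
    (fun n => IsPresentation.finite_degreePart n) (fun n => IsPresentation.finite_degreePart n)
    hsurj (hilb_eq_add (fun m hm => hilb_of_neg _ hm) (fun m hm => hilb_of_neg _ hm)
      P.hilb_A P.hilb_C), hsurj⟩

theorem bijective_extensionMap_B : Function.Bijective (extensionMap P.i₂ (gen P.relB 2)) := by
  have hlow := gen_mul_gen_of_lower (r := P.relB) (σ := id) Function.surjective_id P.relB_lower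
  have hsurj := extensionMap_surjective (x := gen P.relB) (z := gen P.relC) P.i₂_gen
    lift_gen_surjective hlow
  exact ⟨extensionMap_injective (𝒞 := degreePart k (gen P.relC))
    (𝒟 := degreePart k (gen P.relB)) (fun n a ha => map_mem_degreePart P.i₂_gen ha) (gen_mem _ 2)
    (fun n => IsPresentation.finite_degreePart n) (fun n => IsPresentation.finite_degreePart n)
    hsurj (hilb_eq_add (fun m hm => hilb_of_neg _ hm) (fun m hm => hilb_of_neg _ hm)
      P.hilb_B P.hilb_C), hsurj⟩

theorem bijective_leftCombination :
    Function.Bijective (leftCombination (P.j₁.comp P.i₁) (altWord (P.x 2) (P.x 3))) ∧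
    Function.Bijective (leftCombination P.j₁ fun n : ℕ => altWord (P.x 2) (P.x 3) n) ∧
    Function.Bijective (leftCombination P.j₂ fun n : ℕ => altWord (P.x 2) (P.x 3) (-n)) :=
  P.isAmalgam.bijective_leftCombination P.bijective_extensionMap_A P.bijective_extensionMap_B

theorem x_mem (i : Fin 4) : P.x i ∈ degreePart k P.x 1 :=
  Submodule.subset_span ⟨[i], rfl, by simp [word]⟩

/-- As a left `A`-module `D` is free on the alternating words that are empty or begin with `x₄`, one
in each degree; so its series is `(1 - t)⁻³ / (1 - t)`. -/
theorem hilb_D (m : ℤ) : hilb (degreePart k P.x) m - (if m = 0 then 1 else 0) =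
    4 * hilb (degreePart k P.x) (m - 1) - 6 * hilb (degreePart k P.x) (m - 2) +
      4 * hilb (degreePart k P.x) (m - 3) - hilb (degreePart k P.x) (m - 4) := by
  have key := hilb_sub_of_leftCombination (𝒟 := degreePart k P.x)
    (ℰ := degreePart k (gen P.relA)) (fun n => IsPresentation.finite_degreePart n)
    (fun n a ha => map_mem_degreePart P.j₁_gen ha)
    (fun n => (altPair_mem (P.x_mem 2) (P.x_mem 3) n).1) P.bijective_leftCombination.2.1
  have h := P.hilb_A m
  rw [← key, ← key, ← key, ← key, show m - 1 - 1 = m - 2 by ring, show m - 2 - 1 = m - 3 by ring,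
    show m - 3 - 1 = m - 4 by ring] at h
  linarith

theorem injective_j₁ : Function.Injective P.j₁ :=
  injective_of_leftCombination P.bijective_leftCombination.2.1.1 0

theorem injective_j₂ : Function.Injective P.j₂ :=
  injective_of_leftCombination P.bijective_leftCombination.2.2.1 0

include P in
theorem nontrivial : Nontrivial D := by
  have := P.regularA.nontrivial
  exact P.injective_j₁.nontrivial

/-- This is `Hom_C(k, C) = 0`, carried to `D` by its freeness as a left `C`-module. -/
theorem eq_zero_of_x_mul {d : D} (h₀ : P.x 0 * d = 0) (h₁ : P.x 1 * d = 0) : d = 0 := by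
  refine eq_zero_of_leftCombination P.bijective_leftCombination.1 (x := gen P.relC)
    (fun a ha => (isPresentation_gen P.relC).eq_zero_of_gen_mul P.regularC ha) fun i => ?_
  rw [AlgHom.comp_apply, P.i₁_gen]
  fin_cases i
  · exact h₀
  · exact h₁

variable {R : Matrix (Fin 4) (Fin 6) (FreeAlgebra k (Fin 4))}
  {T : Matrix (Fin 6) (Fin 4) (FreeAlgebra k (Fin 4))}

/-- The relations of `A` give `d` for the letters `x₁, x₂, x₃`, and those of `B` give `d'` for `x₁,
x₂, x₄`. The difference `d - d'` is killed by `x₁` and `x₂`, so it vanishes. -/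
theorem exists_eq_x_mul (hT : Matrix.mulVec T (FreeAlgebra.ι k) = P.relD) {u : Fin 4 → D}
    (hu : (T.map (FreeAlgebra.lift k P.x)).mulVec u = 0) : ∃ d, ∀ i, u i = P.x i * d := by
  obtain ⟨TA, -, hTA⟩ := IsPresentation.exists_leftMatrix P.relA_mem
  obtain ⟨TB, -, hTB⟩ := IsPresentation.exists_leftMatrix P.relB_mem
  have hA : ∃ d, ∀ i, u (lettersA i) = P.j₁ (gen P.relA i) * d := by
    refine exists_eq_mul_of_leftCombination (u := fun i => u (lettersA i))
      P.bijective_leftCombination.2.1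
      (fun a ha => (isPresentation_gen P.relA).eq_zero_of_gen_mul P.regularA ha)
      (T := TA.map (FreeAlgebra.lift k (gen P.relA)))
      (fun v hv => (isPresentation_gen P.relA).exists_eq_gen_mul P.regularA hTA hv) fun j => ?_
    have h1 := sum_rightCoefficients_mul (t := TA j) (s := T (j.castLE (by omega)))
      (congrFun hTA j) ((congrFun hT (j.castLE (by omega))).trans (P.relD_A j)) P.x u
    have h2 := congrFun hu (j.castLE (by omega))
    simp_rw [lift_lettersA] at h1
    exact h1.symm.trans h2
  have hB : ∃ d, ∀ i, u (lettersB i) = P.j₂ (gen P.relB i) * d := by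
    refine exists_eq_mul_of_leftCombination (u := fun i => u (lettersB i))
      P.bijective_leftCombination.2.2
      (fun a ha => (isPresentation_gen P.relB).eq_zero_of_gen_mul P.regularB ha)
      (T := TB.map (FreeAlgebra.lift k (gen P.relB)))
      (fun v hv => (isPresentation_gen P.relB).exists_eq_gen_mul P.regularB hTB hv) fun j => ?_
    have h1 := sum_rightCoefficients_mul (t := TB j) (s := T (j.natAdd 3))
      (congrFun hTB j) ((congrFun hT (j.natAdd 3)).trans (P.relD_B j)) P.x u
    have h2 := congrFun hu (j.natAdd 3)
    simp_rw [lift_lettersB] at h1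
    exact h1.symm.trans h2
  obtain ⟨d, hd⟩ := hA
  obtain ⟨d', hd'⟩ := hB
  simp_rw [j₁_gen] at hd
  simp_rw [j₂_gen] at hd'
  have hdd : d - d' = 0 := by
    refine P.eq_zero_of_x_mul ?_ ?_
    · rw [mul_sub, sub_eq_zero]
      exact (hd 0).symm.trans (hd' 0)
    · rw [mul_sub, sub_eq_zero]
      exact (hd 1).symm.trans (hd' 1)
  refine ⟨d, fun i => ?_⟩
  fin_cases i
  · exact hd 0
  · exact hd 1
  · exact hd 2
  · rw [sub_eq_zero.1 hdd]
    exact hd' 2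

/-- Restriction to the relations of `A` and of `B` reduces this to the right-handed Gorenstein
condition there; `j₁` and `j₂` are injective. -/
theorem eq_zero_of_vecMul_R (hR : Matrix.vecMul (FreeAlgebra.ι k) R = P.relD) {v : Fin 4 → k}
    (hv : Matrix.vecMul (fun i => algebraMap k D (v i)) (R.map (FreeAlgebra.lift k P.x)) = 0) :
    v = 0 := by
  obtain ⟨RA, -, hRA⟩ := IsPresentation.exists_rightMatrix P.relA_mem
  obtain ⟨RB, -, hRB⟩ := IsPresentation.exists_rightMatrix P.relB_mem
  have hA : (fun i => v (lettersA i)) = 0 := by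
    refine (isPresentation_gen P.relA).eq_zero_of_vecMul_rightMatrix P.regularA hRA
      (funext fun j => P.injective_j₁ ?_)
    have h1 := sum_mul_leftCoefficients (t := fun i => RA i j)
      (s := fun i => R i (j.castLE (by omega))) (congrFun hRA j)
      ((congrFun hR (j.castLE (by omega))).trans (P.relD_A j)) P.x fun i => algebraMap k D (v i)
    have h2 := congrFun hv (j.castLE (by omega))
    simp_rw [lift_lettersA] at h1
    rw [Pi.zero_apply, map_zero]
    refine Eq.trans ?_ (h1.symm.trans h2)
    simp [Matrix.vecMul, dotProduct]
  have hB : (fun i => v (lettersB i)) = 0 := by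
    refine (isPresentation_gen P.relB).eq_zero_of_vecMul_rightMatrix P.regularB hRB
      (funext fun j => P.injective_j₂ ?_)
    have h1 := sum_mul_leftCoefficients (t := fun i => RB i j)
      (s := fun i => R i (j.natAdd 3)) (congrFun hRB j)
      ((congrFun hR (j.natAdd 3)).trans (P.relD_B j)) P.x fun i => algebraMap k D (v i)
    have h2 := congrFun hv (j.natAdd 3)
    simp_rw [lift_lettersB] at h1
    rw [Pi.zero_apply, map_zero]
    refine Eq.trans ?_ (h1.symm.trans h2)
    simp [Matrix.vecMul, dotProduct]
  funext i
  fin_cases i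
  · exact congrFun hA 0
  · exact congrFun hA 1
  · exact congrFun hA 2
  · exact congrFun hB 2

/-- The scalar matrix `S` is absorbed into `R`; being invertible, it changes neither the image of
`R` on columns nor its minimality. -/
theorem linearComplex (Q : PotentialResolution P.x P.relD) :
    LinearComplex (degreePart k P.x) P.x
      (Q.R.map (FreeAlgebra.lift k P.x) * Q.S.map (algebraMap k D))
      (Q.T.map (FreeAlgebra.lift k P.x)) := by
  have hp := P.isPresentation
  obtain ⟨S', hS'⟩ := isUnit_iff_exists.1 Q.isUnit_S
  have hSS' : Q.S.map (algebraMap k D) * S'.map (algebraMap k D) = 1 := by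
    rw [← Matrix.map_mul, hS'.1, Matrix.map_one _ (map_zero _) (map_one _)]
  have hx := hp.isGeneratedBy
  refine
    { gen := hx
      finite := fun n => IsPresentation.finite_degreePart n
      R_mem := fun i j => ?_
      T_mem := fun i j => lift_mem_degreePart (Q.T_linear i j)
      R_mul_T := Q.R_mul_S_mul_T
      gen_vecMul := by rw [← Matrix.vecMul_vecMul, hp.vecMul_gen_map Q.X_mul_R, Matrix.zero_vecMul]
      mulVec_gen := hp.map_mulVec_gen Q.T_mul_X
      left_gen := fun a ha => (hp.isSyzygyMatrix Q.T_mul_X a).1 ha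
      right_gen := fun a ha => ?_
      right_T := fun u hu => P.exists_eq_x_mul Q.T_mul_X hu
      right_inj := fun d hd => P.eq_zero_of_x_mul (hd 0) (hd 1)
      minimal := fun v hv => P.eq_zero_of_vecMul_R Q.X_mul_R ?_
      recursion := P.hilb_D }
  · rw [Matrix.mul_apply]
    refine Submodule.sum_mem _ fun l _ => ?_
    rw [Matrix.map_apply, Matrix.map_apply, ← Algebra.commutes, ← Algebra.smul_def]
    exact Submodule.smul_mem _ _ (lift_mem_degreePart (Q.R_linear i l))
  · obtain ⟨b, hb⟩ := (hp.sum_gen_mul_eq_zero_iff Q.X_mul_R a).1 ha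
    refine ⟨(S'.map (algebraMap k D)).mulVec b, ?_⟩
    rw [Matrix.mulVec_mulVec, Matrix.mul_assoc, hSS', Matrix.mul_one, hb]
  · rw [← Matrix.vecMul_vecMul] at hv
    have := congrArg (fun a => Matrix.vecMul a (S'.map (algebraMap k D))) hv
    simpa [Matrix.vecMul_vecMul, Matrix.mul_assoc, hSS'] using this

end TypeAAlgebra

end TypeA

theorem theorem1 {k : Type u} [Field k] [IsAlgClosed k] [CharZero k]
    {D : Type u} [Ring D] [Algebra k D] (P : TypeA.TypeAAlgebra k D)
    (hP : Nonempty (TypeA.PotentialResolution P.x P.relD)) :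
    TypeA.HasGlobalDimension D 4 := by
  obtain ⟨Q⟩ := hP
  have := P.nontrivial
  exact (P.linearComplex Q).hasGlobalDimension
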